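/- Let $W(R)=(1+R^2/3)^{-1/2}$ and $\mathcal L u=u_{tt}-u_{rr}-\frac2r u_r-u^5$. For $\nu>3$ and $\varepsilon_0\in\mathbb R$ put $$\lambda(t)=t^{-1-\nu}\exp(-\varepsilon_0\sin(\log t)),\qquad \mu(t)=t\lambda(t),\qquad R=\lambda(t)r\qquad(t>0).$$ For every $\nu>3$ there is $\varepsilon_*>0$ such that for every $|\varepsilon_0|<\varepsilon_*$ there is $T>0$ such that for every $0<t_0<T$ there is a real function $u_2(t,r)$ with the following properties. Each $O(\cdot)$ is a bound that is uniform in $(t,r)$ in the indicated region, with a constant that may depend on $\nu,\varepsilon_0,t_0,k,j$. (i) $u_2\in C^2(\{0<t<t_0,\ 0\le r\le t\})$, and, with $e_2:=\mathcal L u_2$, for $0<t<t_0$, $0<r<t$, $$u_2(t,r)=\sqrt{\lambda(t)}\,\bigl(W(R)+\mu(t)^{-2}O(R)\bigr),\qquad t^2\lambda(t)^{-1/2}e_2(t,r)=\mu(t)^{-2}\,O\!\left(\frac{\log(R+2)}{R+1}\right).$$ (ii) $u_2$ is $C^\infty$ on $\{0<t<t_0,\ 0<r<t/2\}$, and there,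 for all integers $k,j\ge0$, $$\partial_t^k\partial_r^j u_2(t,r)=\partial_t^k\partial_r^j\bigl(\sqrt{\lambda(t)}\,W(\lambda(t)r)\bigr)+t^{-k}r^{-j}\sqrt{\lambda(t)}\,\mu(t)^{-2}O(R),$$ $$\partial_t^k\partial_r^j\bigl(t^2\lambda(t)^{-1/2}e_2(t,r)\bigr)=t^{-k}r^{-j}\mu(t)^{-2}\,O\!\left(\frac{\log(R+2)}{R+1}\right).$$ Moreover $e_2$ is $C^2$ on $\{0<t<t_0,\ 0<r<t\}$, and for $k+j\le2$ both bounds hold on this whole region. (iii) $u_2$ has an extension, again denoted $u_2$, to $\{0<t<t_0,\ r\ge0\}$ that is $C^1$ in $(t,r)$ there and is $C^2$ in $r\in[0,\infty)$ for each fixed $t$, such that for every $\delta>0$ and all sufficiently small $t\in(0,t_0)$, $$\int_t^\infty\bigl[(\partial_r u_2)^2+(\partial_t u_2)^2+u_2^6\bigr](t,r)\,r^2\,dr<\delta .$$ -/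

import Mathlib

open Real Set MeasureTheory
open scoped ContDiff

namespace QuinticWave

noncomputable section

/-- The ground state `W(R) = (1 + R²/3)^{-1/2}`. -/
def W (R : ℝ) : ℝ := (1 + R ^ 2 / 3) ^ (-(1 / 2) : ℝ)

/-- The scaling function `λ(t) = t^{-1-ν} exp(-ε₀ sin(log t))`, for `t > 0`. -/
def lam (ν ε₀ t : ℝ) : ℝ := t ^ (-1 - ν) * exp (-ε₀ * sin (log t))

/-- `μ(t) = t λ(t)`. -/
def mu (ν ε₀ t : ℝ) : ℝ := t * lam ν ε₀ t

/-- The partial derivative `∂_t^k ∂_r^j u (t, r)`. It is only used at interior points of regions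
on which `u` is of class `C^{k+j}`. -/
def pderiv (k j : ℕ) (u : ℝ → ℝ → ℝ) (t r : ℝ) : ℝ :=
  iteratedDeriv k (fun s => iteratedDeriv j (fun ρ => u s ρ) r) t

/-- The radial quintic wave operator `u_tt - u_rr - (2/r) u_r - u⁵`. -/
def quinticOp (u : ℝ → ℝ → ℝ) (t r : ℝ) : ℝ :=
  pderiv 2 0 u t r - pderiv 0 2 u t r - 2 / r * pderiv 0 1 u t r - u t r ^ 5

/-- The bulk term `u₀(t, r) = √λ(t) W(λ(t) r)`. -/
def bulk (ν ε₀ t r : ℝ) : ℝ := √(lam ν ε₀ t) * W (lam ν ε₀ t * r)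

/-- The normalized error `t² λ(t)^{-1/2} (u_tt - u_rr - (2/r) u_r - u⁵)(t, r)` of `u`. -/
def normError (ν ε₀ : ℝ) (u : ℝ → ℝ → ℝ) (t r : ℝ) : ℝ :=
  t ^ 2 * lam ν ε₀ t ^ (-(1 / 2) : ℝ) * quinticOp u t r

/-- The truncated light cone `0 < t < t₀`, `0 ≤ r ≤ t`, of points `(t, r)`. -/
def cone (t₀ : ℝ) : Set (ℝ × ℝ) := {p | 0 < p.1 ∧ p.1 < t₀ ∧ 0 ≤ p.2 ∧ p.2 ≤ p.1}

/-- The open set `0 < t < t₀`, `0 < r < c t`. -/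
def openCone (c t₀ : ℝ) : Set (ℝ × ℝ) := {p | 0 < p.1 ∧ p.1 < t₀ ∧ 0 < p.2 ∧ p.2 < c * p.1}

/-- The symbol bound `∂_t^k ∂_r^j (u - u₀) = t^{-k} r^{-j} √λ μ^{-2} O(R)`, `R = λ r`, on a set
of points `(t, r)`, in the form `∂_t^k ∂_r^j u = ∂_t^k ∂_r^j u₀ + …`. -/
def SolutionBound (ν ε₀ : ℝ) (u : ℝ → ℝ → ℝ) (k j : ℕ) (S : Set (ℝ × ℝ)) : Prop :=
  ∃ C : ℝ, ∀ t r : ℝ, (t, r) ∈ S →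
    |pderiv k j u t r - pderiv k j (bulk ν ε₀) t r| ≤
      C * ((t ^ k)⁻¹ * (r ^ j)⁻¹ * √(lam ν ε₀ t) * (mu ν ε₀ t ^ 2)⁻¹ * (lam ν ε₀ t * r))

/-- The symbol bound `∂_t^k ∂_r^j (t² λ^{-1/2} e) = t^{-k} r^{-j} μ^{-2} O(log(R+2)/(R+1))`,
`R = λ r`, on a set of points `(t, r)`, for the error `e` of `u`. -/
def ErrorBound (ν ε₀ : ℝ) (u : ℝ → ℝ → ℝ) (k j : ℕ) (S : Set (ℝ × ℝ)) : Prop :=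
  ∃ C : ℝ, ∀ t r : ℝ, (t, r) ∈ S →
    |pderiv k j (normError ν ε₀ u) t r| ≤
      C * ((t ^ k)⁻¹ * (r ^ j)⁻¹ * (mu ν ε₀ t ^ 2)⁻¹ *
        (log (lam ν ε₀ t * r + 2) / (lam ν ε₀ t * r + 1)))

/-- The integrand `(u_r² + u_t² + u⁶) r²` of the exterior energy. -/
def energyDensity (u : ℝ → ℝ → ℝ) (t r : ℝ) : ℝ :=
  (pderiv 0 1 u t r ^ 2 + pderiv 1 0 u t r ^ 2 + u t r ^ 6) * r ^ 2

end

end QuinticWave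

/-!
The solution is `u₂ = u₀ + v₁ + v₂`, where `u₀` is the bulk term, whose only error is `∂_t² u₀`.

The first correction solves `(∂_r² + (2/r) ∂_r + 5 u₀⁴) v₁ = ∂_t² u₀` at each fixed time. In the
variable `R = λ r` the right-hand side combines two fixed functions with coefficients depending on
`t` only, so `v₁` combines two solutions of the linearized elliptic equation, which are explicit
because the ground state is. These profiles are `β R + γ` up to `O(log (R + 2) / (R + 1))`; hence
the remaining error `∂_t² v₁` is acceptable except for the part `a(t) r + b(t)` of `v₁`.

The second correction replaces this part by the solution of the free radial wave equation with the
same leading coefficients. Its product with `r` solves the one-dimensional wave equation, so that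
d'Alembert's formula gives it as Taylor remainders, in `r`, of iterated primitives of `a` and `b`
at `t ± r`. Extended by zero to negative times they are `C²`, because they are `O(t^p)` with
`p = (1 + ν) / 2 > 2`; so `v₂` is `C²` across the light cone `r = t`.

All bounds are symbol bounds under `t ∂_t` and `r ∂_r`, which are stable under sums, products and
compositions. Outside the cone `u₂` is cut off in `r / t`; its energy density is bounded for
`t ≤ r ≤ 2 t`, so the exterior energy is `O(t)`.
-/

namespace QuinticWave

open Asymptotics Filter Topology

noncomputable section Symbols

variable {E ι : Type*} [NormedAddCommGroup E] [NormedSpace ℝ E]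

/-- The derivative of `f` along the linear vector field `p ↦ X p`. -/
def fieldDeriv (X : E →L[ℝ] E) (f : E → ℝ) (p : E) : ℝ := fderiv ℝ f p (X p)

/-- A symbol of order `n` and weight `w` on `S`: a `C^n` function all of whose iterated derivatives
of order at most `n` along the linear vector fields `X i` are `O(w)` on `S`. -/
def IsSymbol (X : ι → E →L[ℝ] E) (S : Set E) (w : E → ℝ) : ℕ → (E → ℝ) → Prop
  | 0, f => ContDiffOn ℝ 0 f S ∧ f =O[𝓟 S] w
  | n + 1, f => ContDiffOn ℝ (n + 1 : ℕ) f S ∧ f =O[𝓟 S] w ∧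
      ∀ i, IsSymbol X S w n (fieldDeriv (X i) f)

theorem isBigO_principal_of_nonneg_of_le {α : Type*} {S : Set α} {f g : α → ℝ} {C : ℝ}
    (hf : ∀ x ∈ S, 0 ≤ f x) (hfg : ∀ x ∈ S, f x ≤ C * g x) : f =O[𝓟 S] g :=
  isBigO_principal.2 ⟨|C|, fun x hx => by
    rw [norm_of_nonneg (hf x hx), norm_eq_abs, ← abs_mul]
    exact (hfg x hx).trans (le_abs_self _)⟩

theorem exists_le_of_isBigO_principal {α : Type*} {S : Set α} {f g : α → ℝ}
    (h : f =O[𝓟 S] g) (hg : ∀ x ∈ S, 0 ≤ g x) : ∃ C, 0 ≤ C ∧ ∀ x ∈ S, |f x| ≤ C * g x := by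
  obtain ⟨C, hC, hfg⟩ := h.exists_nonneg
  refine ⟨C, hC, fun x hx => ?_⟩
  simpa [abs_of_nonneg (hg x hx)] using isBigOWith_principal.1 hfg x hx

variable {X : ι → E →L[ℝ] E} {S S' : Set E} {w w₁ w₂ : E → ℝ} {n m : ℕ} {f g : E → ℝ}

theorem fieldDeriv_congr (hS : IsOpen S) (hfg : EqOn f g S) (Y : E →L[ℝ] E) :
    EqOn (fieldDeriv Y f) (fieldDeriv Y g) S := fun p hp => by
  simp only [fieldDeriv, (eventuallyEq_of_mem (hS.mem_nhds hp) hfg).fderiv_eq]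

namespace IsSymbol

theorem contDiffOn (h : IsSymbol X S w n f) : ContDiffOn ℝ n f S := by
  cases n <;> exact h.1

theorem isBigO (h : IsSymbol X S w n f) : f =O[𝓟 S] w := by
  cases n with
  | zero => exact h.2
  | succ n => exact h.2.1

protected theorem fieldDeriv (h : IsSymbol X S w (n + 1) f) (i : ι) :
    IsSymbol X S w n (fieldDeriv (X i) f) :=
  h.2.2 i

theorem of_succ (h : IsSymbol X S w (n + 1) f) : IsSymbol X S w n f := by
  induction n generalizing f with
  | zero => exact ⟨h.contDiffOn.of_le (by simp), h.isBigO⟩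
  | succ n ih =>
    exact ⟨h.contDiffOn.of_le (by exact_mod_cast Nat.le_succ _), h.isBigO,
      fun i => ih (h.fieldDeriv i)⟩

theorem of_le (h : IsSymbol X S w n f) (hmn : m ≤ n) : IsSymbol X S w m f := by
  induction n, hmn using Nat.le_induction with
  | base => exact h
  | succ n _ ih => exact ih h.of_succ

theorem trans_isBigO (h : IsSymbol X S w₁ n f) (hw : w₁ =O[𝓟 S] w₂) : IsSymbol X S w₂ n f := by
  induction n generalizing f with
  | zero => exact ⟨h.contDiffOn, h.isBigO.trans hw⟩
  | succ n ih => exact ⟨h.contDiffOn, h.isBigO.trans hw, fun i => ih (h.fieldDeriv i)⟩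

theorem congr_weight (h : IsSymbol X S w₁ n f) (hw : EqOn w₁ w₂ S) : IsSymbol X S w₂ n f :=
  h.trans_isBigO ((isBigO_refl w₂ _).congr' (eventually_principal.2 hw.symm) .rfl)

theorem mono (h : IsSymbol X S w n f) (hS : S' ⊆ S) : IsSymbol X S' w n f := by
  have hO {g : E → ℝ} (hg : g =O[𝓟 S] w) : g =O[𝓟 S'] w := hg.mono (principal_mono.2 hS)
  induction n generalizing f with
  | zero => exact ⟨h.contDiffOn.mono hS, hO h.isBigO⟩
  | succ n ih => exact ⟨h.contDiffOn.mono hS, hO h.isBigO, fun i => ih (h.fieldDeriv i)⟩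

theorem congr (h : IsSymbol X S w n f) (hS : IsOpen S) (hfg : EqOn g f S) :
    IsSymbol X S w n g := by
  have hO : g =O[𝓟 S] w := h.isBigO.congr' (eventually_principal.2 hfg.symm) .rfl
  induction n generalizing f g with
  | zero => exact ⟨h.contDiffOn.congr hfg, hO⟩
  | succ n ih =>
    have hD i := fieldDeriv_congr hS hfg (X i)
    exact ⟨h.contDiffOn.congr hfg, hO, fun i => ih (h.fieldDeriv i) (hD i)
      ((h.fieldDeriv i).isBigO.congr' (eventually_principal.2 (hD i).symm) .rfl)⟩

theorem union (h : IsSymbol X S w n f) (h' : IsSymbol X S' w n f) (hS : IsOpen S)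
    (hS' : IsOpen S') : IsSymbol X (S ∪ S') w n f := by
  have hO {g : E → ℝ} (hg : g =O[𝓟 S] w) (hg' : g =O[𝓟 S'] w) : g =O[𝓟 (S ∪ S')] w := by
    rw [← sup_principal]
    exact hg.sup hg'
  induction n generalizing f with
  | zero => exact ⟨h.contDiffOn.union_of_isOpen h'.contDiffOn hS hS', hO h.isBigO h'.isBigO⟩
  | succ n ih =>
    exact ⟨h.contDiffOn.union_of_isOpen h'.contDiffOn hS hS', hO h.isBigO h'.isBigO,
      fun i => ih (h.fieldDeriv i) (h'.fieldDeriv i)⟩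

theorem differentiableAt (h : IsSymbol X S w (n + 1) f) (hS : IsOpen S) {p : E}
    (hp : p ∈ S) : DifferentiableAt ℝ f p :=
  (h.contDiffOn.contDiffAt (hS.mem_nhds hp)).differentiableAt (by simp)

theorem succ_of_eqOn (hS : IsOpen S) (hf : ContDiffOn ℝ (n + 1 : ℕ) f S) (hfw : f =O[𝓟 S] w)
    {g : ι → E → ℝ} (hg : ∀ i, IsSymbol X S w n (g i))
    (hfg : ∀ i, EqOn (QuinticWave.fieldDeriv (X i) f) (g i) S) : IsSymbol X S w (n + 1) f :=
  ⟨hf, hfw, fun i => (hg i).congr hS (hfg i)⟩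

protected theorem add (hf : IsSymbol X S w n f) (hg : IsSymbol X S w n g) (hS : IsOpen S) :
    IsSymbol X S w n (fun p => f p + g p) := by
  induction n generalizing f g with
  | zero => exact ⟨hf.contDiffOn.add hg.contDiffOn, hf.isBigO.add hg.isBigO⟩
  | succ n ih =>
    refine succ_of_eqOn hS (hf.contDiffOn.add hg.contDiffOn) (hf.isBigO.add hg.isBigO)
      (fun i => ih (hf.fieldDeriv i) (hg.fieldDeriv i)) fun i p hp => ?_
    simp [QuinticWave.fieldDeriv,
      fderiv_fun_add (hf.differentiableAt hS hp) (hg.differentiableAt hS hp)]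

protected theorem mul (hf : IsSymbol X S w₁ n f) (hg : IsSymbol X S w₂ n g) (hS : IsOpen S) :
    IsSymbol X S (fun p => w₁ p * w₂ p) n (fun p => f p * g p) := by
  induction n generalizing f g with
  | zero => exact ⟨hf.contDiffOn.mul hg.contDiffOn, hf.isBigO.mul hg.isBigO⟩
  | succ n ih =>
    refine succ_of_eqOn hS (hf.contDiffOn.mul hg.contDiffOn) (hf.isBigO.mul hg.isBigO)
      (fun i => (ih (hf.fieldDeriv i) hg.of_succ).add (ih hf.of_succ (hg.fieldDeriv i)) hS)
      fun i p hp => ?_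
    simp only [QuinticWave.fieldDeriv, add_apply, smul_apply, smul_eq_mul,
      fderiv_fun_mul (hf.differentiableAt hS hp) (hg.differentiableAt hS hp)]
    ring

protected theorem const (c : ℝ) : IsSymbol X S (fun _ => 1) n (fun _ => c) := by
  have hO (c : ℝ) : (fun _ : E => c) =O[𝓟 S] fun _ => (1 : ℝ) :=
    isBigO_const_const c one_ne_zero _
  induction n generalizing c with
  | zero => exact ⟨contDiffOn_const, hO c⟩
  | succ n ih =>
    refine ⟨contDiffOn_const, hO c, fun i => ?_⟩
    have hzero : QuinticWave.fieldDeriv (X i) (fun _ => c) = fun _ => 0 := by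
      ext; simp [QuinticWave.fieldDeriv]
    exact hzero ▸ ih 0

protected theorem const_mul (hf : IsSymbol X S w n f) (hS : IsOpen S) (c : ℝ) :
    IsSymbol X S w n (fun p => c * f p) :=
  ((IsSymbol.const c).mul hf hS).congr_weight fun _ _ => one_mul _

protected theorem neg (hf : IsSymbol X S w n f) (hS : IsOpen S) :
    IsSymbol X S w n (fun p => - f p) :=
  (hf.const_mul hS (-1)).congr hS fun _ _ => by simp

protected theorem sub (hf : IsSymbol X S w n f) (hg : IsSymbol X S w n g) (hS : IsOpen S) :
    IsSymbol X S w n (fun p => f p - g p) :=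
  (hf.add (hg.neg hS) hS).congr hS fun _ _ => sub_eq_add_neg _ _

protected theorem pow (hf : IsSymbol X S w n f) (hS : IsOpen S) (k : ℕ) :
    IsSymbol X S (fun p => w p ^ k) n (fun p => f p ^ k) := by
  induction k with
  | zero => simpa using IsSymbol.const 1
  | succ k ih => simpa [pow_succ] using ih.mul hf hS

protected theorem inv (hf : IsSymbol X S w n f) (hS : IsOpen S) (hf0 : ∀ p ∈ S, f p ≠ 0)
    (hwf : w =O[𝓟 S] f) : IsSymbol X S (fun p => (w p)⁻¹) n (fun p => (f p)⁻¹) := by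
  have hw0 : ∀ p ∈ S, w p ≠ 0 := fun p hp hw =>
    hf0 p hp (eventually_principal.1 hf.isBigO.eq_zero_imp p hp hw)
  have hO : (fun p => (f p)⁻¹) =O[𝓟 S] fun p => (w p)⁻¹ :=
    hwf.inv_rev (eventually_principal.2 fun p hp h => absurd h (hw0 p hp))
  induction n with
  | zero => exact ⟨hf.contDiffOn.inv hf0, hO⟩
  | succ n ih =>
    refine succ_of_eqOn hS (hf.contDiffOn.inv hf0) hO
      (g := fun i p => -(QuinticWave.fieldDeriv (X i) f p * ((f p)⁻¹ * (f p)⁻¹))) (fun i => ?_)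
      fun i p hp => ?_
    · have hi := ih hf.of_succ
      exact (((hf.fieldDeriv i).mul (hi.mul hi hS) hS).congr_weight fun p hp =>
        mul_inv_cancel_left₀ (hw0 p hp) _).neg hS
    · have hinv : HasFDerivAt (fun p => (f p)⁻¹) (-(f p ^ 2)⁻¹ • fderiv ℝ f p) p :=
        (hasDerivAt_inv (hf0 p hp)).comp_hasFDerivAt p (hf.differentiableAt hS hp).hasFDerivAt
      simp only [QuinticWave.fieldDeriv, hinv.fderiv, smul_apply, smul_eq_mul]
      ring

end IsSymbol

/-- The Euler vector field `x d/dx` on the line, as a family with one element. -/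
def eulerField : Unit → ℝ →L[ℝ] ℝ := fun _ => ContinuousLinearMap.id ℝ ℝ

theorem fieldDeriv_eulerField (i : Unit) (f : ℝ → ℝ) (x : ℝ) :
    fieldDeriv (eulerField i) f x = x * deriv f x := by
  simp [fieldDeriv, eulerField, fderiv_eq_smul_deriv]

namespace IsSymbol

theorem comp {I : Set ℝ} {v h : ℝ → ℝ} {φ : E → ℝ} {c : ι → E → ℝ}
    (hh : IsSymbol eulerField I v n h) (hI : IsOpen I) (hS : IsOpen S) (hφ : ContDiffOn ℝ n φ S)
    (hφI : MapsTo φ S I) (hc : ∀ i, IsSymbol X S (fun _ => 1) n (c i))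
    (hφc : ∀ i, ∀ p ∈ S, QuinticWave.fieldDeriv (X i) φ p = c i p * φ p) :
    IsSymbol X S (fun p => v (φ p)) n (fun p => h (φ p)) := by
  have hO : (fun p => h (φ p)) =O[𝓟 S] fun p => v (φ p) :=
    hh.isBigO.comp_tendsto (tendsto_principal_principal.2 hφI)
  induction n generalizing h with
  | zero => exact ⟨hh.contDiffOn.comp hφ hφI, hO⟩
  | succ n ih =>
    have hxh' := ih (hh.fieldDeriv ()) (hφ.of_le (by exact_mod_cast Nat.le_succ _))
      (fun i => (hc i).of_succ)
      ((hh.fieldDeriv ()).isBigO.comp_tendsto (tendsto_principal_principal.2 hφI))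
    refine succ_of_eqOn hS (hh.contDiffOn.comp hφ hφI) hO (fun i =>
      ((hc i).of_succ.mul hxh' hS).congr_weight fun _ _ => one_mul _) fun i p hp => ?_
    have hcomp : HasFDerivAt (fun p => h (φ p)) (deriv h (φ p) • fderiv ℝ φ p) p :=
      (hh.differentiableAt hI (hφI hp)).hasDerivAt.comp_hasFDerivAt p
        ((hφ.contDiffAt (hS.mem_nhds hp)).differentiableAt (by simp)).hasFDerivAt
    have hφ' : fderiv ℝ φ p (X i p) = c i p * φ p := hφc i p hp
    simp only [fieldDeriv_eulerField]
    simp only [QuinticWave.fieldDeriv, hcomp.fderiv, smul_apply, hφ', smul_eq_mul]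
    ring

theorem succ_of_hasDerivAt {I : Set ℝ} {v h h' : ℝ → ℝ} (hI : IsOpen I)
    (hI0 : ∀ x ∈ I, x ≠ 0) (hd : ∀ x ∈ I, HasDerivAt h (h' x) x) (hO : h =O[𝓟 I] v)
    (hs : IsSymbol eulerField I v n (fun x => x * h' x)) :
    IsSymbol eulerField I v (n + 1) h := by
  have hh' : ContDiffOn ℝ n h' I :=
    ((contDiffOn_id.inv hI0).mul hs.contDiffOn).congr fun x hx => by simp [hI0 x hx]
  refine succ_of_eqOn hI ?_ hO (fun _ => hs) fun i x hx => ?_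
  · push_cast
    rw [contDiffOn_succ_iff_deriv_of_isOpen hI]
    exact ⟨fun x hx => (hd x hx).differentiableAt.differentiableWithinAt, by simp,
      hh'.congr fun x hx => (hd x hx).deriv⟩
  · rw [fieldDeriv_eulerField, (hd x hx).deriv]

theorem of_contDiff {h : ℝ → ℝ} (hh : ContDiff ℝ ∞ h) (a b : ℝ) :
    IsSymbol eulerField (Ioo a b) (fun _ => 1) n h := by
  have hO {h : ℝ → ℝ} (hh : Continuous h) : h =O[𝓟 (Ioo a b)] fun _ => (1 : ℝ) :=
    (hh.continuousOn.isBigO_principal isCompact_Icc (by simp)).mono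
      (principal_mono.2 Ioo_subset_Icc_self)
  induction n generalizing h with
  | zero => exact ⟨(hh.of_le (by simp)).contDiffOn, hO hh.continuous⟩
  | succ n ih =>
    refine succ_of_eqOn isOpen_Ioo (hh.of_le (by exact_mod_cast le_top)).contDiffOn
      (hO hh.continuous) (fun _ => ih (contDiff_id.mul (contDiff_infty_iff_deriv.1 hh).2))
      fun i x _ => fieldDeriv_eulerField i h x

end IsSymbol

end Symbols

noncomputable section Profiles

/-- `(1 + x²)^{-1/2}`, the ground state in the variable `x = R/√3`. -/
def ground (x : ℝ) : ℝ := (√(1 + x ^ 2))⁻¹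

theorem W_eq_ground (R : ℝ) : W R = ground (R / √3) := by
  have h : (0 : ℝ) ≤ 1 + R ^ 2 / 3 := by positivity
  rw [W, ground, rpow_neg h, ← sqrt_eq_rpow, div_pow, sq_sqrt (by norm_num)]

theorem ground_pos (x : ℝ) : 0 < ground x := by unfold ground; positivity

theorem ground_sq (x : ℝ) : ground x ^ 2 * (1 + x ^ 2) = 1 := by
  have h : (0 : ℝ) < 1 + x ^ 2 := by positivity
  rw [ground, inv_pow, sq_sqrt h.le, inv_mul_cancel₀ h.ne']

theorem ground_le {x : ℝ} (hx : 0 ≤ x) : ground x ≤ 2 * (1 + x)⁻¹ := by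
  have h : (1 + x) / 2 ≤ √(1 + x ^ 2) := le_sqrt_of_sq_le (by nlinarith [sq_nonneg (x - 1)])
  calc ground x ≤ ((1 + x) / 2)⁻¹ := inv_anti₀ (by positivity) h
    _ = 2 * (1 + x)⁻¹ := by field_simp

theorem hasDerivAt_one_add_sq (x : ℝ) : HasDerivAt (fun x : ℝ => 1 + x ^ 2) (2 * x) x := by
  simpa using (hasDerivAt_pow 2 x).const_add 1

theorem hasDerivAt_ground (x : ℝ) : HasDerivAt ground (-x * ground x ^ 3) x := by
  have h : (0 : ℝ) < 1 + x ^ 2 := by positivity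
  have hsqrt : √(1 + x ^ 2) ≠ 0 := sqrt_ne_zero'.2 h
  refine (((hasDerivAt_one_add_sq x).sqrt h.ne').inv hsqrt).congr_deriv ?_
  unfold ground
  field_simp

theorem contDiff_ground {n : WithTop ℕ∞} : ContDiff ℝ n ground :=
  ((by fun_prop : ContDiff ℝ n fun x : ℝ => 1 + x ^ 2).sqrt fun x => by positivity).inv
    fun x => sqrt_ne_zero'.2 (by positivity)

theorem hasDerivAt_log_one_add_sq (x : ℝ) :
    HasDerivAt (fun x : ℝ => log (1 + x ^ 2)) (2 * x / (1 + x ^ 2)) x :=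
  (hasDerivAt_one_add_sq x).log (by positivity)

theorem one_half_le_log_add_two {x : ℝ} (hx : 0 ≤ x) : (1 : ℝ) / 2 ≤ log (x + 2) :=
  (by linarith [log_two_gt_d9] : (1 : ℝ) / 2 ≤ log 2).trans
    (log_le_log (by norm_num) (by linarith))

theorem mul_inv_one_add_le_one {x : ℝ} (hx : 0 ≤ x) : x * (1 + x)⁻¹ ≤ 1 := by
  rw [← div_eq_mul_inv, div_le_one (by positivity)]
  linarith

variable {n : ℕ}

theorem isSymbol_id : IsSymbol eulerField (Ioi 0) (fun x => x) n (fun x => x) := by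
  induction n with
  | zero => exact ⟨contDiffOn_id, isBigO_refl _ _⟩
  | succ n ih =>
    exact .succ_of_hasDerivAt isOpen_Ioi (fun _ hx => hx.ne') (fun x _ => hasDerivAt_id x)
      (isBigO_refl _ _) (by simpa using ih)

theorem isSymbol_inv : IsSymbol eulerField (Ioi 0) (fun x => x⁻¹) n (fun x => x⁻¹) :=
  isSymbol_id.inv isOpen_Ioi (fun _ hx => hx.ne') (isBigO_refl _ _)

theorem isSymbol_ground :
    IsSymbol eulerField (Ioi 0) (fun x => (1 + x)⁻¹) n ground := by
  have hO : ground =O[𝓟 (Ioi 0)] fun x => (1 + x)⁻¹ :=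
    isBigO_principal_of_nonneg_of_le (fun x _ => (ground_pos x).le)
      fun x hx => ground_le (mem_Ioi.1 hx).le
  induction n with
  | zero => exact ⟨contDiff_ground.contDiffOn, hO⟩
  | succ n ih =>
    refine .succ_of_hasDerivAt isOpen_Ioi (fun _ hx => hx.ne') (fun x _ => hasDerivAt_ground x) hO
      ?_
    have hsq : IsSymbol eulerField (Ioi 0) (fun _ => 1) n (fun x => ground x ^ 2) := by
      refine (ih.pow isOpen_Ioi 2).trans_isBigO
        (isBigO_principal_of_nonneg_of_le (C := 1) (fun _ _ => by positivity) fun x hx => ?_)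
      have hx : 0 < x := hx
      rw [one_mul]
      exact pow_le_one₀ (by positivity) (inv_le_one_of_one_le₀ (by linarith))
    refine (((hsq.sub (.const 1) isOpen_Ioi).mul ih isOpen_Ioi).congr_weight
      fun _ _ => one_mul _).congr isOpen_Ioi fun x _ => ?_
    linear_combination (-ground x) * ground_sq x

theorem isSymbol_log_one_add_sq :
    IsSymbol eulerField (Ioi 0) (fun x => log (x + 2)) n (fun x => log (1 + x ^ 2)) := by
  refine (IsSymbol.succ_of_hasDerivAt isOpen_Ioi (fun _ hx => hx.ne')
    (fun x _ => hasDerivAt_log_one_add_sq x) ?_ ?_).of_succ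
  · refine isBigO_principal_of_nonneg_of_le (C := 2) (fun x _ => log_nonneg (by nlinarith))
      fun x hx => ?_
    have hx : 0 < x := hx
    rw [← log_rpow (by linarith)]
    refine log_le_log (by positivity) ?_
    norm_num
    nlinarith
  · refine ((((isSymbol_id.mul isSymbol_ground isOpen_Ioi).pow isOpen_Ioi 2).const_mul isOpen_Ioi
      2).trans_isBigO (isBigO_principal_of_nonneg_of_le (C := 2) (fun _ _ => by positivity)
        fun x hx => ?_)).congr isOpen_Ioi fun x _ => by
          rw [div_eq_mul_one_div, ← eq_one_div_of_mul_eq_one_left (ground_sq x)]; ring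
    have hx : 0 < x := hx
    have hsq : (x * (1 + x)⁻¹) ^ 2 ≤ 1 :=
      pow_le_one₀ (by positivity) (mul_inv_one_add_le_one hx.le)
    linarith [one_half_le_log_add_two hx.le]

theorem abs_arctan_sub_pi_div_two_le {x : ℝ} (hx : 0 < x) : |arctan x - π / 2| ≤ x⁻¹ := by
  have hpos : 0 < arctan x⁻¹ := arctan_pos.2 (inv_pos.2 hx)
  rw [abs_sub_comm, ← arctan_inv_of_pos hx, abs_of_pos hpos]
  simpa only [tan_arctan] using le_tan hpos.le (arctan_lt_pi_div_two _)

theorem isSymbol_arctan_sub :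
    IsSymbol eulerField (Ioi 0) (fun x => x⁻¹) n (fun x => arctan x - π / 2) := by
  refine (IsSymbol.succ_of_hasDerivAt isOpen_Ioi (fun _ hx => hx.ne')
    (fun x _ => (hasDerivAt_arctan x).sub_const _) ?_ ?_).of_succ
  · refine isBigO_principal.2 ⟨1, fun x hx => ?_⟩
    have hx : 0 < x := hx
    rw [norm_eq_abs, norm_of_nonneg (inv_pos.2 hx).le, one_mul]
    exact abs_arctan_sub_pi_div_two_le hx
  · refine ((isSymbol_id.mul (isSymbol_ground.pow isOpen_Ioi 2) isOpen_Ioi).trans_isBigO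
      (isBigO_principal_of_nonneg_of_le (C := 1)
        (fun x hx => mul_nonneg (mem_Ioi.1 hx).le (by positivity))
        fun x hx => ?_)).congr isOpen_Ioi fun x _ => ?_
    · have hx : 0 < x := hx
      rw [one_mul, inv_pow, ← div_eq_mul_inv, ← one_div,
        div_le_div_iff₀ (by positivity) hx]
      nlinarith
    · exact congrArg (x * ·) (eq_one_div_of_mul_eq_one_left (ground_sq x)).symm

theorem one_sub_mul_ground_nonneg_le {x : ℝ} (hx : 0 < x) :
    0 ≤ 1 - x * ground x ∧ 1 - x * ground x ≤ 4 * (1 + x)⁻¹ ^ 2 := by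
  have hpos := mul_pos hx (ground_pos x)
  have hfactor : (1 - x * ground x) * (1 + x * ground x) = ground x ^ 2 := by
    linear_combination -ground_sq x
  have hnonneg : 0 ≤ 1 - x * ground x :=
    nonneg_of_mul_nonneg_left (hfactor ▸ sq_nonneg _) (by linarith)
  have hsq : ground x ^ 2 ≤ (2 * (1 + x)⁻¹) ^ 2 :=
    pow_le_pow_left₀ (ground_pos x).le (ground_le hx.le) 2
  exact ⟨hnonneg, by nlinarith⟩

theorem isSymbol_one_sub_mul_ground :
    IsSymbol eulerField (Ioi 0) (fun x => (1 + x)⁻¹ ^ 2) n (fun x => 1 - x * ground x) := by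
  refine (IsSymbol.succ_of_hasDerivAt isOpen_Ioi (fun _ hx => hx.ne')
    (fun x _ => ((hasDerivAt_id x).mul (hasDerivAt_ground x)).const_sub 1) ?_ ?_).of_succ
  · exact isBigO_principal_of_nonneg_of_le (fun x hx => (one_sub_mul_ground_nonneg_le hx).1)
      fun x hx => (one_sub_mul_ground_nonneg_le hx).2
  · refine ((((isSymbol_id.mul isSymbol_ground isOpen_Ioi).mul
      (isSymbol_ground.pow isOpen_Ioi 2) isOpen_Ioi).neg isOpen_Ioi).trans_isBigO
      (isBigO_principal_of_nonneg_of_le (C := 1) (fun x hx => ?_) fun x hx => ?_)).congr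
      isOpen_Ioi fun x _ => ?_
    · have hx : 0 < x := hx
      positivity
    · rw [one_mul]
      exact mul_le_of_le_one_left (by positivity) (mul_inv_one_add_le_one (mem_Ioi.1 hx).le)
    · simp only [one_mul, id_eq]
      linear_combination (x * ground x) * ground_sq x

/-- The smooth extension of `arctan x / x` to the origin. -/
def arctanQuot : ℝ → ℝ := dslope arctan 0

theorem arctanQuot_zero : arctanQuot 0 = 1 := by
  simp [arctanQuot]

theorem arctanQuot_of_ne {x : ℝ} (hx : x ≠ 0) : arctanQuot x = arctan x / x := by
  rw [arctanQuot, dslope_of_ne _ hx]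
  simp [slope, div_eq_inv_mul]

theorem contDiff_arctanQuot : ContDiff ℝ ∞ arctanQuot := by
  refine contDiff_iff_contDiffAt.2 fun x => ?_
  obtain rfl | hx := eq_or_ne x 0
  · obtain ⟨p, hp⟩ := (contDiff_arctan (n := ω)).contDiffAt (x := 0) |>.analyticAt
    exact (hp.has_fpower_series_dslope_fslope.analyticAt).contDiffAt
  · refine (contDiff_arctan.contDiffAt.div contDiffAt_id hx).congr_of_eventuallyEq ?_
    filter_upwards [isOpen_ne.mem_nhds hx] with y hy using arctanQuot_of_ne hy

end Profiles

noncomputable section ProfileODE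

/-- The radial Laplacian in three dimensions. -/
def radialLap (f : ℝ → ℝ) (r : ℝ) : ℝ := deriv (deriv f) r + 2 / r * deriv f r

/-- The linearization of `Δ + 3 W⁵` at the ground state, in the variable `x = R/√3`. -/
def linearizedOp (F : ℝ → ℝ) (x : ℝ) : ℝ := radialLap F x + 15 * ground x ^ 4 * F x

theorem hasDerivAt_ground_cube (x : ℝ) :
    HasDerivAt (fun x => ground x ^ 3) (-3 * x / (1 + x ^ 2) * ground x ^ 3) x := by
  refine ((hasDerivAt_ground x).pow 3).congr_deriv ?_
  have h : 1 + x ^ 2 ≠ 0 := by positivity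
  field_simp
  norm_num
  linear_combination (3 * ground x ^ 3 * x) * ground_sq x

theorem ground_pow_four (x : ℝ) : ground x ^ 4 = ((1 + x ^ 2) ^ 2)⁻¹ := by
  rw [← mul_eq_one_iff_eq_inv₀ (by positivity : (1 + x ^ 2) ^ 2 ≠ 0)]
  linear_combination (ground x ^ 2 * (1 + x ^ 2) + 1) * ground_sq x

theorem linearizedOp_ground_cube_mul {M M₁ : ℝ → ℝ} {m₂ x : ℝ} (hx : x ≠ 0)
    (hM : ∀ᶠ y in 𝓝 x, HasDerivAt M (M₁ y) y) (hM₁ : HasDerivAt M₁ m₂ x) :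
    linearizedOp (fun y => ground y ^ 3 * M y) x =
      ground x ^ 3 * (m₂ + (2 / x - 6 * x / (1 + x ^ 2)) * M₁ x + 6 / (1 + x ^ 2) * M x) := by
  have h0 (y : ℝ) : 1 + y ^ 2 ≠ 0 := by positivity
  have hderiv : ∀ᶠ y in 𝓝 x, HasDerivAt (fun y => ground y ^ 3 * M y)
      (ground y ^ 3 * (M₁ y - 3 * y / (1 + y ^ 2) * M y)) y := by
    filter_upwards [hM] with y hy
    exact ((hasDerivAt_ground_cube y).mul hy).congr_deriv (by ring)
  have hquot : HasDerivAt (fun x : ℝ => 3 * x / (1 + x ^ 2))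
      ((3 * (1 + x ^ 2) - 3 * x * (2 * x)) / (1 + x ^ 2) ^ 2) x :=
    (((hasDerivAt_id x).const_mul 3).div (hasDerivAt_one_add_sq x) (h0 x)).congr_deriv (by simp)
  have hderiv₂ := ((hasDerivAt_ground_cube x).mul
    (hM₁.sub (hquot.mul hM.self_of_nhds))).congr_of_eventuallyEq
      (hderiv.mono fun y hy => hy.deriv)
  have hx₁ := h0 x
  rw [linearizedOp, radialLap, hderiv₂.deriv, hderiv.self_of_nhds.deriv, ground_pow_four]
  simp only [Pi.mul_apply, Pi.sub_apply]
  field_simp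
  ring

theorem hasDerivAt_log_term (x : ℝ) :
    HasDerivAt (fun y => (1 - y ^ 2) * log (1 + y ^ 2))
      (-2 * x * log (1 + x ^ 2) + (2 * x - 2 * x ^ 3) / (1 + x ^ 2)) x := by
  refine (((hasDerivAt_pow 2 x).const_sub 1).mul (hasDerivAt_log_one_add_sq x)).congr_deriv ?_
  push_cast
  ring

theorem hasDerivAt_deriv_log_term (x : ℝ) :
    HasDerivAt (fun y => -2 * y * log (1 + y ^ 2) + (2 * y - 2 * y ^ 3) / (1 + y ^ 2))
      (-2 * log (1 + x ^ 2) + (2 - 12 * x ^ 2 - 6 * x ^ 4) / (1 + x ^ 2) ^ 2) x := by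
  have h : 1 + x ^ 2 ≠ 0 := by positivity
  refine ((((hasDerivAt_id x).const_mul (-2)).mul (hasDerivAt_log_one_add_sq x)).add
    ((((hasDerivAt_id x).const_mul 2).sub ((hasDerivAt_pow 3 x).const_mul 2)).div
      (hasDerivAt_one_add_sq x) h)).congr_deriv ?_
  simp only [id_eq]
  field_simp
  norm_num
  ring

theorem hasDerivAt_arctan_term {x : ℝ} (hx : x ≠ 0) :
    HasDerivAt (fun y => (y⁻¹ - 6 * y + y ^ 3) * arctan y)
      ((-(x ^ 2)⁻¹ - 6 + 3 * x ^ 2) * arctan x + (x⁻¹ - 6 * x + x ^ 3) * (1 + x ^ 2)⁻¹) x := by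
  refine ((((hasDerivAt_inv hx).sub ((hasDerivAt_id x).const_mul 6)).add
    (hasDerivAt_pow 3 x)).mul (hasDerivAt_arctan' x)).congr_deriv ?_
  simp

theorem hasDerivAt_deriv_arctan_term {x : ℝ} (hx : x ≠ 0) :
    HasDerivAt
      (fun y => (-(y ^ 2)⁻¹ - 6 + 3 * y ^ 2) * arctan y + (y⁻¹ - 6 * y + y ^ 3) * (1 + y ^ 2)⁻¹)
      ((2 / x ^ 3 + 6 * x) * arctan x + 2 * ((-(x ^ 2)⁻¹ - 6 + 3 * x ^ 2) * (1 + x ^ 2)⁻¹) -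
        (x⁻¹ - 6 * x + x ^ 3) * (2 * x / (1 + x ^ 2) ^ 2)) x := by
  have h : 1 + x ^ 2 ≠ 0 := by positivity
  refine (((((hasDerivAt_pow 2 x).inv (pow_ne_zero 2 hx)).neg.sub_const 6).add
    ((hasDerivAt_pow 2 x).const_mul 3)).mul (hasDerivAt_arctan' x) |>.add
    ((((hasDerivAt_inv hx).sub ((hasDerivAt_id x).const_mul 6)).add (hasDerivAt_pow 3 x)).mul
      ((hasDerivAt_one_add_sq x).inv h))).congr_deriv ?_
  simp only [Pi.add_apply, Pi.sub_apply, Pi.inv_apply, Pi.neg_apply, id_eq]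
  field_simp
  norm_num
  ring

/-- A family of functions on which the linearized operator is rational up to the factor `W³`: by
variation of parameters, it contains the solutions of the linearized profile equations. -/
def profile (a c p₀ p₁ p₂ x : ℝ) : ℝ :=
  ground x ^ 3 * (a * (1 - x ^ 2) * log (1 + x ^ 2) +
    c * (1 - 6 * x ^ 2 + x ^ 4) * arctanQuot x + (p₀ + p₁ * x ^ 2 + p₂ * x ^ 4))

variable {a c p₀ p₁ p₂ : ℝ} {n : ℕ}

theorem contDiff_profile : ContDiff ℝ ∞ (profile a c p₀ p₁ p₂) := by
  have hground := contDiff_ground (n := ∞)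
  have harctan := contDiff_arctanQuot
  have hlog : ContDiff ℝ ∞ (fun x : ℝ => log (1 + x ^ 2)) :=
    ContDiff.log (by fun_prop) fun x => by positivity
  unfold profile
  fun_prop

theorem profile_zero (h : c + p₀ = 0) : profile a c p₀ p₁ p₂ 0 = 0 := by
  simp [profile, arctanQuot_zero, h]

theorem profile_eq {x : ℝ} (hx : x ≠ 0) :
    profile a c p₀ p₁ p₂ x = ground x ^ 3 * (a * ((1 - x ^ 2) * log (1 + x ^ 2)) +
      c * ((x⁻¹ - 6 * x + x ^ 3) * arctan x) + (p₀ + p₁ * x ^ 2 + p₂ * x ^ 4)) := by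
  rw [profile, arctanQuot_of_ne hx]
  field_simp

theorem linearizedOp_profile {x : ℝ} (hx : 0 < x) :
    linearizedOp (profile a c p₀ p₁ p₂) x =
      ground x ^ 3 / (1 + x ^ 2) ^ 2 * (a * (2 * x ^ 4 - 24 * x ^ 2 + 6) + 32 * c * (x ^ 2 - 1) +
        6 * (p₀ + p₁) * (1 + x ^ 2) + p₂ * (20 * x ^ 2 + 22 * x ^ 4 + 2 * x ^ 6)) := by
  have hpoly (y : ℝ) : HasDerivAt (fun y => p₀ + p₁ * y ^ 2 + p₂ * y ^ 4)
      (2 * p₁ * y + 4 * p₂ * y ^ 3) y :=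
    ((((hasDerivAt_pow 2 y).const_mul p₁).const_add p₀).add
      ((hasDerivAt_pow 4 y).const_mul p₂)).congr_deriv (by push_cast; ring)
  have hpoly' : HasDerivAt (fun y => 2 * p₁ * y + 4 * p₂ * y ^ 3) (2 * p₁ + 12 * p₂ * x ^ 2) x :=
    (((hasDerivAt_id x).const_mul (2 * p₁)).add
      ((hasDerivAt_pow 3 x).const_mul (4 * p₂))).congr_deriv (by push_cast; ring)
  have hne : ∀ᶠ y in 𝓝 x, y ≠ 0 := isOpen_ne.mem_nhds hx.ne'
  have hcongr : linearizedOp (profile a c p₀ p₁ p₂) x = linearizedOp (fun y => ground y ^ 3 *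
      (a * ((1 - y ^ 2) * log (1 + y ^ 2)) + c * ((y⁻¹ - 6 * y + y ^ 3) * arctan y) +
        (p₀ + p₁ * y ^ 2 + p₂ * y ^ 4))) x := by
    have heq := hne.mono fun y hy =>
      profile_eq (a := a) (c := c) (p₀ := p₀) (p₁ := p₁) (p₂ := p₂) hy
    have heq' := EventuallyEq.deriv heq
    simp only [linearizedOp, radialLap, heq'.deriv_eq, heq'.eq_of_nhds, heq.self_of_nhds]
  have hM (y : ℝ) (hy : y ≠ 0) :=
    (((hasDerivAt_log_term y).const_mul a).fun_add
      ((hasDerivAt_arctan_term hy).const_mul c)).fun_add (hpoly y)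
  have hM' := (((hasDerivAt_deriv_log_term x).const_mul a).fun_add
    ((hasDerivAt_deriv_arctan_term hx.ne').const_mul c)).fun_add hpoly'
  rw [hcongr, linearizedOp_ground_cube_mul hx.ne' (hne.mono hM) hM']
  have h : 1 + x ^ 2 ≠ 0 := by positivity
  field_simp
  ring

/-- The weight `log (x + 2) / (x + 1)` of the error bounds. -/
def logWeight (x : ℝ) : ℝ := log (x + 2) / (x + 1)

theorem logWeight_pos {x : ℝ} (hx : 0 ≤ x) : 0 < logWeight x :=
  div_pos (by linarith [one_half_le_log_add_two hx]) (by linarith)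

theorem inv_one_add_le_logWeight {x : ℝ} (hx : 0 ≤ x) : (1 + x)⁻¹ ≤ 2 * logWeight x := by
  rw [logWeight, ← one_div, add_comm, ← mul_div_assoc]
  gcongr
  linarith [one_half_le_log_add_two hx]

theorem isBigO_inv_logWeight : (fun x => x⁻¹) =O[𝓟 (Ioi 1)] logWeight := by
  refine isBigO_principal_of_nonneg_of_le (C := 4) (fun x hx => ?_) fun x hx => ?_ <;>
    have hx : 1 < x := hx
  · positivity
  · calc x⁻¹ ≤ 2 * (1 + x)⁻¹ := by
          rw [← div_eq_mul_inv, ← one_div, div_le_div_iff₀ (by linarith) (by linarith)]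
          linarith
      _ ≤ 4 * logWeight x := by linarith [inv_one_add_le_logWeight (zero_le_one.trans hx.le)]

theorem isBigO_inv_pow_inv_pow {j k : ℕ} (h : j ≤ k) :
    (fun x : ℝ => x⁻¹ ^ k) =O[𝓟 (Ioi 1)] fun x => x⁻¹ ^ j := by
  refine isBigO_principal_of_nonneg_of_le (C := 1) (fun x hx => ?_) fun x hx => ?_ <;>
    have hx : 1 < x := hx
  · positivity
  · rw [one_mul]
    exact pow_le_pow_of_le_one (by positivity) (inv_le_one_of_one_le₀ hx.le) h

theorem isBigO_inv_one_add_inv :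
    (fun x : ℝ => (1 + x)⁻¹) =O[𝓟 (Ioi 1)] fun x => x⁻¹ := by
  refine isBigO_principal_of_nonneg_of_le (C := 1) (fun x hx => ?_) fun x hx => ?_ <;>
    have hx : 1 < x := hx
  · positivity
  · rw [one_mul]
    exact inv_anti₀ (by linarith) (by linarith)

section Infinity

theorem Ioi_one_subset : Ioi (1 : ℝ) ⊆ Ioi 0 := Ioi_subset_Ioi zero_le_one

theorem isSymbol_ground_Ioi_one :
    IsSymbol eulerField (Ioi 1) (fun x => x⁻¹) n ground :=
  (isSymbol_ground.mono Ioi_one_subset).trans_isBigO isBigO_inv_one_add_inv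

theorem isSymbol_mul_ground :
    IsSymbol eulerField (Ioi 1) (fun _ => 1) n (fun x => x * ground x) :=
  ((isSymbol_id.mono Ioi_one_subset).mul isSymbol_ground_Ioi_one isOpen_Ioi).congr_weight
    fun _ hx => mul_inv_cancel₀ (Ioi_one_subset hx).ne'

theorem isSymbol_mul_ground_cube_sub_one :
    IsSymbol eulerField (Ioi 1) (fun x => x⁻¹ ^ 2) n (fun x => (x * ground x) ^ 3 - 1) := by
  have hone_sub : IsSymbol eulerField (Ioi 1) (fun x => x⁻¹ ^ 2) n (fun x => 1 - x * ground x) :=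
    (isSymbol_one_sub_mul_ground.mono Ioi_one_subset).trans_isBigO (isBigO_inv_one_add_inv.pow 2)
  have hfactor : IsSymbol eulerField (Ioi 1) (fun _ => 1) n
      (fun x => (x * ground x) ^ 2 + (x * ground x + 1)) :=
    ((isSymbol_mul_ground.pow isOpen_Ioi 2).congr_weight fun _ _ => one_pow 2).add
      (isSymbol_mul_ground.add (.const 1) isOpen_Ioi) isOpen_Ioi
  exact (((hone_sub.mul hfactor isOpen_Ioi).neg isOpen_Ioi).congr_weight
    fun _ _ => mul_one _).congr isOpen_Ioi fun x _ => by ring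

theorem isSymbol_mul_ground_sq_mul_ground :
    IsSymbol eulerField (Ioi 1) (fun x => x⁻¹) n (fun x => (x * ground x) ^ 2 * ground x) :=
  ((isSymbol_mul_ground.pow isOpen_Ioi 2).mul isSymbol_ground_Ioi_one isOpen_Ioi).congr_weight
    fun x _ => by simp

theorem isSymbol_ground_cube :
    IsSymbol eulerField (Ioi 1) (fun x => x⁻¹ ^ 3) n (fun x => ground x ^ 3) :=
  isSymbol_ground_Ioi_one.pow isOpen_Ioi 3

theorem isSymbol_ground_cube_of_inv :
    IsSymbol eulerField (Ioi 1) (fun x => x⁻¹) n (fun x => ground x ^ 3) :=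
  isSymbol_ground_cube.trans_isBigO
    (by simpa using isBigO_inv_pow_inv_pow (show 1 ≤ 3 by norm_num))

theorem isSymbol_log_part :
    IsSymbol eulerField (Ioi 1) logWeight n
      (fun x => (ground x ^ 3 - (x * ground x) ^ 2 * ground x) * log (1 + x ^ 2)) := by
  refine ((isSymbol_ground_cube_of_inv.sub isSymbol_mul_ground_sq_mul_ground isOpen_Ioi).mul
    (isSymbol_log_one_add_sq.mono Ioi_one_subset) isOpen_Ioi).trans_isBigO
    (isBigO_principal_of_nonneg_of_le (C := 2) (fun x hx => ?_) fun x hx => ?_) <;>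
    have hx : 1 < x := hx <;>
    have hlog := one_half_le_log_add_two (zero_le_one.trans hx.le)
  · exact mul_nonneg (by positivity) (by linarith)
  · rw [logWeight, ← mul_div_assoc, ← div_eq_inv_mul, div_le_div_iff₀ (by linarith) (by linarith)]
    nlinarith

theorem isSymbol_arctan_coeff_sub_one :
    IsSymbol eulerField (Ioi 1) (fun x => x⁻¹ ^ 2) n (fun x => ground x ^ 3 * x⁻¹ -
      6 * (x * ground x * ground x ^ 2) + ((x * ground x) ^ 3 - 1)) := by
  have hinv : IsSymbol eulerField (Ioi 1) (fun x => x⁻¹ ^ 2) n (fun x => ground x ^ 3 * x⁻¹) :=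
    (isSymbol_ground_cube_of_inv.mul (isSymbol_inv.mono Ioi_one_subset)
      isOpen_Ioi).congr_weight fun x _ => (sq _).symm
  have hlin : IsSymbol eulerField (Ioi 1) (fun x => x⁻¹ ^ 2) n
      (fun x => x * ground x * ground x ^ 2) :=
    (isSymbol_mul_ground.mul (isSymbol_ground_Ioi_one.pow isOpen_Ioi 2)
      isOpen_Ioi).congr_weight fun x _ => one_mul _
  exact (hinv.sub (hlin.const_mul isOpen_Ioi 6) isOpen_Ioi).add isSymbol_mul_ground_cube_sub_one
    isOpen_Ioi

theorem isBigO_inv_sq_logWeight : (fun x => x⁻¹ ^ 2) =O[𝓟 (Ioi 1)] logWeight :=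
  (by simpa using isBigO_inv_pow_inv_pow one_le_two :
    (fun x : ℝ => x⁻¹ ^ 2) =O[𝓟 (Ioi 1)] fun x => x⁻¹).trans isBigO_inv_logWeight

theorem isSymbol_arctan_part :
    IsSymbol eulerField (Ioi 1) logWeight n
      (fun x => (ground x ^ 3 * x⁻¹ - 6 * (x * ground x * ground x ^ 2) + (x * ground x) ^ 3) *
        arctan x - π / 2) := by
  have hcoeff := isSymbol_arctan_coeff_sub_one (n := n)
  have hcoeff_one : IsSymbol eulerField (Ioi 1) (fun _ => 1) n (fun x => ground x ^ 3 * x⁻¹ -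
      6 * (x * ground x * ground x ^ 2) + ((x * ground x) ^ 3 - 1) + 1) :=
    (hcoeff.trans_isBigO (by simpa using isBigO_inv_pow_inv_pow zero_le_two)).add (.const 1)
      isOpen_Ioi
  have hsmall := (hcoeff_one.mul (isSymbol_arctan_sub.mono Ioi_one_subset) isOpen_Ioi).trans_isBigO
    (by simpa using isBigO_inv_logWeight)
  exact (hsmall.add ((hcoeff.trans_isBigO isBigO_inv_sq_logWeight).const_mul isOpen_Ioi (π / 2))
    isOpen_Ioi).congr isOpen_Ioi fun x _ => by ring

theorem isSymbol_poly_part :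
    IsSymbol eulerField (Ioi 1) logWeight n (fun x => p₀ * ground x ^ 3 +
      p₁ * ((x * ground x) ^ 2 * ground x) + p₂ * (x * ((x * ground x) ^ 3 - 1))) := by
  refine IsSymbol.trans_isBigO ?_ isBigO_inv_logWeight
  have hlead : IsSymbol eulerField (Ioi 1) (fun x => x⁻¹) n
      (fun x => x * ((x * ground x) ^ 3 - 1)) :=
    ((isSymbol_id.mono Ioi_one_subset).mul isSymbol_mul_ground_cube_sub_one
      isOpen_Ioi).congr_weight fun x hx => by
        have hx : x ≠ 0 := (Ioi_one_subset hx).ne'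
        field_simp
  exact ((isSymbol_ground_cube_of_inv.const_mul isOpen_Ioi _).add
    (isSymbol_mul_ground_sq_mul_ground.const_mul isOpen_Ioi _) isOpen_Ioi).add
    (hlead.const_mul isOpen_Ioi _) isOpen_Ioi

theorem isSymbol_profile_sub_Ioi_one :
    IsSymbol eulerField (Ioi 1) logWeight n
      (fun x => profile a c p₀ p₁ p₂ x - (p₂ * x + c * (π / 2))) := by
  refine (((isSymbol_log_part.const_mul isOpen_Ioi a).add
    (isSymbol_arctan_part.const_mul isOpen_Ioi c) isOpen_Ioi).add
    (isSymbol_poly_part (p₀ := p₀) (p₁ := p₁) (p₂ := p₂)) isOpen_Ioi).congr isOpen_Ioi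
      fun x hx => ?_
  have hx : x ≠ 0 := (Ioi_one_subset hx).ne'
  rw [profile_eq hx]
  field_simp
  ring

end Infinity

theorem Ioo_union_Ioi_one : Ioo (0 : ℝ) 2 ∪ Ioi 1 = Ioi 0 := by
  ext x
  grind

theorem isSymbol_profile_sub :
    IsSymbol eulerField (Ioi 0) logWeight n
      (fun x => profile a c p₀ p₁ p₂ x - (p₂ * x + c * (π / 2))) := by
  rw [← Ioo_union_Ioi_one]
  refine IsSymbol.union ?_ isSymbol_profile_sub_Ioi_one isOpen_Ioo isOpen_Ioi
  have hsmooth : ContDiff ℝ ∞ (fun x => profile a c p₀ p₁ p₂ x - (p₂ * x + c * (π / 2))) :=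
    contDiff_profile.sub (by fun_prop)
  refine (IsSymbol.of_contDiff hsmooth 0 2).trans_isBigO
    (isBigO_principal_of_nonneg_of_le (C := 6) (fun _ _ => zero_le_one) fun x hx => ?_)
  rw [logWeight, ← mul_div_assoc, le_div_iff₀ (by linarith [hx.1])]
  linarith [one_half_le_log_add_two hx.1.le, hx.2]

theorem isSymbol_of_contDiff_of_zero {h : ℝ → ℝ} (hh : ContDiff ℝ ∞ h) (h0 : h 0 = 0) (b : ℝ) :
    IsSymbol eulerField (Ioo 0 b) (fun x => x) n h := by
  have hderiv := contDiff_infty_iff_deriv.1 hh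
  obtain ⟨C, hC⟩ := (isCompact_Icc (a := (0 : ℝ)) (b := b)).exists_bound_of_continuousOn
    hderiv.2.continuous.continuousOn
  refine (IsSymbol.succ_of_hasDerivAt isOpen_Ioo (fun x hx => hx.1.ne')
    (fun x _ => (hderiv.1 x).hasDerivAt) (isBigO_principal.2 ⟨C, fun x hx => ?_⟩) ?_).of_succ
  · simpa [h0] using (convex_Icc (0 : ℝ) b).norm_image_sub_le_of_norm_hasDerivWithin_le
      (fun y _ => (hderiv.1 y).hasDerivAt.hasDerivWithinAt)
      hC (left_mem_Icc.2 (hx.1.le.trans hx.2.le)) (Ioo_subset_Icc_self hx)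
  · exact ((isSymbol_id.mono Ioo_subset_Ioi_self).mul (IsSymbol.of_contDiff hderiv.2 0 b)
      isOpen_Ioo).congr_weight fun _ _ => mul_one _

theorem isSymbol_profile (h : c + p₀ = 0) :
    IsSymbol eulerField (Ioi 0) (fun x => x) n (profile a c p₀ p₁ p₂) := by
  rw [← Ioo_union_Ioi_one]
  refine IsSymbol.union (isSymbol_of_contDiff_of_zero contDiff_profile (profile_zero h) 2) ?_
    isOpen_Ioo isOpen_Ioi
  have hdecay : logWeight =O[𝓟 (Ioi 1)] fun x => x := by
    refine isBigO_principal_of_nonneg_of_le (C := 1)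
      (fun x hx => (logWeight_pos (mem_Ioi.1 (Ioi_one_subset hx)).le).le) fun x hx => ?_
    have hx : 1 < x := hx
    rw [logWeight, div_le_iff₀ (by linarith)]
    nlinarith [log_le_sub_one_of_pos (show 0 < x + 2 by linarith)]
  have hone : (fun _ => (1 : ℝ)) =O[𝓟 (Ioi 1)] fun x : ℝ => x :=
    isBigO_principal_of_nonneg_of_le (C := 1) (fun _ _ => zero_le_one)
      fun x hx => by simpa using (mem_Ioi.1 hx).le
  exact ((isSymbol_profile_sub_Ioi_one.trans_isBigO hdecay).add
    (((isSymbol_id.mono Ioi_one_subset).const_mul isOpen_Ioi p₂).add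
      ((IsSymbol.const (c * (π / 2))).trans_isBigO hone) isOpen_Ioi) isOpen_Ioi).congr isOpen_Ioi
      fun x _ => by ring

/-- `F` solves the linearized profile equation with source `s`, is smooth and vanishes at the
origin, and is `β x + γ` up to a decaying error. -/
structure IsProfile (s F : ℝ → ℝ) (β γ : ℝ) : Prop where
  contDiff : ContDiff ℝ ∞ F
  isSymbol : ∀ n, IsSymbol eulerField (Ioi 0) (fun x => x) n F
  isSymbol_sub : ∀ n, IsSymbol eulerField (Ioi 0) logWeight n (fun x => F x - (β * x + γ))
  linearizedOp_eq : ∀ x, 0 < x → linearizedOp F x = 3 * s x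

/-- `(1/2 + x d/dx)` applied to the ground state. -/
def source₁ (x : ℝ) : ℝ := 1 / 2 * (1 - x ^ 2) * ground x ^ 3

/-- `(1/2 + x d/dx)²` applied to the ground state. -/
def source₂ (x : ℝ) : ℝ := 1 / 4 * (1 - 10 * x ^ 2 + x ^ 4) * ground x ^ 5

theorem exists_isProfile_source₁ : ∃ F β γ, IsProfile source₁ F β γ := by
  refine ⟨profile (15 / 2) (15 / 4) (-15 / 4) (33 / 2) (-3 / 4), _, _, contDiff_profile,
    fun n => isSymbol_profile (by norm_num), fun n => isSymbol_profile_sub, fun x hx => ?_⟩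
  rw [linearizedOp_profile hx, source₁]
  have h : 1 + x ^ 2 ≠ 0 := by positivity
  field_simp
  ring

theorem exists_isProfile_source₂ : ∃ F β γ, IsProfile source₂ F β γ := by
  refine ⟨profile (-15 / 2) (-15 / 4) (15 / 4) (-129 / 8) (3 / 8), _, _, contDiff_profile,
    fun n => isSymbol_profile (by norm_num), fun n => isSymbol_profile_sub, fun x hx => ?_⟩
  have h : 1 + x ^ 2 ≠ 0 := by positivity
  have hpow : ground x ^ 5 = ground x ^ 3 / (1 + x ^ 2) := by
    rw [eq_div_iff h]
    linear_combination ground x ^ 3 * ground_sq x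
  rw [linearizedOp_profile hx, source₂, hpow]
  field_simp
  ring

end ProfileODE

noncomputable section DirectionalDerivative

variable {E : Type*} [NormedAddCommGroup E] [NormedSpace ℝ E]

/-- The directional derivative `p ↦ D f(p) v`, as an operator on functions, so that it can be
iterated. -/
def dirDeriv (v : E) (f : E → ℝ) (p : E) : ℝ := fderiv ℝ f p v

variable {S : Set E} {v : E} {n k : ℕ} {f g : E → ℝ}

theorem contDiffOn_dirDeriv (hS : IsOpen S) (hf : ContDiffOn ℝ (n + 1 : ℕ) f S) :
    ContDiffOn ℝ n (dirDeriv v f) S :=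
  (hf.fderiv_of_isOpen hS (m := n) (by simp)).clm_apply contDiffOn_const

theorem contDiffOn_iterate_dirDeriv (hS : IsOpen S) (hf : ContDiffOn ℝ (n + k : ℕ) f S) :
    ContDiffOn ℝ n ((dirDeriv v)^[k] f) S := by
  induction k generalizing f with
  | zero => exact hf
  | succ k ih => exact ih (contDiffOn_dirDeriv hS hf)

theorem differentiableAt_iterate_dirDeriv (hS : IsOpen S) (hf : ContDiffOn ℝ (k + 1 : ℕ) f S)
    {p : E} (hp : p ∈ S) : DifferentiableAt ℝ ((dirDeriv v)^[k] f) p :=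
  ((contDiffOn_iterate_dirDeriv (n := 1) hS (by rwa [add_comm])).contDiffAt
    (hS.mem_nhds hp)).differentiableAt (by simp)

theorem dirDeriv_congr (hS : IsOpen S) (hfg : EqOn f g S) :
    EqOn (dirDeriv v f) (dirDeriv v g) S := fun p hp => by
  simp only [dirDeriv, (eventuallyEq_of_mem (hS.mem_nhds hp) hfg).fderiv_eq]

theorem iterate_dirDeriv_congr (hS : IsOpen S) (hfg : EqOn f g S) :
    EqOn ((dirDeriv v)^[k] f) ((dirDeriv v)^[k] g) S := by
  induction k generalizing f g with
  | zero => exact hfg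
  | succ _ ih => exact ih (dirDeriv_congr hS hfg)

theorem iterate_dirDeriv_add (hS : IsOpen S) (hf : ContDiffOn ℝ k f S)
    (hg : ContDiffOn ℝ k g S) :
    EqOn ((dirDeriv v)^[k] (fun p => f p + g p))
      (fun p => ((dirDeriv v)^[k] f) p + ((dirDeriv v)^[k] g) p) S := by
  induction k with
  | zero => exact fun _ _ => rfl
  | succ k ih =>
    have hk : (k : WithTop ℕ∞) ≤ (k + 1 : ℕ) := by exact_mod_cast Nat.le_succ k
    intro p hp
    simp only [Function.iterate_succ_apply']
    rw [dirDeriv_congr hS (ih (hf.of_le hk) (hg.of_le hk)) hp]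
    simp [dirDeriv, fderiv_fun_add (differentiableAt_iterate_dirDeriv hS hf hp)
      (differentiableAt_iterate_dirDeriv hS hg hp)]

theorem iteratedDeriv_comp_line {γ : ℝ → E} (hγ : ∀ s, HasDerivAt γ v s) (hS : IsOpen S)
    (hf : ContDiffOn ℝ k f S) {t : ℝ} (ht : γ t ∈ S) :
    iteratedDeriv k (fun s => f (γ s)) t = ((dirDeriv v)^[k] f) (γ t) := by
  induction k generalizing t with
  | zero => simp
  | succ k ih =>
    have hmem : ∀ᶠ s in 𝓝 t, γ s ∈ S := (hγ t).continuousAt.eventually_mem (hS.mem_nhds ht)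
    have hev : iteratedDeriv k (fun s => f (γ s)) =ᶠ[𝓝 t]
        fun s => ((dirDeriv v)^[k] f) (γ s) := by
      filter_upwards [hmem] with s hs using ih (hf.of_le (by exact_mod_cast Nat.le_succ k)) hs
    rw [iteratedDeriv_succ, Function.iterate_succ_apply', hev.deriv_eq]
    exact ((differentiableAt_iterate_dirDeriv hS hf ht).hasFDerivAt.comp_hasDerivAt t
      (hγ t)).deriv

end DirectionalDerivative

noncomputable section Plane

/-- The vector fields `t ∂_t` and `r ∂_r`. -/
def coneField : Bool → (ℝ × ℝ →L[ℝ] ℝ × ℝ)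
  | false => (ContinuousLinearMap.inl ℝ ℝ ℝ).comp (ContinuousLinearMap.fst ℝ ℝ ℝ)
  | true => (ContinuousLinearMap.inr ℝ ℝ ℝ).comp (ContinuousLinearMap.snd ℝ ℝ ℝ)

/-- The partial derivative `∂_t`. -/
abbrev dt : (ℝ × ℝ → ℝ) → ℝ × ℝ → ℝ := dirDeriv (1, 0)

/-- The partial derivative `∂_r`. -/
abbrev dr : (ℝ × ℝ → ℝ) → ℝ × ℝ → ℝ := dirDeriv (0, 1)

/-- The open first quadrant. -/
def quadrant : Set (ℝ × ℝ) := Ioi 0 ×ˢ Ioi 0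

theorem isOpen_quadrant : IsOpen quadrant := isOpen_Ioi.prod isOpen_Ioi

variable {S : Set (ℝ × ℝ)} {w : ℝ × ℝ → ℝ} {n k j : ℕ} {f g : ℝ × ℝ → ℝ} {t r : ℝ}

theorem fieldDeriv_false (f : ℝ × ℝ → ℝ) (p : ℝ × ℝ) :
    fieldDeriv (coneField false) f p = p.1 * dt f p := by
  have : coneField false p = p.1 • ((1, 0) : ℝ × ℝ) := by ext <;> simp [coneField]
  rw [fieldDeriv, this, map_smul, dt, dirDeriv, smul_eq_mul]

theorem fieldDeriv_true (f : ℝ × ℝ → ℝ) (p : ℝ × ℝ) :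
    fieldDeriv (coneField true) f p = p.2 * dr f p := by
  have : coneField true p = p.2 • ((0, 1) : ℝ × ℝ) := by ext <;> simp [coneField]
  rw [fieldDeriv, this, map_smul, dr, dirDeriv, smul_eq_mul]

theorem hasDerivAt_prodMk_left (r s : ℝ) : HasDerivAt (fun s : ℝ => (s, r)) (1, 0) s :=
  (hasDerivAt_id s).prodMk (hasDerivAt_const s r)

theorem hasDerivAt_prodMk_right (t ρ : ℝ) : HasDerivAt (fun ρ : ℝ => (t, ρ)) (0, 1) ρ :=
  (hasDerivAt_const ρ t).prodMk (hasDerivAt_id ρ)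

theorem hasDerivAt_fst (h : DifferentiableAt ℝ f (t, r)) :
    HasDerivAt (fun s => f (s, r)) (dt f (t, r)) t :=
  h.hasFDerivAt.comp_hasDerivAt t (hasDerivAt_prodMk_left r t)

theorem hasDerivAt_snd (h : DifferentiableAt ℝ f (t, r)) :
    HasDerivAt (fun ρ => f (t, ρ)) (dr f (t, r)) r :=
  h.hasFDerivAt.comp_hasDerivAt r (hasDerivAt_prodMk_right t r)

theorem eventually_prodMk_left_mem (hS : IsOpen S) (h : (t, r) ∈ S) : ∀ᶠ s in 𝓝 t, (s, r) ∈ S :=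
  (Continuous.prodMk_left r).continuousAt.eventually_mem (hS.mem_nhds h)

theorem eventually_prodMk_right_mem (hS : IsOpen S) (h : (t, r) ∈ S) :
    ∀ᶠ ρ in 𝓝 r, (t, ρ) ∈ S :=
  (Continuous.prodMk_right t).continuousAt.eventually_mem (hS.mem_nhds h)

theorem pderiv_eq_iterate (hS : IsOpen S) (hf : ContDiffOn ℝ (k + j : ℕ) f S) (h : (t, r) ∈ S) :
    pderiv k j (fun s ρ => f (s, ρ)) t r = (dt^[k] (dr^[j] f)) (t, r) := by
  have hr : (fun s => iteratedDeriv j (fun ρ => f (s, ρ)) r) =ᶠ[𝓝 t]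
      fun s => (dr^[j] f) (s, r) := by
    filter_upwards [eventually_prodMk_left_mem hS h] with s hs
    exact iteratedDeriv_comp_line (hasDerivAt_prodMk_right s) hS
      (hf.of_le (by exact_mod_cast Nat.le_add_left j k)) hs
  rw [pderiv, hr.iteratedDeriv_eq]
  exact iteratedDeriv_comp_line (hasDerivAt_prodMk_left r) hS
    (contDiffOn_iterate_dirDeriv hS hf) h

theorem pderiv_add (hS : IsOpen S) (hf : ContDiffOn ℝ (k + j : ℕ) f S)
    (hg : ContDiffOn ℝ (k + j : ℕ) g S) (h : (t, r) ∈ S) :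
    pderiv k j (fun s ρ => f (s, ρ) + g (s, ρ)) t r =
      pderiv k j (fun s ρ => f (s, ρ)) t r + pderiv k j (fun s ρ => g (s, ρ)) t r := by
  have hj : (j : WithTop ℕ∞) ≤ (k + j : ℕ) := by exact_mod_cast Nat.le_add_left j k
  rw [pderiv_eq_iterate hS hf h, pderiv_eq_iterate hS hg h,
    pderiv_eq_iterate (f := fun p => f p + g p) hS (hf.add hg) h,
    iterate_dirDeriv_congr hS (iterate_dirDeriv_add hS (hf.of_le hj) (hg.of_le hj)) h,
    iterate_dirDeriv_add hS (contDiffOn_iterate_dirDeriv hS hf)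
      (contDiffOn_iterate_dirDeriv hS hg) h]

theorem pderiv_congr {u v : ℝ → ℝ → ℝ} (hS : IsOpen S)
    (huv : ∀ t r, (t, r) ∈ S → u t r = v t r) (h : (t, r) ∈ S) :
    pderiv k j u t r = pderiv k j v t r := by
  refine EventuallyEq.iteratedDeriv_eq k ?_
  filter_upwards [eventually_prodMk_left_mem hS h] with s hs
  refine EventuallyEq.iteratedDeriv_eq j ?_
  filter_upwards [eventually_prodMk_right_mem hS hs] with ρ hρ using huv s ρ hρ

theorem isSymbol_comp_fst {v h : ℝ → ℝ} (hh : IsSymbol eulerField (Ioi 0) v n h) :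
    IsSymbol coneField quadrant (fun p => v p.1) n (fun p => h p.1) := by
  refine hh.comp (c := fun i _ => if i then 0 else 1) isOpen_Ioi isOpen_quadrant
    contDiff_fst.contDiffOn (fun p hp => hp.1) (fun i => .const _) fun i p _ => ?_
  cases i
  · simp [fieldDeriv_false, dt, dirDeriv, fderiv_fst]
  · simp [fieldDeriv_true, dr, dirDeriv, fderiv_fst]

theorem isSymbol_comp_snd {v h : ℝ → ℝ} (hh : IsSymbol eulerField (Ioi 0) v n h) :
    IsSymbol coneField quadrant (fun p => v p.2) n (fun p => h p.2) := by
  refine hh.comp (c := fun i _ => if i then 1 else 0) isOpen_Ioi isOpen_quadrant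
    contDiff_snd.contDiffOn (fun p hp => hp.2) (fun i => .const _) fun i p _ => ?_
  cases i
  · simp [fieldDeriv_false, dt, dirDeriv, fderiv_snd]
  · simp [fieldDeriv_true, dr, dirDeriv, fderiv_snd]

theorem isSymbol_fst : IsSymbol coneField quadrant (fun p => p.1) n (fun p => p.1) :=
  isSymbol_comp_fst isSymbol_id

theorem isSymbol_snd : IsSymbol coneField quadrant (fun p => p.2) n (fun p => p.2) :=
  isSymbol_comp_snd isSymbol_id

namespace IsSymbol

theorem dt (hf : IsSymbol coneField S w (n + 1) f) (hS : IsOpen S) (hQ : S ⊆ quadrant) :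
    IsSymbol coneField S (fun p => p.1⁻¹ * w p) n (dt f) := by
  refine (((isSymbol_comp_fst isSymbol_inv).mono hQ).mul (hf.fieldDeriv false) hS).congr hS
    fun p hp => ?_
  have ht : 0 < p.1 := (hQ hp).1
  simp only [fieldDeriv_false, inv_mul_cancel_left₀ ht.ne']

theorem dr (hf : IsSymbol coneField S w (n + 1) f) (hS : IsOpen S) (hQ : S ⊆ quadrant) :
    IsSymbol coneField S (fun p => p.2⁻¹ * w p) n (dr f) := by
  refine (((isSymbol_comp_snd isSymbol_inv).mono hQ).mul (hf.fieldDeriv true) hS).congr hS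
    fun p hp => ?_
  have hr : 0 < p.2 := (hQ hp).2
  simp only [fieldDeriv_true, inv_mul_cancel_left₀ hr.ne']

theorem iterate_dt (hf : IsSymbol coneField S w (n + k) f) (hS : IsOpen S)
    (hQ : S ⊆ quadrant) :
    IsSymbol coneField S (fun p => (p.1 ^ k)⁻¹ * w p) n (QuinticWave.dt^[k] f) := by
  induction k generalizing f w with
  | zero => simpa using hf
  | succ k ih =>
    refine (ih (hf.dt hS hQ)).congr_weight fun p _ => ?_
    rw [pow_succ, mul_inv, mul_assoc]

theorem iterate_dr (hf : IsSymbol coneField S w (n + k) f) (hS : IsOpen S)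
    (hQ : S ⊆ quadrant) :
    IsSymbol coneField S (fun p => (p.2 ^ k)⁻¹ * w p) n (QuinticWave.dr^[k] f) := by
  induction k generalizing f w with
  | zero => simpa using hf
  | succ k ih =>
    refine (ih (hf.dr hS hQ)).congr_weight fun p _ => ?_
    rw [pow_succ, mul_inv, mul_assoc]

theorem exists_abs_pderiv_le (hf : IsSymbol coneField S w (k + j) f) (hS : IsOpen S)
    (hQ : S ⊆ quadrant) (hw : ∀ p ∈ S, 0 ≤ w p) : ∃ C, 0 ≤ C ∧ ∀ t r, (t, r) ∈ S →
      |pderiv k j (fun s ρ => f (s, ρ)) t r| ≤ C * ((t ^ k)⁻¹ * ((r ^ j)⁻¹ * w (t, r))) := by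
  have hiter := IsSymbol.iterate_dt (n := 0) (k := k) (by simpa using hf.iterate_dr hS hQ) hS hQ
  obtain ⟨C, hC, h⟩ := exists_le_of_isBigO_principal hiter.isBigO fun p hp => by
    have ht : 0 < p.1 := (hQ hp).1
    have hr : 0 < p.2 := (hQ hp).2
    have := hw p hp
    positivity
  refine ⟨C, hC, fun t r htr => ?_⟩
  rw [pderiv_eq_iterate hS hf.contDiffOn htr]
  exact h (t, r) htr

end IsSymbol

end Plane

noncomputable section PowerSymbols

/-- A symbol of weight `x^p` on the half-line, of every order. -/
def IsPowerSymbol (p : ℝ) (a : ℝ → ℝ) : Prop :=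
  ∀ n, IsSymbol eulerField (Ioi 0) (fun x => x ^ p) n a

/-- A symbol of weight `x^p` on the half-line, extended by zero to the line. -/
structure IsExtendedPowerSymbol (p : ℝ) (a : ℝ → ℝ) : Prop where
  isPowerSymbol : IsPowerSymbol p a
  eq_zero : ∀ x ≤ 0, a x = 0

/-- The primitive that vanishes at the origin. -/
def prim (a : ℝ → ℝ) (x : ℝ) : ℝ := ∫ s in (0 : ℝ)..x, a s

variable {p : ℝ} {a : ℝ → ℝ} {n : ℕ}

namespace IsPowerSymbol

theorem hasDerivAt (h : IsPowerSymbol p a) {x : ℝ} (hx : 0 < x) : HasDerivAt a (deriv a x) x :=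
  ((h 1).differentiableAt isOpen_Ioi hx).hasDerivAt

theorem exists_abs_le (h : IsPowerSymbol p a) : ∃ C, 0 ≤ C ∧ ∀ x, 0 < x → |a x| ≤ C * x ^ p :=
  exists_le_of_isBigO_principal (h 0).isBigO fun _ hx => rpow_nonneg (mem_Ioi.1 hx).le p

protected theorem deriv (h : IsPowerSymbol p a) : IsPowerSymbol (p - 1) (deriv a) := fun n => by
  refine ((isSymbol_inv.mul ((h (n + 1)).fieldDeriv ()) isOpen_Ioi).congr_weight
    fun x hx => ?_).congr isOpen_Ioi fun x hx => ?_
  all_goals have hx : x ≠ 0 := (mem_Ioi.1 hx).ne'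
  · simp only [rpow_sub_one hx, inv_mul_eq_div]
  · simp only [fieldDeriv_eulerField, inv_mul_cancel_left₀ hx]

protected theorem iteratedDeriv (h : IsPowerSymbol p a) (i : ℕ) :
    IsPowerSymbol (p - i) (iteratedDeriv i a) := by
  induction i with
  | zero => simpa using h
  | succ i ih =>
    rw [iteratedDeriv_succ]
    push_cast
    simpa [sub_sub] using ih.deriv

theorem hasDerivAt_iteratedDeriv (h : IsPowerSymbol p a) (i : ℕ) {x : ℝ} (hx : 0 < x) :
    HasDerivAt (iteratedDeriv i a) (iteratedDeriv i (deriv a) x) x := by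
  rw [← iteratedDeriv_succ', iteratedDeriv_succ]
  exact (h.iteratedDeriv i).hasDerivAt hx

end IsPowerSymbol

theorem tendsto_abs_rpow_zero (hp : 0 < p) :
    Tendsto (fun x : ℝ => |x| ^ p) (𝓝 0) (𝓝 0) := by
  simpa [zero_rpow hp.ne'] using (continuous_abs.tendsto (0 : ℝ)).rpow_const (.inr hp.le)

namespace IsExtendedPowerSymbol

theorem indicator (h : IsPowerSymbol p a) : IsExtendedPowerSymbol p ((Ioi 0).indicator a) :=
  ⟨fun n => (h n).congr isOpen_Ioi fun _ hx => indicator_of_mem hx a,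
    fun _ hx => indicator_of_notMem (by simpa using hx) a⟩

theorem exists_abs_le (h : IsExtendedPowerSymbol p a) :
    ∃ C, 0 ≤ C ∧ ∀ x, |a x| ≤ C * |x| ^ p := by
  obtain ⟨C, hC, ha⟩ := h.isPowerSymbol.exists_abs_le
  refine ⟨C, hC, fun x => ?_⟩
  rcases le_or_gt x 0 with hx | hx
  · rw [h.eq_zero x hx, abs_zero]
    positivity
  · rw [abs_of_pos hx]
    exact ha x hx

theorem isBigO (h : IsExtendedPowerSymbol p a) (l : Filter ℝ) : a =O[l] fun x => |x| ^ p := by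
  obtain ⟨C, -, ha⟩ := h.exists_abs_le
  refine .of_bound C (.of_forall fun x => ?_)
  simpa [abs_of_nonneg (rpow_nonneg (abs_nonneg x) p)] using ha x

theorem hasDerivAt_of_nonpos (h : IsExtendedPowerSymbol p a) (hp : 1 < p) {x : ℝ} (hx : x ≤ 0) :
    HasDerivAt a 0 x := by
  rcases hx.lt_or_eq with hx | rfl
  · refine (hasDerivAt_const x (0 : ℝ)).congr_of_eventuallyEq ?_
    filter_upwards [gt_mem_nhds hx] with y hy using h.eq_zero y hy.le
  · have hlittle : (fun x : ℝ => |x| ^ (p - 1) * |x|) =o[𝓝 0] fun x => 1 * x :=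
      ((isLittleO_one_iff ℝ).2 (tendsto_abs_rpow_zero (sub_pos.2 hp))).mul_isBigO
        (isBigO_refl _ _).abs_left
    have hrpow (x : ℝ) : |x| ^ p = |x| ^ (p - 1) * |x| := by
      rw [← rpow_add_one' (abs_nonneg x) (by linarith), sub_add_cancel]
    rw [hasDerivAt_iff_isLittleO]
    simpa [h.eq_zero 0 le_rfl] using (h.isBigO _).trans_isLittleO (by simpa [hrpow] using hlittle)

protected theorem deriv (h : IsExtendedPowerSymbol p a) (hp : 1 < p) :
    IsExtendedPowerSymbol (p - 1) (deriv a) :=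
  ⟨h.isPowerSymbol.deriv, fun _ hx => (h.hasDerivAt_of_nonpos hp hx).deriv⟩

theorem differentiable (h : IsExtendedPowerSymbol p a) (hp : 1 < p) : Differentiable ℝ a :=
  fun x => (le_or_gt x 0).elim (fun hx => (h.hasDerivAt_of_nonpos hp hx).differentiableAt)
    fun hx => (h.isPowerSymbol.hasDerivAt hx).differentiableAt

theorem continuous (h : IsExtendedPowerSymbol p a) (hp : 0 < p) : Continuous a := by
  refine continuous_iff_continuousAt.2 fun x => ?_
  rcases lt_trichotomy x 0 with hx | rfl | hx
  · refine (continuousAt_const (y := (0 : ℝ))).congr ?_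
    filter_upwards [gt_mem_nhds hx] with y hy using (h.eq_zero y hy.le).symm
  · rw [ContinuousAt, h.eq_zero 0 le_rfl]
    exact (h.isBigO _).trans_tendsto (tendsto_abs_rpow_zero hp)
  · exact (h.isPowerSymbol.hasDerivAt hx).continuousAt

theorem contDiff (h : IsExtendedPowerSymbol p a) (hp : (n : ℝ) < p) : ContDiff ℝ n a := by
  induction n generalizing p a with
  | zero => exact contDiff_zero.2 (h.continuous (by simpa using hp))
  | succ n ih =>
    push_cast at hp
    have hp1 : 1 < p := by linarith [n.cast_nonneg (α := ℝ)]
    push_cast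
    exact contDiff_succ_iff_deriv.2
      ⟨h.differentiable hp1, by simp, ih (h.deriv hp1) (by linarith)⟩

theorem hasDerivAt_prim (h : IsExtendedPowerSymbol p a) (hp : 0 < p) (x : ℝ) :
    HasDerivAt (prim a) (a x) x :=
  ((h.continuous hp).integral_hasStrictDerivAt 0 x).hasDerivAt

theorem isBigO_prim (h : IsExtendedPowerSymbol p a) (hp : 0 < p) :
    prim a =O[𝓟 (Ioi 0)] fun x => x ^ (p + 1) := by
  obtain ⟨C, hC, ha⟩ := h.exists_abs_le
  refine isBigO_principal.2 ⟨C, fun x hx => ?_⟩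
  have hx : 0 < x := hx
  have hle : ∀ y ∈ uIoc 0 x, ‖a y‖ ≤ C * x ^ p := fun y hy => by
    rw [uIoc_of_le hx.le] at hy
    refine (ha y).trans ?_
    rw [abs_of_pos hy.1]
    gcongr
    exacts [hy.1.le, hy.2]
  calc ‖prim a x‖ ≤ C * x ^ p * |x - 0| := intervalIntegral.norm_integral_le_of_norm_le_const hle
    _ = C * ‖x ^ (p + 1)‖ := by
      rw [norm_of_nonneg (by positivity), sub_zero, abs_of_pos hx, rpow_add_one hx.ne', mul_assoc]

protected theorem prim (h : IsExtendedPowerSymbol p a) (hp : 0 < p) :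
    IsExtendedPowerSymbol (p + 1) (prim a) := by
  refine ⟨fun n => IsSymbol.of_succ ?_, fun x hx => ?_⟩
  · refine .succ_of_hasDerivAt isOpen_Ioi (fun x hx => (mem_Ioi.1 hx).ne')
      (fun x _ => h.hasDerivAt_prim hp x) (h.isBigO_prim hp) ?_
    refine (isSymbol_id.mul (h.isPowerSymbol n) isOpen_Ioi).congr_weight fun x hx => ?_
    simp only [rpow_add_one (mem_Ioi.1 hx).ne', mul_comm]
  · refine intervalIntegral.integral_zero_ae (.of_forall fun y hy => ?_)
    rw [uIoc_of_ge hx] at hy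
    exact h.eq_zero y hy.2

end IsExtendedPowerSymbol

end PowerSymbols

noncomputable section TaylorRemainder

/-- The wedge `0 < r < κ t` of points `(t, r)`. -/
def wedge (κ : ℝ) : Set (ℝ × ℝ) := {q | 0 < q.2 ∧ q.2 < κ * q.1}

/-- The wedge `t/4 < r < 3t` around the light cone. -/
def coneNhd : Set (ℝ × ℝ) := {q | q.1 / 4 < q.2 ∧ q.2 < 3 * q.1}

/-- The remainder of the Taylor polynomial of degree `< m` of `a` at `t`, evaluated at
`t + c r`. -/
def taylorRem (a : ℝ → ℝ) (c : ℝ) (m : ℕ) (q : ℝ × ℝ) : ℝ :=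
  a (q.1 + c * q.2) - ∑ i ∈ Finset.range m, (c * q.2) ^ i / i.factorial * iteratedDeriv i a q.1

variable {p c κ t r : ℝ} {a : ℝ → ℝ} {n m : ℕ}

theorem isOpen_wedge : IsOpen (wedge κ) :=
  (isOpen_lt continuous_const continuous_snd).inter
    (isOpen_lt continuous_snd (continuous_const.mul continuous_fst))

theorem wedge_subset (hκ : 0 < κ) : wedge κ ⊆ quadrant := fun _ hq =>
  ⟨pos_of_mul_pos_right (hq.1.trans hq.2) hκ.le, hq.1⟩

theorem isOpen_coneNhd : IsOpen coneNhd :=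
  (isOpen_lt (continuous_fst.div_const 4) continuous_snd).inter
    (isOpen_lt continuous_snd (continuous_const.mul continuous_fst))

theorem coneNhd_subset : coneNhd ⊆ wedge 3 := fun q hq =>
  ⟨by linarith [hq.1, hq.2], hq.2⟩

theorem wedge_half_union_coneNhd : wedge (1 / 2) ∪ coneNhd = wedge 3 := by
  ext ⟨t, r⟩
  simp only [wedge, coneNhd, mem_union, mem_ofPred_eq]
  grind

theorem half_lt_add_mul (hc : |c| ≤ 1) (hr : 0 ≤ r) (hrt : r < 1 / 2 * t) :
    t / 2 < t + c * r ∧ t + c * r < 2 * t := by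
  have := abs_le.1 hc
  constructor <;> nlinarith

theorem add_mul_pos (hc : |c| ≤ 1) {q : ℝ × ℝ} (hq : q ∈ wedge (1 / 2)) :
    0 < q.1 + c * q.2 := by
  have ht : 0 < q.1 := (wedge_subset (by norm_num) hq).1
  linarith [(half_lt_add_mul hc hq.1.le hq.2).1]

theorem rpow_le_of_half_le {x : ℝ} (ht : 0 < t) (h₁ : t / 2 ≤ x) (h₂ : x ≤ 2 * t) :
    x ^ p ≤ 2 ^ |p| * t ^ p := by
  have hx : 0 < x := by linarith
  rcases le_total 0 p with hp | hp
  · rw [abs_of_nonneg hp, ← mul_rpow zero_le_two ht.le]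
    exact rpow_le_rpow hx.le h₂ hp
  · calc x ^ p ≤ (t / 2) ^ p := rpow_le_rpow_of_nonpos (by positivity) h₁ hp
      _ = 2 ^ |p| * t ^ p := by
        rw [abs_of_nonpos hp, div_rpow ht.le zero_le_two, rpow_neg zero_le_two, mul_comm,
          div_eq_mul_inv]

section Derivatives

theorem hasDerivAt_comp_add_mul_fst (ha : HasDerivAt a (deriv a (t + c * r)) (t + c * r)) :
    HasDerivAt (fun s => a (s + c * r)) (deriv a (t + c * r)) t :=
  ha.comp_add_const t (c * r)

theorem hasDerivAt_comp_add_mul_snd (ha : HasDerivAt a (deriv a (t + c * r)) (t + c * r)) :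
    HasDerivAt (fun ρ => a (t + c * ρ)) (c * deriv a (t + c * r)) r := by
  have hline : HasDerivAt (fun ρ => t + c * ρ) c r := by
    simpa using ((hasDerivAt_id r).const_mul c).const_add t
  exact (ha.comp r hline).congr_deriv (mul_comm _ _)

theorem hasDerivAt_taylorRem_fst (h : IsPowerSymbol p a) (ht : 0 < t) (htr : 0 < t + c * r) :
    HasDerivAt (fun s => taylorRem a c m (s, r)) (taylorRem (deriv a) c m (t, r)) t :=
  (hasDerivAt_comp_add_mul_fst (h.hasDerivAt htr)).sub <|
    HasDerivAt.fun_sum fun i _ =>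
      (h.hasDerivAt_iteratedDeriv i ht).const_mul ((c * r) ^ i / i.factorial)

theorem hasDerivAt_taylorRem_snd (h : IsPowerSymbol p a) (htr : 0 < t + c * r) :
    HasDerivAt (fun ρ => taylorRem a c m (t, ρ)) (c * taylorRem (deriv a) c (m - 1) (t, r)) r := by
  have hterm i : HasDerivAt (fun ρ => (c * ρ) ^ i / i.factorial * iteratedDeriv i a t)
      (i * (c * r) ^ (i - 1) * c / i.factorial * iteratedDeriv i a t) r := by
    have hlin : HasDerivAt (fun ρ => c * ρ) c r := by simpa using (hasDerivAt_id r).const_mul c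
    exact ((hlin.pow i).div_const _).mul_const _
  refine ((hasDerivAt_comp_add_mul_snd (h.hasDerivAt htr)).sub
    (HasDerivAt.fun_sum fun i _ => hterm i)).congr_deriv ?_
  rw [taylorRem, mul_sub, Finset.mul_sum]
  cases m with
  | zero => simp
  | succ m =>
    simp only [Finset.sum_range_succ', Nat.cast_zero, zero_mul, zero_div, add_zero,
      Nat.add_sub_cancel]
    congr 1
    refine Finset.sum_congr rfl fun i _ => ?_
    rw [Nat.factorial_succ, ← iteratedDeriv_succ']
    push_cast
    field_simp

end Derivatives

theorem exists_abs_taylorRem_zero_le (h : IsPowerSymbol p a) (hc : |c| ≤ 1) :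
    ∃ C, 0 ≤ C ∧ ∀ t r, 0 ≤ r → r < 1 / 2 * t → |taylorRem a c 0 (t, r)| ≤ C * t ^ p := by
  obtain ⟨C, hC, ha⟩ := h.exists_abs_le
  refine ⟨C * 2 ^ |p|, by positivity, fun t r hr hrt => ?_⟩
  obtain ⟨hlow, hup⟩ := half_lt_add_mul hc hr hrt
  have ht : 0 < t := by linarith
  simp only [taylorRem, Finset.range_zero, Finset.sum_empty, sub_zero]
  calc |a (t + c * r)| ≤ C * (t + c * r) ^ p := ha _ (by linarith)
    _ ≤ C * (2 ^ |p| * t ^ p) := by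
      gcongr
      exact rpow_le_of_half_le ht hlow.le hup.le
    _ = C * 2 ^ |p| * t ^ p := (mul_assoc _ _ _).symm

theorem exists_abs_taylorRem_le (h : IsPowerSymbol p a) (hc : |c| ≤ 1) (m : ℕ) :
    ∃ C, 0 ≤ C ∧ ∀ t r, 0 ≤ r → r < 1 / 2 * t →
      |taylorRem a c m (t, r)| ≤ C * (r ^ m * t ^ (p - m)) := by
  induction m generalizing p a with
  | zero => simpa using exists_abs_taylorRem_zero_le h hc
  | succ m ih =>
    obtain ⟨C, hC, hderiv⟩ := ih h.deriv
    refine ⟨C, hC, fun t r hr hrt => ?_⟩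
    have ht : 0 < t := by linarith
    have hpos ρ (hρ : ρ ∈ Icc 0 r) : 0 < t + c * ρ := by
      linarith [(half_lt_add_mul hc hρ.1 (hρ.2.trans_lt hrt)).1]
    have hbound ρ (hρ : ρ ∈ Icc 0 r) :
        ‖c * taylorRem (deriv a) c m (t, ρ)‖ ≤ C * (r ^ m * t ^ (p - 1 - m)) :=
      calc |c * taylorRem (deriv a) c m (t, ρ)|
          ≤ 1 * |taylorRem (deriv a) c m (t, ρ)| := by rw [abs_mul]; gcongr
        _ ≤ C * (ρ ^ m * t ^ (p - 1 - m)) := by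
          rw [one_mul]
          exact hderiv t ρ hρ.1 (hρ.2.trans_lt hrt)
        _ ≤ C * (r ^ m * t ^ (p - 1 - m)) := by
          gcongr
          exacts [hρ.1, hρ.2]
    have hmean := (convex_Icc (0 : ℝ) r).norm_image_sub_le_of_norm_hasDerivWithin_le
      (f := fun ρ => taylorRem a c (m + 1) (t, ρ))
      (fun ρ hρ => (hasDerivAt_taylorRem_snd h (hpos ρ hρ)).hasDerivWithinAt) hbound
      (left_mem_Icc.2 hr) (right_mem_Icc.2 hr)
    have hzero : taylorRem a c (m + 1) (t, 0) = 0 := by simp [taylorRem, Finset.sum_range_succ']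
    rw [hzero, sub_zero, sub_zero, norm_eq_abs, norm_of_nonneg hr] at hmean
    refine hmean.trans_eq ?_
    rw [sub_sub p, add_comm 1 (m : ℝ)]
    push_cast
    ring

theorem contDiffOn_taylorRem (h : IsPowerSymbol p a) (hc : |c| ≤ 1) :
    ContDiffOn ℝ n (taylorRem a c m) (wedge (1 / 2)) := by
  refine ((h n).contDiffOn.comp (by fun_prop) fun q hq => add_mul_pos hc hq).sub
    (ContDiffOn.sum fun i _ => ContDiffOn.mul (by fun_prop)
      (((h.iteratedDeriv i) n).contDiffOn.comp contDiffOn_fst fun q hq => ?_))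
  exact (wedge_subset (by norm_num) hq).1

theorem isBigO_snd_fst (hκ : 0 < κ) :
    (fun q : ℝ × ℝ => q.2) =O[𝓟 (wedge κ)] fun q => q.1 :=
  isBigO_principal_of_nonneg_of_le (fun _ hq => (wedge_subset hκ hq).2.le) fun _ hq => hq.2.le

theorem isBigO_fst_snd : (fun q : ℝ × ℝ => q.1) =O[𝓟 coneNhd] fun q => q.2 :=
  isBigO_principal_of_nonneg_of_le (C := 4)
    (fun _ hq => (wedge_subset three_pos (coneNhd_subset hq)).1.le) fun _ hq => by linarith [hq.1]

theorem isBigO_taylorWeight (m : ℕ) :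
    (fun q : ℝ × ℝ => q.2 * (q.2 ^ (m - 1) * q.1 ^ (p - 1 - (m - 1 : ℕ))))
      =O[𝓟 (wedge (1 / 2))] fun q => q.2 ^ m * q.1 ^ (p - m) := by
  cases m with
  | zero =>
    refine ((isBigO_snd_fst one_half_pos).mul
      (isBigO_refl (fun q : ℝ × ℝ => q.1 ^ (p - 1)) _)).congr' ?_ ?_
    · exact .of_forall fun q => by simp
    · refine eventually_principal.2 fun q hq => ?_
      have ht : 0 < q.1 := (wedge_subset one_half_pos hq).1
      simp only [rpow_sub_one ht.ne', pow_zero, Nat.cast_zero, sub_zero, one_mul]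
      field_simp
  | succ m =>
    refine (isBigO_refl _ _).congr_left fun q => ?_
    rw [Nat.add_sub_cancel, sub_sub, add_comm 1 (m : ℝ)]
    push_cast
    ring

theorem isSymbol_taylorRem_wedge_half (h : IsPowerSymbol p a) (hc : |c| ≤ 1) (m : ℕ) :
    IsSymbol coneField (wedge (1 / 2)) (fun q => q.2 ^ m * q.1 ^ (p - m)) n
      (taylorRem a c m) := by
  have hsub : wedge (1 / 2) ⊆ quadrant := wedge_subset one_half_pos
  have hO {p m} {a : ℝ → ℝ} (h : IsPowerSymbol p a) :
      taylorRem a c m =O[𝓟 (wedge (1 / 2))] fun q => q.2 ^ m * q.1 ^ (p - m) := by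
    obtain ⟨C, -, hle⟩ := exists_abs_taylorRem_le h hc m
    refine isBigO_principal.2 ⟨C, fun q hq => ?_⟩
    have ht : 0 < q.1 := (hsub hq).1
    have hr : 0 < q.2 := (hsub hq).2
    rw [norm_of_nonneg (by positivity : 0 ≤ q.2 ^ m * q.1 ^ (p - m))]
    exact hle q.1 q.2 hq.1.le hq.2
  induction n generalizing m p a with
  | zero => exact ⟨contDiffOn_taylorRem h hc, hO h⟩
  | succ n ih =>
    have hopen : IsOpen (wedge (1 / 2)) := isOpen_wedge
    have hcd : ContDiffOn ℝ (n + 1 : ℕ) (taylorRem a c m) (wedge (1 / 2)) :=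
      contDiffOn_taylorRem h hc
    have hdiff q (hq : q ∈ wedge (1 / 2)) : DifferentiableAt ℝ (taylorRem a c m) q :=
      (hcd.contDiffAt (hopen.mem_nhds hq)).differentiableAt (by simp)
    refine .succ_of_eqOn hopen hcd (hO h)
      (g := fun i => match i with
        | false => fun q => q.1 * taylorRem (deriv a) c m q
        | true => fun q => q.2 * (c * taylorRem (deriv a) c (m - 1) q)) ?_ ?_
    · rintro (_ | _)
      · refine ((isSymbol_fst.mono hsub).mul (ih h.deriv m) hopen).congr_weight fun q hq => ?_
        have ht : 0 < q.1 := (hsub hq).1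
        simp only [sub_right_comm p 1, rpow_sub_one ht.ne']
        field_simp
      · exact ((isSymbol_snd.mono hsub).mul ((ih h.deriv (m - 1)).const_mul hopen c)
          hopen).trans_isBigO (isBigO_taylorWeight m)
    · rintro (_ | _) q hq
      · simp only [fieldDeriv_false, (hasDerivAt_fst (hdiff q hq)).unique
          (hasDerivAt_taylorRem_fst h (hsub hq).1 (add_mul_pos hc hq))]
      · simp only [fieldDeriv_true, (hasDerivAt_snd (hdiff q hq)).unique
          (hasDerivAt_taylorRem_snd h (add_mul_pos hc hq))]

namespace IsExtendedPowerSymbol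

theorem isBigO_comp_add_mul (h : IsExtendedPowerSymbol p a) (hp : 0 ≤ p) (hc : |c| ≤ 1) :
    (fun q : ℝ × ℝ => a (q.1 + c * q.2)) =O[𝓟 (wedge 3)] fun q => q.1 ^ p := by
  have habs : (fun q : ℝ × ℝ => |q.1 + c * q.2| ^ p) =O[𝓟 (wedge 3)] fun q => q.1 ^ p := by
    refine isBigO_principal_of_nonneg_of_le (C := 4 ^ p) (fun q _ => by positivity)
      fun q hq => ?_
    have ht : 0 < q.1 := (wedge_subset three_pos hq).1
    rw [← mul_rpow (by norm_num) ht.le]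
    gcongr
    obtain ⟨hc₁, hc₂⟩ := abs_le.1 hc
    obtain ⟨hr, hrt⟩ := hq
    exact abs_le.2 ⟨by nlinarith, by nlinarith⟩
  exact ((h.isBigO ⊤).comp_tendsto tendsto_top).trans habs

theorem isSymbol_comp_add_mul (h : IsExtendedPowerSymbol p a) (hp : (n : ℝ) < p)
    (hc : |c| ≤ 1) :
    IsSymbol coneField (wedge 3) (fun q => q.1 ^ p) n (fun q => a (q.1 + c * q.2)) := by
  have hO := h.isBigO_comp_add_mul (n.cast_nonneg.trans hp.le) hc
  have hcd : ContDiff ℝ n (fun q : ℝ × ℝ => a (q.1 + c * q.2)) := (h.contDiff hp).comp (by fun_prop)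
  have hsub : wedge 3 ⊆ quadrant := wedge_subset three_pos
  induction n generalizing p a with
  | zero => exact ⟨hcd.contDiffOn, hO⟩
  | succ n ih =>
    have hopen : IsOpen (wedge 3) := isOpen_wedge
    push_cast at hp
    have hp1 : 1 < p := by linarith [n.cast_nonneg (α := ℝ)]
    have hn : (n : ℝ) < p - 1 := by linarith
    have hdiff q : DifferentiableAt ℝ (fun q : ℝ × ℝ => a (q.1 + c * q.2)) q :=
      hcd.contDiffAt.differentiableAt (by simp)
    have ha x : HasDerivAt a (_root_.deriv a x) x := (h.differentiable hp1 x).hasDerivAt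
    have hderiv := ih (h.deriv hp1) hn ((h.deriv hp1).isBigO_comp_add_mul (by linarith) hc)
      (((h.deriv hp1).contDiff hn).comp (by fun_prop))
    have hweight : EqOn (fun q : ℝ × ℝ => q.1 * q.1 ^ (p - 1)) (fun q => q.1 ^ p) (wedge 3) :=
      fun q hq => by
        have ht : 0 < q.1 := (hsub hq).1
        simp only [rpow_sub_one ht.ne', mul_div_cancel₀ _ ht.ne']
    refine .succ_of_eqOn hopen hcd.contDiffOn hO (g := fun i => match i with
        | false => fun q => q.1 * _root_.deriv a (q.1 + c * q.2)
        | true => fun q => c * (q.2 * _root_.deriv a (q.1 + c * q.2))) ?_ ?_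
    · rintro (_ | _)
      · exact ((isSymbol_fst.mono hsub).mul hderiv hopen).congr_weight hweight
      · exact ((((isSymbol_snd.mono hsub).trans_isBigO (isBigO_snd_fst three_pos)).mul hderiv
          hopen).congr_weight hweight).const_mul hopen c
    · rintro (_ | _) q -
      · simp only [fieldDeriv_false, (hasDerivAt_fst (hdiff q)).unique
          (hasDerivAt_comp_add_mul_fst (ha _))]
      · simp only [fieldDeriv_true, (hasDerivAt_snd (hdiff q)).unique
          (hasDerivAt_comp_add_mul_snd (ha _)), mul_left_comm]

theorem isSymbol_taylorRem_coneNhd (h : IsExtendedPowerSymbol p a) (hp : (n : ℝ) < p)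
    (hc : |c| ≤ 1) (m : ℕ) :
    IsSymbol coneField coneNhd (fun q => q.2 ^ m * q.1 ^ (p - m)) n (taylorRem a c m) := by
  have hsub : coneNhd ⊆ quadrant := coneNhd_subset.trans (wedge_subset three_pos)
  have hopen := isOpen_coneNhd
  have hterm (i : ℕ) : IsSymbol coneField coneNhd (fun q => q.1 ^ p) n
      (fun q => (c * q.2) ^ i / i.factorial * iteratedDeriv i a q.1) := by
    have hpow := (((isSymbol_snd (n := n)).mono hsub).trans_isBigO
      ((isBigO_snd_fst three_pos).mono (principal_mono.2 coneNhd_subset))).pow hopen i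
    have hderiv := (isSymbol_comp_fst (h.isPowerSymbol.iteratedDeriv i n)).mono hsub
    refine (((hpow.mul hderiv hopen).const_mul hopen (c ^ i / i.factorial)).congr_weight
      fun q hq => ?_).congr hopen fun q _ => by ring
    have ht : 0 < q.1 := (hsub hq).1
    simp only [rpow_sub ht, rpow_natCast]
    field_simp
  have hsum : IsSymbol coneField coneNhd (fun q => q.1 ^ p) n (fun q =>
      ∑ i ∈ Finset.range m, (c * q.2) ^ i / i.factorial * iteratedDeriv i a q.1) := by
    induction m with
    | zero =>
      exact ((hterm 0).const_mul hopen 0).congr hopen fun q _ => by simp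
    | succ m ih => exact (ih.add (hterm m) hopen).congr hopen fun q _ => Finset.sum_range_succ _ _
  refine (((h.isSymbol_comp_add_mul hp hc).mono coneNhd_subset).sub hsum hopen).trans_isBigO ?_
  refine ((isBigO_fst_snd.pow m).mul (isBigO_refl (fun q : ℝ × ℝ => q.1 ^ (p - m)) _)).congr'
    (eventually_principal.2 fun q hq => ?_) .rfl
  have ht : 0 < q.1 := (hsub hq).1
  simp only [rpow_sub ht, rpow_natCast]
  field_simp

theorem isSymbol_taylorRem_wedge_three (h : IsExtendedPowerSymbol p a) (hp : (n : ℝ) < p)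
    (hc : |c| ≤ 1) (m : ℕ) :
    IsSymbol coneField (wedge 3) (fun q => q.2 ^ m * q.1 ^ (p - m)) n (taylorRem a c m) := by
  rw [← wedge_half_union_coneNhd]
  exact (isSymbol_taylorRem_wedge_half h.isPowerSymbol hc m).union
    (h.isSymbol_taylorRem_coneNhd hp hc m) isOpen_wedge isOpen_coneNhd

end IsExtendedPowerSymbol

end TaylorRemainder

noncomputable section Scaling

/-- The logarithmic derivative `t λ'/λ` of the scaling function. -/
def logDerivLam (ν ε t : ℝ) : ℝ := -1 - ν - ε * cos (log t)

/-- The amplitude `√λ` of the rescaled ground state. -/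
def sqrtLam (ν ε t : ℝ) : ℝ := √(lam ν ε t)

/-- The coefficient of `source₁` in `∂_t²` of the bulk term. -/
def omega₁ (ν ε t : ℝ) : ℝ := ε * sin (log t) - logDerivLam ν ε t

/-- The coefficient of `source₂` in `∂_t²` of the bulk term. -/
def omega₂ (ν ε t : ℝ) : ℝ := logDerivLam ν ε t ^ 2

variable {ν ε t : ℝ} {n : ℕ}

theorem lam_pos (ht : 0 < t) : 0 < lam ν ε t := by
  unfold lam
  positivity

theorem sqrtLam_pos (ht : 0 < t) : 0 < sqrtLam ν ε t := sqrt_pos.2 (lam_pos ht)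

theorem sqrtLam_sq (ht : 0 < t) : sqrtLam ν ε t ^ 2 = lam ν ε t := sq_sqrt (lam_pos ht).le

theorem mu_eq (ht : 0 < t) : mu ν ε t = t * sqrtLam ν ε t ^ 2 := by rw [mu, sqrtLam_sq ht]

theorem hasDerivAt_lam (ht : 0 < t) :
    HasDerivAt (lam ν ε) (logDerivLam ν ε t / t * lam ν ε t) t := by
  have hrpow : HasDerivAt (fun t : ℝ => t ^ (-1 - ν)) ((-1 - ν) * t ^ (-1 - ν - 1)) t :=
    hasDerivAt_rpow_const (.inl ht.ne')
  have hexp := ((hasDerivAt_log ht.ne').sin.const_mul (-ε)).exp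
  refine (hrpow.mul hexp).congr_deriv ?_
  rw [rpow_sub_one ht.ne', lam, logDerivLam]
  field_simp
  ring

theorem hasDerivAt_sqrtLam (ht : 0 < t) :
    HasDerivAt (sqrtLam ν ε) (logDerivLam ν ε t / (2 * t) * sqrtLam ν ε t) t := by
  refine ((hasDerivAt_lam ht).sqrt (lam_pos ht).ne').congr_deriv ?_
  have hs : 0 < sqrtLam ν ε t := sqrtLam_pos ht
  rw [← sqrtLam, ← sqrtLam_sq ht]
  field_simp

theorem hasDerivAt_logDerivLam (ht : 0 < t) :
    HasDerivAt (logDerivLam ν ε) (ε * sin (log t) / t) t := by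
  refine (((hasDerivAt_log ht.ne').cos.const_mul ε).const_sub (-1 - ν)).congr_deriv ?_
  field_simp

theorem isSymbol_cos_log_and_sin_log :
    IsSymbol eulerField (Ioi 0) (fun _ => 1) n (fun t => cos (log t)) ∧
      IsSymbol eulerField (Ioi 0) (fun _ => 1) n (fun t => sin (log t)) := by
  have hlog : ContDiffOn ℝ (0 : ℕ) log (Ioi 0) := contDiffOn_log.mono fun t ht => (mem_Ioi.1 ht).ne'
  have hcos : (fun t => cos (log t)) =O[𝓟 (Ioi 0)] fun _ => (1 : ℝ) :=
    .of_bound 1 (.of_forall fun t => by simpa using abs_cos_le_one (log t))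
  have hsin : (fun t => sin (log t)) =O[𝓟 (Ioi 0)] fun _ => (1 : ℝ) :=
    .of_bound 1 (.of_forall fun t => by simpa using abs_sin_le_one (log t))
  have h0 (t : ℝ) (ht : t ∈ Ioi 0) : t ≠ 0 := (mem_Ioi.1 ht).ne'
  induction n with
  | zero =>
    exact ⟨⟨contDiff_cos.comp_contDiffOn hlog, hcos⟩,
      ⟨contDiff_sin.comp_contDiffOn hlog, hsin⟩⟩
  | succ n ih =>
    refine ⟨.succ_of_hasDerivAt isOpen_Ioi h0 (fun t ht => (hasDerivAt_log (h0 t ht)).cos) hcos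
      ((ih.2.neg isOpen_Ioi).congr isOpen_Ioi fun t ht => ?_),
      .succ_of_hasDerivAt isOpen_Ioi h0 (fun t ht => (hasDerivAt_log (h0 t ht)).sin) hsin
      (ih.1.congr isOpen_Ioi fun t ht => ?_)⟩
    all_goals
      have := h0 t ht
      field_simp

theorem isSymbol_logDerivLam : IsSymbol eulerField (Ioi 0) (fun _ => 1) n (logDerivLam ν ε) :=
  (IsSymbol.const (-1 - ν)).sub (isSymbol_cos_log_and_sin_log.1.const_mul isOpen_Ioi ε) isOpen_Ioi

theorem isSymbol_omega₁ : IsSymbol eulerField (Ioi 0) (fun _ => 1) n (omega₁ ν ε) :=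
  (isSymbol_cos_log_and_sin_log.2.const_mul isOpen_Ioi ε).sub isSymbol_logDerivLam isOpen_Ioi

theorem isSymbol_omega₂ : IsSymbol eulerField (Ioi 0) (fun _ => 1) n (omega₂ ν ε) :=
  (isSymbol_logDerivLam.pow isOpen_Ioi 2).congr_weight fun _ _ => one_pow 2

theorem isSymbol_sqrtLam : IsSymbol eulerField (Ioi 0) (sqrtLam ν ε) n (sqrtLam ν ε) := by
  induction n with
  | zero =>
    refine ⟨contDiffOn_zero.2 fun t ht => ?_, isBigO_refl _ _⟩
    exact (hasDerivAt_sqrtLam ht).continuousAt.continuousWithinAt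
  | succ n ih =>
    refine .succ_of_hasDerivAt isOpen_Ioi (fun t ht => (mem_Ioi.1 ht).ne')
      (fun t ht => hasDerivAt_sqrtLam ht) (isBigO_refl _ _) ?_
    refine ((((isSymbol_logDerivLam (ν := ν) (ε := ε)).const_mul isOpen_Ioi (1 / 2)).mul ih
      isOpen_Ioi).congr_weight
      fun t _ => one_mul _).congr isOpen_Ioi fun t ht => ?_
    have := (mem_Ioi.1 ht).ne'
    field_simp

theorem isSymbol_sqrtLam_inv : IsSymbol eulerField (Ioi 0) (fun t => (sqrtLam ν ε t)⁻¹) n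
    (fun t => (sqrtLam ν ε t)⁻¹) :=
  isSymbol_sqrtLam.inv isOpen_Ioi (fun _ ht => (sqrtLam_pos ht).ne') (isBigO_refl _ _)

theorem isSymbol_lam : IsSymbol eulerField (Ioi 0) (lam ν ε) n (lam ν ε) :=
  ((isSymbol_sqrtLam.pow isOpen_Ioi 2).congr_weight fun _ ht => sqrtLam_sq ht).congr isOpen_Ioi
    fun _ ht => (sqrtLam_sq ht).symm

theorem lam_isTheta : lam ν ε =Θ[𝓟 (Ioi 0)] fun t => t ^ (-1 - ν) := by
  have hexp : (fun t => exp (-ε * sin (log t))) =Θ[𝓟 (Ioi 0)] fun _ => (1 : ℝ) := by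
    refine isTheta_exp_comp_one.2 (isBoundedUnder_of ⟨|ε|, fun t => ?_⟩)
    rw [abs_mul, abs_neg]
    exact mul_le_of_le_one_right (abs_nonneg ε) (abs_sin_le_one _)
  exact ((isTheta_refl (fun t : ℝ => t ^ (-1 - ν)) _).mul hexp).trans_eventuallyEq
    (.of_forall fun t => mul_one _)

theorem sqrtLam_inv_isTheta :
    (fun t => (sqrtLam ν ε t)⁻¹) =Θ[𝓟 (Ioi 0)] fun t => t ^ ((1 + ν) / 2) := by
  refine (lam_isTheta.sqrt (eventually_principal.2 fun t ht => (lam_pos ht).le)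
    (eventually_principal.2 fun t ht => rpow_nonneg (mem_Ioi.1 ht).le _)).inv.trans_eventuallyEq
    (eventually_principal.2 fun t ht => ?_)
  have ht : 0 ≤ t := (mem_Ioi.1 ht).le
  simp only [sqrt_eq_rpow, ← rpow_mul ht, ← rpow_neg ht]
  congr 1
  ring

theorem mu_isTheta : mu ν ε =Θ[𝓟 (Ioi 0)] fun t => t ^ (-ν) := by
  refine ((isTheta_refl (fun t : ℝ => t) _).mul lam_isTheta).trans_eventuallyEq
    (eventually_principal.2 fun t ht => ?_)
  have ht : 0 < t := ht
  simp only [sub_eq_add_neg, rpow_add ht, rpow_neg_one]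
  exact mul_inv_cancel_left₀ ht.ne' _

theorem one_isBigO_mu (hν : 0 ≤ ν) (t₀ : ℝ) :
    (fun _ => (1 : ℝ)) =O[𝓟 (Ioo 0 t₀)] mu ν ε := by
  refine IsBigO.trans ?_ (mu_isTheta.2.mono (principal_mono.2 Ioo_subset_Ioi_self))
  refine isBigO_principal_of_nonneg_of_le (C := t₀ ^ ν) (fun _ _ => zero_le_one) fun t ht => ?_
  rw [rpow_neg ht.1.le, ← div_eq_mul_inv, one_le_div (rpow_pos_of_pos ht.1 ν)]
  exact rpow_le_rpow ht.1.le ht.2.le hν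

end Scaling

noncomputable section FlatExtension

/-- The wedge `r < κ t`, extended across its edge `r = 0` to the half-space `t > 0`. -/
def extendedWedge (κ : ℝ) : Set (ℝ × ℝ) := {q | 0 < q.1 ∧ q.2 < κ * q.1}

variable {n m : ℕ} {κ : ℝ} {f : ℝ × ℝ → ℝ} {h : ℝ → ℝ}

theorem isOpen_extendedWedge : IsOpen (extendedWedge κ) :=
  (isOpen_lt continuous_const continuous_fst).inter
    (isOpen_lt continuous_snd (continuous_const.mul continuous_fst))

theorem isBigO_norm_sub_pow (hκ : 0 < κ) (hf : f =O[𝓟 (wedge κ)] fun q => q.2 ^ m * h q.1)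
    (hh : ContinuousOn h (Ioi 0)) (h0 : ∀ q : ℝ × ℝ, 0 < q.1 → q.2 ≤ 0 → f q = 0)
    {q : ℝ × ℝ} (ht : 0 < q.1) (hr : q.2 ≤ 0) : f =O[𝓝 q] fun p => ‖p - q‖ ^ m := by
  obtain ⟨C, hC⟩ := isBigO_principal.1 hf
  have hwedge : ∀ᶠ p in 𝓝 q, p ∈ extendedWedge κ :=
    isOpen_extendedWedge.mem_nhds ⟨ht, hr.trans_lt (mul_pos hκ ht)⟩
  have hflat : f =O[𝓝 q] fun p => (p.2 - q.2) ^ m * h p.1 := by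
    refine .of_bound (max C 0) (hwedge.mono fun p hp => ?_)
    rcases le_or_gt p.2 0 with hp0 | hp0
    · rw [h0 p hp.1 hp0, norm_zero]
      positivity
    · refine (hC p ⟨hp0, hp.2⟩).trans ?_
      simp only [norm_mul, norm_pow]
      gcongr
      · exact le_max_left _ _
      · exact abs_le_abs_of_nonneg hp0.le (by linarith)
  have hbdd : (fun p : ℝ × ℝ => h p.1) =O[𝓝 q] fun _ => (1 : ℝ) :=
    ((hh.continuousAt (Ioi_mem_nhds ht)).comp continuousAt_fst).isBigO_one ℝ
  have hsnd : (fun p : ℝ × ℝ => p.2 - q.2) =O[𝓝 q] fun p => ‖p - q‖ :=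
    .of_bound' (.of_forall fun p => by simpa using norm_snd_le (p - q))
  simpa using hflat.trans ((hsnd.pow m).mul hbdd)

theorem continuousAt_of_isBigO_norm_sub_pow {q : ℝ × ℝ} (hm : m ≠ 0) (hq : f q = 0)
    (hf : f =O[𝓝 q] fun p => ‖p - q‖ ^ m) : ContinuousAt f q := by
  rw [ContinuousAt, hq]
  refine hf.trans_tendsto ?_
  have hcont : Continuous fun p : ℝ × ℝ => ‖p - q‖ ^ m := by fun_prop
  simpa [hm] using hcont.tendsto q

theorem fderiv_eq_dt_add_dr (f : ℝ × ℝ → ℝ) (q : ℝ × ℝ) :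
    fderiv ℝ f q = dt f q • ContinuousLinearMap.fst ℝ ℝ ℝ +
      dr f q • ContinuousLinearMap.snd ℝ ℝ ℝ := by
  ext <;> simp [dirDeriv]

theorem contDiffOn_of_flat (hκ : 0 < κ)
    (hf : IsSymbol coneField (wedge κ) (fun q => q.2 ^ m * h q.1) n f) (hm : n < m)
    (hh : ContinuousOn h (Ioi 0)) (h0 : ∀ q : ℝ × ℝ, 0 < q.1 → q.2 ≤ 0 → f q = 0) :
    ContDiffOn ℝ n f (extendedWedge κ) := by
  have hsub : wedge κ ⊆ quadrant := wedge_subset hκ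
  induction n generalizing m f h with
  | zero =>
    refine contDiffOn_zero.2 fun q hq => ContinuousAt.continuousWithinAt ?_
    rcases le_or_gt q.2 0 with hr | hr
    · exact continuousAt_of_isBigO_norm_sub_pow hm.ne' (h0 q hq.1 hr)
        (isBigO_norm_sub_pow hκ hf.isBigO hh h0 hq.1 hr)
    · exact hf.contDiffOn.continuousOn.continuousAt (isOpen_wedge.mem_nhds ⟨hr, hq.2⟩)
  | succ n ih =>
    have hzero (q : ℝ × ℝ) (ht : 0 < q.1) (hr : q.2 ≤ 0) :
        HasFDerivAt f (0 : ℝ × ℝ →L[ℝ] ℝ) q :=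
      (isBigO_norm_sub_pow hκ hf.isBigO hh h0 ht hr).hasFDerivAt (by lia)
    have hdt : ContDiffOn ℝ n (dt f) (extendedWedge κ) := by
      refine ih (m := m) (h := fun t => t⁻¹ * h t)
        ((hf.dt isOpen_wedge hsub).congr_weight fun q _ => by ring) (by lia)
        ((continuousOn_id.inv₀ fun t ht => (mem_Ioi.1 ht).ne').mul hh) fun q ht hr => ?_
      rw [dt, dirDeriv, (hzero q ht hr).fderiv, zero_apply]
    have hdr : ContDiffOn ℝ n (dr f) (extendedWedge κ) := by
      refine ih (m := m - 1) (h := h)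
        ((hf.dr isOpen_wedge hsub).congr_weight fun q hq => ?_) (by lia) hh fun q ht hr => ?_
      · have hr : 0 < q.2 := hq.1
        rw [pow_sub₀ _ hr.ne' (by lia)]
        ring
      · rw [dr, dirDeriv, (hzero q ht hr).fderiv, zero_apply]
    push_cast
    refine (contDiffOn_succ_iff_fderiv_of_isOpen isOpen_extendedWedge).2
      ⟨fun q hq => ?_, by simp, ?_⟩
    · rcases le_or_gt q.2 0 with hr | hr
      · exact (hzero q hq.1 hr).differentiableAt.differentiableWithinAt
      · exact (hf.differentiableAt isOpen_wedge ⟨hr, hq.2⟩).differentiableWithinAt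
    · exact ((hdt.smul contDiffOn_const).add (hdr.smul contDiffOn_const)).congr
        fun q _ => fderiv_eq_dt_add_dr f q

end FlatExtension

/-- A choice of the two profiles from which the first correction is built. -/
structure ProfilePair where
  (F₁ F₂ : ℝ → ℝ)
  (β₁ γ₁ β₂ γ₂ : ℝ)
  isProfile₁ : IsProfile source₁ F₁ β₁ γ₁
  isProfile₂ : IsProfile source₂ F₂ β₂ γ₂

noncomputable section Corrections

variable (D : ProfilePair) (ν ε : ℝ)

/-- The rescaled radius `λ(t) r / √3`, in which the profiles are written. -/
def xi (q : ℝ × ℝ) : ℝ := lam ν ε q.1 * q.2 / √3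

/-- The first correction, which solves `(∂_r² + (2/r) ∂_r + 5 u₀⁴) v = ∂_t² u₀` for the bulk term
`u₀`. -/
def corr₁ (q : ℝ × ℝ) : ℝ := (q.1 ^ 2 * sqrtLam ν ε q.1 ^ 3)⁻¹ *
  (omega₁ ν ε q.1 * D.F₁ (xi ν ε q) + omega₂ ν ε q.1 * D.F₂ (xi ν ε q))

/-- The coefficient of `r` in the leading part of the first correction at `R = ∞`. -/
def leadA (t : ℝ) : ℝ :=
  (t ^ 2 * sqrtLam ν ε t)⁻¹ * ((omega₁ ν ε t * D.β₁ + omega₂ ν ε t * D.β₂) / √3)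

/-- The constant term in the leading part of the first correction at `R = ∞`. -/
def leadB (t : ℝ) : ℝ :=
  (t ^ 2 * sqrtLam ν ε t ^ 3)⁻¹ * (omega₁ ν ε t * D.γ₁ + omega₂ ν ε t * D.γ₂)

/-- The leading part `a(t) r + b(t)` of the first correction at `R = ∞`. -/
def lead (q : ℝ × ℝ) : ℝ := leadA D ν ε q.1 * q.2 + leadB D ν ε q.1

/-- The difference of the first correction and its leading part at `R = ∞`. -/
def corrDiff (q : ℝ × ℝ) : ℝ := corr₁ D ν ε q - lead D ν ε q

/-- The second primitive of `leadA` that vanishes for negative times. -/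
def primA : ℝ → ℝ := prim (prim ((Ioi 0).indicator (leadA D ν ε)))

/-- The primitive of `leadB` that vanishes for negative times. -/
def primB : ℝ → ℝ := prim ((Ioi 0).indicator (leadB D ν ε))

/-- The second correction, which solves
`(∂_t² - ∂_r² - (2/r) ∂_r) v = -∂_t² (a(t) r + b(t))` for the leading part `a(t) r + b(t)` of the
first one: with `A'' = a` and `B' = b` it is the difference of
`(A(t + r) + A(t - r) - 2 A(t) + (B(t + r) - B(t - r)) / 2) / r` and `a(t) r + b(t)`. -/
def corr₂ (q : ℝ × ℝ) : ℝ :=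
  (primA D ν ε (q.1 + q.2) + primA D ν ε (q.1 - q.2) - 2 * primA D ν ε q.1 -
    q.2 ^ 2 * leadA D ν ε q.1 +
    ((primB D ν ε (q.1 + q.2) - primB D ν ε (q.1 - q.2)) / 2 - q.2 * leadB D ν ε q.1)) / q.2

/-- The size `r² (1 + λ r) / (t⁴ λ^{3/2})` of the second correction. -/
def corr₂Weight (q : ℝ × ℝ) : ℝ :=
  q.2 ^ 2 * (1 + sqrtLam ν ε q.1 ^ 2 * q.2) / (q.1 ^ 4 * sqrtLam ν ε q.1 ^ 3)

variable {D ν ε} {n : ℕ} {t : ℝ}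

theorem isSymbol_leadA : IsSymbol eulerField (Ioi 0) (fun t => (t ^ 2 * sqrtLam ν ε t)⁻¹) n
    (leadA D ν ε) := by
  have hO : IsOpen (Ioi (0 : ℝ)) := isOpen_Ioi
  refine (((isSymbol_inv.pow hO 2).mul (isSymbol_sqrtLam_inv (ν := ν) (ε := ε)) hO).mul
    ((((isSymbol_omega₁ (ν := ν) (ε := ε)).const_mul hO D.β₁).add
    ((isSymbol_omega₂ (ν := ν) (ε := ε)).const_mul hO D.β₂) hO).const_mul hO (√3)⁻¹)
    hO).congr_weight (fun _ _ => ?_) |>.congr hO fun _ _ => ?_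
  · simp only [mul_one, mul_inv, inv_pow]
  · simp only [leadA, mul_inv, inv_pow]; ring

theorem isSymbol_leadB : IsSymbol eulerField (Ioi 0) (fun t => (t ^ 2 * sqrtLam ν ε t ^ 3)⁻¹) n
    (leadB D ν ε) := by
  have hO : IsOpen (Ioi (0 : ℝ)) := isOpen_Ioi
  refine (((isSymbol_inv.pow hO 2).mul ((isSymbol_sqrtLam_inv (ν := ν) (ε := ε)).pow hO 3) hO).mul
    (((isSymbol_omega₁ (ν := ν) (ε := ε)).const_mul hO D.γ₁).add
    ((isSymbol_omega₂ (ν := ν) (ε := ε)).const_mul hO D.γ₂) hO) hO).congr_weight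
    (fun _ _ => ?_) |>.congr hO fun _ _ => ?_
  · simp only [mul_one, mul_inv, inv_pow]
  · simp only [leadB, mul_inv, inv_pow]; ring

theorem inv_pow_mul_sqrtLam_pow_isTheta (m k : ℕ) :
    (fun t => (t ^ m * sqrtLam ν ε t ^ k)⁻¹) =Θ[𝓟 (Ioi 0)]
      fun t => t ^ (k * ((1 + ν) / 2) - m) := by
  simp only [mul_inv, ← inv_pow (sqrtLam ν ε _)]
  refine ((isTheta_refl (fun t : ℝ => (t ^ m)⁻¹) _).mul
    (sqrtLam_inv_isTheta.pow k)).trans_eventuallyEq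
    (eventually_principal.2 fun t ht => ?_)
  have ht : 0 < t := ht
  simp only [rpow_sub ht, mul_comm (k : ℝ), rpow_mul_natCast ht.le, rpow_natCast]
  ring

theorem isPowerSymbol_leadA : IsPowerSymbol ((1 + ν) / 2 - 2) (leadA D ν ε) := fun _ =>
  isSymbol_leadA.trans_isBigO <| by
    simpa using (inv_pow_mul_sqrtLam_pow_isTheta (ν := ν) (ε := ε) 2 1).1

theorem isPowerSymbol_leadB : IsPowerSymbol (3 * ((1 + ν) / 2) - 2) (leadB D ν ε) := fun _ =>
  isSymbol_leadB.trans_isBigO <| by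
    simpa using (inv_pow_mul_sqrtLam_pow_isTheta (ν := ν) (ε := ε) 2 3).1

theorem isExtendedPowerSymbol_prim_leadA (hν : 3 < ν) :
    IsExtendedPowerSymbol ((1 + ν) / 2 - 1) (prim ((Ioi 0).indicator (leadA D ν ε))) := by
  convert (IsExtendedPowerSymbol.indicator
    (isPowerSymbol_leadA (D := D) (ν := ν) (ε := ε))).prim (by linarith) using 1
  ring

theorem isExtendedPowerSymbol_primA (hν : 3 < ν) :
    IsExtendedPowerSymbol ((1 + ν) / 2) (primA D ν ε) := by
  unfold primA
  convert (isExtendedPowerSymbol_prim_leadA (D := D) (ε := ε) hν).prim (by linarith) using 1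
  ring

theorem isExtendedPowerSymbol_primB (hν : 3 < ν) :
    IsExtendedPowerSymbol (3 * ((1 + ν) / 2) - 1) (primB D ν ε) := by
  unfold primB
  convert (IsExtendedPowerSymbol.indicator
    (isPowerSymbol_leadB (D := D) (ν := ν) (ε := ε))).prim (by linarith) using 1
  ring

theorem contDiff_primA (hν : 3 < ν) : ContDiff ℝ (2 : ℕ) (primA D ν ε) :=
  (isExtendedPowerSymbol_primA hν).contDiff (by push_cast; linarith)

theorem contDiff_primB (hν : 3 < ν) : ContDiff ℝ (2 : ℕ) (primB D ν ε) :=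
  (isExtendedPowerSymbol_primB hν).contDiff (by push_cast; linarith)

theorem deriv_deriv_primA (hν : 3 < ν) (ht : 0 < t) :
    deriv (deriv (primA D ν ε)) t = leadA D ν ε t := by
  have hderiv : deriv (primA D ν ε) = prim ((Ioi 0).indicator (leadA D ν ε)) :=
    funext fun x => ((isExtendedPowerSymbol_prim_leadA hν).hasDerivAt_prim (by linarith) x).deriv
  rw [hderiv, ((IsExtendedPowerSymbol.indicator isPowerSymbol_leadA).hasDerivAt_prim
    (by linarith) t).deriv, indicator_of_mem (mem_Ioi.2 ht)]

theorem deriv_primB (hν : 3 < ν) (ht : 0 < t) : deriv (primB D ν ε) t = leadB D ν ε t := by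
  rw [primB, ((IsExtendedPowerSymbol.indicator isPowerSymbol_leadB).hasDerivAt_prim
    (by linarith) t).deriv, indicator_of_mem (mem_Ioi.2 ht)]

theorem taylorRem_primA (hν : 3 < ν) {q : ℝ × ℝ} (hq : 0 < q.1) :
    taylorRem (primA D ν ε) 1 4 q + taylorRem (primA D ν ε) (-1) 4 q =
      primA D ν ε (q.1 + q.2) + primA D ν ε (q.1 - q.2) - 2 * primA D ν ε q.1 -
        q.2 ^ 2 * leadA D ν ε q.1 := by
  rw [← deriv_deriv_primA hν hq]
  simp only [taylorRem, Finset.sum_range_succ, Finset.range_zero, Finset.sum_empty,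
    iteratedDeriv_succ, iteratedDeriv_zero]
  norm_num [Nat.factorial]
  ring_nf

theorem taylorRem_primB (hν : 3 < ν) {q : ℝ × ℝ} (hq : 0 < q.1) :
    taylorRem (primB D ν ε) 1 3 q - taylorRem (primB D ν ε) (-1) 3 q =
      2 * ((primB D ν ε (q.1 + q.2) - primB D ν ε (q.1 - q.2)) / 2 - q.2 * leadB D ν ε q.1) := by
  rw [← deriv_primB hν hq]
  simp only [taylorRem, Finset.sum_range_succ, Finset.range_zero, Finset.sum_empty,
    iteratedDeriv_succ, iteratedDeriv_zero]
  norm_num [Nat.factorial]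
  ring_nf

theorem corr₂_eq_taylorRem (hν : 3 < ν) {q : ℝ × ℝ} (hq : 0 < q.1) : corr₂ D ν ε q =
    q.2⁻¹ * (taylorRem (primA D ν ε) 1 4 q + taylorRem (primA D ν ε) (-1) 4 q) +
      q.2⁻¹ * (1 / 2 * (taylorRem (primB D ν ε) 1 3 q - taylorRem (primB D ν ε) (-1) 3 q)) := by
  rw [taylorRem_primA hν hq, taylorRem_primB hν hq, corr₂]
  ring

theorem isBigO_weight_primA : (fun q : ℝ × ℝ => q.2⁻¹ * (q.2 ^ 4 * q.1 ^ ((1 + ν) / 2 - (4 : ℕ))))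
    =O[𝓟 quadrant] corr₂Weight ν ε := by
  have hpow : (fun q : ℝ × ℝ => q.1 ^ ((1 + ν) / 2 - (4 : ℕ))) =O[𝓟 quadrant]
      fun q => (q.1 ^ 4 * sqrtLam ν ε q.1)⁻¹ := by
    simpa [Function.comp_def] using
      (inv_pow_mul_sqrtLam_pow_isTheta (ν := ν) (ε := ε) 4 1).2.comp_tendsto
      (tendsto_principal_principal.2 fun q (hq : q ∈ quadrant) => hq.1)
  refine ((isBigO_refl (fun q : ℝ × ℝ => q.2⁻¹) _).mul ((isBigO_refl _ _).mul hpow)).trans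
    (isBigO_principal_of_nonneg_of_le (C := 1) (fun q hq => ?_) fun q hq => ?_)
  all_goals
    have ht : 0 < q.1 := hq.1
    have hr : 0 < q.2 := hq.2
    have hs : 0 < sqrtLam ν ε q.1 := sqrtLam_pos ht
  · positivity
  · unfold corr₂Weight
    field_simp
    linarith

theorem isBigO_weight_primB :
    (fun q : ℝ × ℝ => q.2⁻¹ * (q.2 ^ 3 * q.1 ^ (3 * ((1 + ν) / 2) - 1 - (3 : ℕ))))
      =O[𝓟 quadrant] corr₂Weight ν ε := by
  have hpow : (fun q : ℝ × ℝ => q.1 ^ (3 * ((1 + ν) / 2) - 1 - (3 : ℕ))) =O[𝓟 quadrant]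
      fun q => (q.1 ^ 4 * sqrtLam ν ε q.1 ^ 3)⁻¹ := by
    rw [show 3 * ((1 + ν) / 2) - 1 - ((3 : ℕ) : ℝ) = (3 : ℕ) * ((1 + ν) / 2) - (4 : ℕ) by
      push_cast; ring]
    exact (inv_pow_mul_sqrtLam_pow_isTheta (ν := ν) (ε := ε) 4 3).2.comp_tendsto
      (tendsto_principal_principal.2 fun q (hq : q ∈ quadrant) => hq.1)
  refine ((isBigO_refl (fun q : ℝ × ℝ => q.2⁻¹) _).mul ((isBigO_refl _ _).mul hpow)).trans
    (isBigO_principal_of_nonneg_of_le (C := 1) (fun q hq => ?_) fun q hq => ?_)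
  all_goals
    have ht : 0 < q.1 := hq.1
    have hr : 0 < q.2 := hq.2
    have hs : 0 < sqrtLam ν ε q.1 := sqrtLam_pos ht
  · positivity
  · unfold corr₂Weight
    field_simp
    nlinarith [mul_pos (pow_pos hs 2) hr]

theorem isSymbol_corr₂_of_taylorRem (hν : 3 < ν) {S : Set (ℝ × ℝ)} (hO : IsOpen S)
    (hS : S ⊆ quadrant)
    (hA : ∀ c, |c| ≤ 1 → IsSymbol coneField S
      (fun q => q.2 ^ 4 * q.1 ^ ((1 + ν) / 2 - (4 : ℕ))) n (taylorRem (primA D ν ε) c 4))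
    (hB : ∀ c, |c| ≤ 1 → IsSymbol coneField S
      (fun q => q.2 ^ 3 * q.1 ^ (3 * ((1 + ν) / 2) - 1 - (3 : ℕ))) n
        (taylorRem (primB D ν ε) c 3)) :
    IsSymbol coneField S (corr₂Weight ν ε) n (corr₂ D ν ε) := by
  have hr := (isSymbol_comp_snd (isSymbol_inv (n := n))).mono hS
  have hone : |(1 : ℝ)| ≤ 1 := by simp
  have hneg : |(-1 : ℝ)| ≤ 1 := by simp
  have hSO := principal_mono.2 hS
  exact (((hr.mul ((hA 1 hone).add (hA (-1) hneg) hO) hO).trans_isBigO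
    (isBigO_weight_primA.mono hSO)).add ((hr.mul (((hB 1 hone).sub (hB (-1) hneg) hO).const_mul hO
    (1 / 2)) hO).trans_isBigO (isBigO_weight_primB.mono hSO)) hO).congr hO
    fun q hq => corr₂_eq_taylorRem hν (hS hq).1

theorem isSymbol_corr₂_wedge_half (hν : 3 < ν) :
    IsSymbol coneField (wedge (1 / 2)) (corr₂Weight ν ε) n (corr₂ D ν ε) :=
  isSymbol_corr₂_of_taylorRem hν isOpen_wedge (wedge_subset one_half_pos)
    (fun _ hc => isSymbol_taylorRem_wedge_half (isExtendedPowerSymbol_primA hν).isPowerSymbol hc 4)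
    fun _ hc => isSymbol_taylorRem_wedge_half (isExtendedPowerSymbol_primB hν).isPowerSymbol hc 3

theorem isSymbol_corr₂_wedge_three (hν : 3 < ν) :
    IsSymbol coneField (wedge 3) (corr₂Weight ν ε) 2 (corr₂ D ν ε) :=
  isSymbol_corr₂_of_taylorRem hν isOpen_wedge (wedge_subset three_pos)
    (fun _ hc => (isExtendedPowerSymbol_primA hν).isSymbol_taylorRem_wedge_three
      (by push_cast; linarith) hc 4)
    fun _ hc => (isExtendedPowerSymbol_primB hν).isSymbol_taylorRem_wedge_three
      (by push_cast; linarith) hc 3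

theorem isSymbol_comp_xi {m h : ℝ → ℝ} (hh : IsSymbol eulerField (Ioi 0) m n h) :
    IsSymbol coneField quadrant (fun q => m (xi ν ε q)) n (fun q => h (xi ν ε q)) := by
  have hxi : ContDiffOn ℝ n (xi ν ε) quadrant :=
    ((isSymbol_lam.contDiffOn.comp contDiffOn_fst fun q hq => hq.1).mul contDiffOn_snd).div_const _
  refine hh.comp (c := fun i q => if i then 1 else logDerivLam ν ε q.1) isOpen_Ioi isOpen_quadrant
    hxi (fun q hq => ?_) (fun i => ?_) fun i q hq => ?_
  · exact div_pos (mul_pos (lam_pos hq.1) hq.2) (by positivity)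
  · cases i
    · simpa using isSymbol_comp_fst isSymbol_logDerivLam
    · simpa using IsSymbol.const 1
  · have ht : 0 < q.1 := hq.1
    have hd : DifferentiableAt ℝ (xi ν ε) (q.1, q.2) := by
      have hlam : DifferentiableAt ℝ (fun q : ℝ × ℝ => lam ν ε q.1) (q.1, q.2) :=
        (hasDerivAt_lam ht).differentiableAt.comp (f := Prod.fst) (q.1, q.2) differentiableAt_fst
      unfold xi
      fun_prop
    cases i
    · rw [fieldDeriv_false, (hasDerivAt_fst hd).unique
        (((hasDerivAt_lam ht).mul_const q.2).div_const (√3))]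
      simp only [xi, Bool.false_eq_true, if_false]
      field_simp
    · rw [fieldDeriv_true, (hasDerivAt_snd hd).unique
        (((hasDerivAt_id q.2).const_mul (lam ν ε q.1)).div_const (√3))]
      simp only [xi, if_true]
      ring

end Corrections

noncomputable section WaveOperator

theorem deriv_deriv_eq {f f' : ℝ → ℝ} {b x : ℝ} (hf : ∀ᶠ y in 𝓝 x, HasDerivAt f (f' y) y)
    (hf' : HasDerivAt f' b x) : deriv (deriv f) x = b :=
  (EventuallyEq.deriv_eq (hf.mono fun _ hy => hy.deriv)).trans hf'.deriv

section RadialLap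

variable {f g : ℝ → ℝ} {r : ℝ}

theorem radialLap_add (hf : ContDiff ℝ 2 f) (hg : ContDiff ℝ 2 g) :
    radialLap (fun ρ => f ρ + g ρ) r = radialLap f r + radialLap g r := by
  have hderiv : deriv (fun ρ => f ρ + g ρ) = fun ρ => deriv f ρ + deriv g ρ := funext fun ρ =>
    deriv_fun_add (hf.differentiable two_ne_zero ρ) (hg.differentiable two_ne_zero ρ)
  rw [radialLap, hderiv, deriv_fun_add ((hf.differentiable_deriv_two) r)
    ((hg.differentiable_deriv_two) r), radialLap, radialLap]
  ring

theorem radialLap_const_mul (c : ℝ) : radialLap (fun ρ => c * f ρ) r = c * radialLap f r := by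
  simp only [radialLap, deriv_const_mul_field']
  ring

theorem radialLap_comp_mul {k : ℝ} (hk : k ≠ 0) :
    radialLap (fun ρ => f (k * ρ)) r = k ^ 2 * radialLap f (k * r) := by
  have hderiv (h : ℝ → ℝ) : deriv (fun ρ => h (k * ρ)) = fun ρ => k * deriv h (k * ρ) :=
    funext fun ρ => by simpa using deriv_comp_mul_left k h ρ
  simp only [radialLap, hderiv, deriv_const_mul_field']
  field_simp

theorem radialLap_affine (a b : ℝ) : radialLap (fun ρ => a * ρ + b) r = 2 * a / r := by
  have hderiv : deriv (fun ρ => a * ρ + b) = fun _ => a := funext fun ρ => by simp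
  rw [radialLap, hderiv, deriv_const]
  ring

theorem radialLap_div_id (hf : ContDiff ℝ 2 f) (hr : r ≠ 0) :
    radialLap (fun ρ => f ρ / ρ) r = deriv (deriv f) r / r := by
  have hderiv (y : ℝ) : HasDerivAt f (deriv f y) y :=
    (hf.differentiable two_ne_zero y).hasDerivAt
  have hderiv' : HasDerivAt (deriv f) (deriv (deriv f) r) r :=
    (hf.differentiable_deriv_two r).hasDerivAt
  have hquot : ∀ᶠ y in 𝓝 r, HasDerivAt (fun ρ => f ρ / ρ) (deriv f y / y - f y / y ^ 2) y := by
    filter_upwards [isOpen_ne.mem_nhds hr] with y hy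
    refine ((hderiv y).div (hasDerivAt_id y) hy).congr_deriv ?_
    simp only [id_eq]
    field_simp
  have hquot' : HasDerivAt (fun y => deriv f y / y - f y / y ^ 2)
      (deriv (deriv f) r / r - 2 * deriv f r / r ^ 2 + 2 * f r / r ^ 3) r := by
    refine ((hderiv'.div (hasDerivAt_id r) hr).sub
      ((hderiv r).div (hasDerivAt_pow 2 r) (pow_ne_zero 2 hr))).congr_deriv ?_
    simp only [id_eq]
    field_simp
    ring
  rw [radialLap, deriv_deriv_eq hquot hquot', hquot.self_of_nhds.deriv]
  field_simp
  ring

theorem radialLap_ground (hr : r ≠ 0) : radialLap ground r = -3 * ground r ^ 5 := by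
  have hderiv : HasDerivAt (fun x => -x * ground x ^ 3)
      (-1 * ground r ^ 3 + -r * (3 * ground r ^ 2 * (-r * ground r ^ 3))) r :=
    ((hasDerivAt_id r).neg.mul ((hasDerivAt_ground r).pow 3)).congr_deriv (by simp)
  rw [radialLap, deriv_deriv_eq (.of_forall hasDerivAt_ground) hderiv, (hasDerivAt_ground r).deriv]
  field_simp
  linear_combination (3 * ground r ^ 3) * ground_sq r

end RadialLap

/-- The radial wave operator `u_tt - u_rr - (2/r) u_r`. -/
def waveOp (u : ℝ → ℝ → ℝ) (t r : ℝ) : ℝ :=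
  pderiv 2 0 u t r - pderiv 0 2 u t r - 2 / r * pderiv 0 1 u t r

theorem waveOp_eq (u : ℝ → ℝ → ℝ) (t r : ℝ) :
    waveOp u t r = pderiv 2 0 u t r - radialLap (u t) r := by
  simp only [waveOp, pderiv, radialLap, iteratedDeriv_zero, iteratedDeriv_succ]
  ring

section Generic

variable {S : Set (ℝ × ℝ)} {t r : ℝ}

theorem waveOp_congr {u v : ℝ → ℝ → ℝ} (hS : IsOpen S) (huv : ∀ t r, (t, r) ∈ S → u t r = v t r)
    (h : (t, r) ∈ S) : waveOp u t r = waveOp v t r := by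
  simp only [waveOp, pderiv_congr hS huv h]

theorem waveOp_add {f g : ℝ × ℝ → ℝ} (hS : IsOpen S) (hf : ContDiffOn ℝ 2 f S)
    (hg : ContDiffOn ℝ 2 g S) (h : (t, r) ∈ S) : waveOp (fun s ρ => f (s, ρ) + g (s, ρ)) t r =
      waveOp (fun s ρ => f (s, ρ)) t r + waveOp (fun s ρ => g (s, ρ)) t r := by
  have hone : ((0 + 1 : ℕ) : WithTop ℕ∞) ≤ 2 := by norm_num
  rw [waveOp, pderiv_add (k := 2) (j := 0) hS hf hg h, pderiv_add (k := 0) (j := 2) hS hf hg h,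
    pderiv_add (k := 0) (j := 1) hS (hf.of_le hone) (hg.of_le hone) h, waveOp, waveOp]
  ring

/-- Up to the term `2 A(t)`, a solution of the wave equation on the line; it vanishes at
`r = 0`. -/
def dAlembert (A B : ℝ → ℝ) (t r : ℝ) : ℝ :=
  A (t + r) + A (t - r) - 2 * A t + (B (t + r) - B (t - r)) / 2

variable {A B : ℝ → ℝ}

theorem contDiff_dAlembert (hA : ContDiff ℝ 2 A) (hB : ContDiff ℝ 2 B) :
    ContDiff ℝ 2 (fun q : ℝ × ℝ => dAlembert A B q.1 q.2) := by
  unfold dAlembert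
  fun_prop

theorem deriv_deriv_dAlembert_fst (hA : ContDiff ℝ 2 A) (hB : ContDiff ℝ 2 B) :
    deriv (deriv fun s => dAlembert A B s r) t =
      deriv (deriv (dAlembert A B t)) r - 2 * deriv (deriv A) t := by
  have hA₁ := hA.differentiable two_ne_zero
  have hB₁ := hB.differentiable two_ne_zero
  have hfst : deriv (fun s => dAlembert A B s r) = fun s => deriv A (s + r) + deriv A (s - r) -
      2 * deriv A s + (deriv B (s + r) - deriv B (s - r)) / 2 := funext fun s => by
    unfold dAlembert
    simp (disch := fun_prop) only [deriv_fun_add, deriv_fun_sub, deriv_div_const,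
      deriv_const_mul_field', deriv_comp_add_const, deriv_comp_sub_const]
  have hsnd : deriv (dAlembert A B t) = fun ρ => deriv A (t + ρ) - deriv A (t - ρ) +
      (deriv B (t + ρ) + deriv B (t - ρ)) / 2 := funext fun ρ => by
    unfold dAlembert
    simp (disch := fun_prop) only [deriv_fun_add, deriv_fun_sub, deriv_div_const, deriv_const,
      deriv_comp_const_add, deriv_comp_const_sub]
    ring
  rw [hfst, hsnd]
  simp (disch := fun_prop) only [deriv_fun_add, deriv_fun_sub, deriv_div_const,
    deriv_const_mul_field', deriv_comp_add_const, deriv_comp_sub_const, deriv_comp_const_add,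
    deriv_comp_const_sub]
  ring

theorem waveOp_dAlembert_div (hA : ContDiff ℝ 2 A) (hB : ContDiff ℝ 2 B) (hr : r ≠ 0) :
    waveOp (fun s ρ => dAlembert A B s ρ / ρ) t r = -(2 * deriv (deriv A) t / r) := by
  have hsnd : ContDiff ℝ 2 (dAlembert A B t) :=
    (contDiff_dAlembert hA hB).comp (contDiff_const.prodMk contDiff_id)
  have hdiv (f : ℝ → ℝ) : deriv (fun s => f s / r) = fun s => deriv f s / r :=
    funext fun _ => deriv_div_const _
  rw [waveOp_eq, radialLap_div_id hsnd hr]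
  simp only [pderiv, iteratedDeriv_zero, iteratedDeriv_succ, hdiv,
    deriv_deriv_dAlembert_fst hA hB]
  ring

end Generic

end WaveOperator

noncomputable section Approximation

/-- The total correction `v₁ + v₂` to the bulk term `u₀`. -/
def corr (D : ProfilePair) (ν ε : ℝ) (q : ℝ × ℝ) : ℝ := corr₁ D ν ε q + corr₂ D ν ε q

/-- The approximate solution `u₀ + v₁ + v₂`. -/
def approx (D : ProfilePair) (ν ε : ℝ) (q : ℝ × ℝ) : ℝ := bulk ν ε q.1 q.2 + corr D ν ε q

variable {D : ProfilePair} {ν ε : ℝ} {n : ℕ} {q : ℝ × ℝ} {t r : ℝ}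

theorem bulk_eq (q : ℝ × ℝ) : bulk ν ε q.1 q.2 = sqrtLam ν ε q.1 * ground (xi ν ε q) := by
  rw [bulk, W_eq_ground]
  rfl

theorem xi_pos (hq : q ∈ quadrant) : 0 < xi ν ε q :=
  div_pos (mul_pos (lam_pos hq.1) hq.2) (by positivity)

theorem isSymbol_bulk : IsSymbol coneField quadrant
    (fun q => sqrtLam ν ε q.1 * (1 + xi ν ε q)⁻¹) n (fun q => bulk ν ε q.1 q.2) :=
  ((isSymbol_comp_fst isSymbol_sqrtLam).mul (isSymbol_comp_xi isSymbol_ground)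
    isOpen_quadrant).congr isOpen_quadrant fun q _ => bulk_eq q

theorem isSymbol_omega_comp_xi {w G₁ G₂ : ℝ → ℝ} (h₁ : IsSymbol eulerField (Ioi 0) w n G₁)
    (h₂ : IsSymbol eulerField (Ioi 0) w n G₂) :
    IsSymbol coneField quadrant (fun q => (q.1 ^ 2 * sqrtLam ν ε q.1 ^ 3)⁻¹ * w (xi ν ε q)) n
      (fun q => (q.1 ^ 2 * sqrtLam ν ε q.1 ^ 3)⁻¹ *
        (omega₁ ν ε q.1 * G₁ (xi ν ε q) + omega₂ ν ε q.1 * G₂ (xi ν ε q))) := by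
  have hO := isOpen_quadrant
  have hfactor := (isSymbol_comp_fst ((isSymbol_inv (n := n)).pow isOpen_Ioi 2)).mul
    (isSymbol_comp_fst ((isSymbol_sqrtLam_inv (ν := ν) (ε := ε)).pow isOpen_Ioi 3)) hO
  have hsum := ((isSymbol_comp_fst (isSymbol_omega₁ (ν := ν) (ε := ε))).mul
    (isSymbol_comp_xi (ν := ν) (ε := ε) h₁) hO).add
      ((isSymbol_comp_fst (isSymbol_omega₂ (ν := ν) (ε := ε))).mul
        (isSymbol_comp_xi (ν := ν) (ε := ε) h₂) hO) hO
  refine (hfactor.mul hsum hO).congr_weight (fun _ _ => ?_) |>.congr hO fun _ _ => ?_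
  all_goals simp only [mul_inv, inv_pow, one_mul]

theorem isSymbol_corr₁ : IsSymbol coneField quadrant
    (fun q => (q.1 ^ 2 * sqrtLam ν ε q.1 ^ 3)⁻¹ * xi ν ε q) n (corr₁ D ν ε) :=
  isSymbol_omega_comp_xi (D.isProfile₁.isSymbol n) (D.isProfile₂.isSymbol n)

theorem isSymbol_corrDiff : IsSymbol coneField quadrant
    (fun q => (q.1 ^ 2 * sqrtLam ν ε q.1 ^ 3)⁻¹ * logWeight (xi ν ε q)) n (corrDiff D ν ε) := by
  refine (isSymbol_omega_comp_xi (D.isProfile₁.isSymbol_sub n)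
    (D.isProfile₂.isSymbol_sub n)).congr isOpen_quadrant fun q hq => ?_
  have ht : 0 < q.1 := hq.1
  have hs : 0 < sqrtLam ν ε q.1 := sqrtLam_pos ht
  simp only [corrDiff, lead, corr₁, leadA, leadB, xi, ← sqrtLam_sq ht]
  field_simp
  ring

theorem contDiffOn_lead : ContDiffOn ℝ n (lead D ν ε) quadrant :=
  ((isSymbol_leadA.contDiffOn.comp contDiffOn_fst fun _ hq => hq.1).mul contDiffOn_snd).add
    (isSymbol_leadB.contDiffOn.comp contDiffOn_fst fun _ hq => hq.1)

theorem corr₂_add_lead (hr : q.2 ≠ 0) : corr₂ D ν ε q + lead D ν ε q =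
    dAlembert (primA D ν ε) (primB D ν ε) q.1 q.2 / q.2 := by
  rw [corr₂, lead, dAlembert]
  field_simp
  ring

theorem contDiffOn_corr₂ (hν : 3 < ν) : ContDiffOn ℝ 2 (corr₂ D ν ε) quadrant := by
  have hdAlembert : ContDiffOn ℝ 2 (fun q : ℝ × ℝ =>
      dAlembert (primA D ν ε) (primB D ν ε) q.1 q.2 / q.2) quadrant :=
    (contDiff_dAlembert (contDiff_primA hν) (contDiff_primB hν)).contDiffOn.div contDiffOn_snd
      fun _ hq => ne_of_gt hq.2
  exact (hdAlembert.sub (contDiffOn_lead (n := 2))).congr fun _ hq =>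
    eq_sub_of_add_eq (corr₂_add_lead (ne_of_gt hq.2))

theorem hasDerivAt_xi (ht : 0 < t) :
    HasDerivAt (fun s => xi ν ε (s, r)) (logDerivLam ν ε t / t * xi ν ε (t, r)) t := by
  refine (((hasDerivAt_lam ht).mul_const r).div_const (√3)).congr_deriv ?_
  simp only [xi]
  ring

theorem hasDerivAt_sqrtLam_mul_comp_xi {f : ℝ → ℝ} {f' : ℝ} (ht : 0 < t)
    (hf : HasDerivAt f f' (xi ν ε (t, r))) :
    HasDerivAt (fun s => sqrtLam ν ε s * f (xi ν ε (s, r)))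
      (logDerivLam ν ε t / t *
        (sqrtLam ν ε t * (1 / 2 * f (xi ν ε (t, r)) + xi ν ε (t, r) * f'))) t := by
  refine ((hasDerivAt_sqrtLam ht).mul (hf.comp t (hasDerivAt_xi ht))).congr_deriv ?_
  simp only [Function.comp]
  field_simp

theorem hasDerivAt_source₁ (x : ℝ) :
    HasDerivAt source₁ (-x * ground x ^ 3 - 3 / 2 * (1 - x ^ 2) * (x * ground x ^ 5)) x := by
  refine ((((hasDerivAt_pow 2 x).const_sub 1).const_mul (1 / 2)).mul
    ((hasDerivAt_ground x).pow 3)).congr_deriv ?_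
  simp only [Pi.pow_apply]
  push_cast
  ring

theorem pderiv_two_zero_bulk (ht : 0 < t) :
    pderiv 2 0 (bulk ν ε) t r = sqrtLam ν ε t / t ^ 2 *
      (omega₁ ν ε t * source₁ (xi ν ε (t, r)) + omega₂ ν ε t * source₂ (xi ν ε (t, r))) := by
  have hderiv (s : ℝ) (hs : 0 < s) : HasDerivAt (fun s => bulk ν ε s r)
      (logDerivLam ν ε s / s * (sqrtLam ν ε s * source₁ (xi ν ε (s, r)))) s := by
    refine ((hasDerivAt_sqrtLam_mul_comp_xi hs
      (hasDerivAt_ground (xi ν ε (s, r)))).congr_of_eventuallyEq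
        (.of_forall fun s => bulk_eq (s, r))).congr_deriv ?_
    rw [source₁]
    linear_combination (-logDerivLam ν ε s / s * sqrtLam ν ε s * ground (xi ν ε (s, r)) / 2) *
      ground_sq (xi ν ε (s, r))
  have hlogDeriv : HasDerivAt (fun s => logDerivLam ν ε s / s) (omega₁ ν ε t / t ^ 2) t := by
    refine ((hasDerivAt_logDerivLam ht).div (hasDerivAt_id t) ht.ne').congr_deriv ?_
    simp only [omega₁, id_eq]
    field_simp
  simp only [pderiv, iteratedDeriv_zero, iteratedDeriv_succ]
  rw [deriv_deriv_eq (eventually_of_mem (Ioi_mem_nhds ht) hderiv)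
    (hlogDeriv.mul (hasDerivAt_sqrtLam_mul_comp_xi ht (hasDerivAt_source₁ _)))]
  simp only [omega₂, source₂, source₁]
  field_simp
  linear_combination (-4 * sqrtLam ν ε t * logDerivLam ν ε t ^ 2 * ground (xi ν ε (t, r)) ^ 3 *
    (1 - 5 * xi ν ε (t, r) ^ 2)) * ground_sq (xi ν ε (t, r))

theorem radialLap_comp_xi (ht : 0 < t) (f : ℝ → ℝ) :
    radialLap (fun ρ => f (xi ν ε (t, ρ))) r =
      sqrtLam ν ε t ^ 4 / 3 * radialLap f (xi ν ε (t, r)) := by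
  have hk : lam ν ε t / √3 ≠ 0 := (div_pos (lam_pos ht) (by positivity)).ne'
  have hk_sq : (lam ν ε t / √3) ^ 2 = sqrtLam ν ε t ^ 4 / 3 := by
    rw [div_pow, sq_sqrt (by norm_num), ← sqrtLam_sq ht]
    ring
  have hxi (ρ : ℝ) : xi ν ε (t, ρ) = lam ν ε t / √3 * ρ := by
    rw [xi]
    ring
  simp only [hxi, radialLap_comp_mul hk, hk_sq]

theorem radialLap_bulk (h : (t, r) ∈ quadrant) :
    radialLap (bulk ν ε t) r = -bulk ν ε t r ^ 5 := by
  have hfun : bulk ν ε t = fun ρ => sqrtLam ν ε t * ground (xi ν ε (t, ρ)) :=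
    funext fun ρ => bulk_eq (t, ρ)
  rw [hfun, radialLap_const_mul, radialLap_comp_xi h.1, radialLap_ground (xi_pos h).ne']
  ring

theorem radialLap_corr₁ (h : (t, r) ∈ quadrant) :
    radialLap (fun ρ => corr₁ D ν ε (t, ρ)) r =
      pderiv 2 0 (bulk ν ε) t r - 5 * bulk ν ε t r ^ 4 * corr₁ D ν ε (t, r) := by
  have hs : 0 < sqrtLam ν ε t := sqrtLam_pos h.1
  have ht : 0 < t := h.1
  have hcomp {F : ℝ → ℝ} (hF : ContDiff ℝ ∞ F) (c : ℝ) :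
      ContDiff ℝ 2 fun ρ => c * F (xi ν ε (t, ρ)) := by
    have hF₂ : ContDiff ℝ 2 F := contDiff_infty.1 hF 2
    simp only [xi]
    fun_prop
  have hode {s F : ℝ → ℝ} {β γ : ℝ} (hF : IsProfile s F β γ) :=
    eq_sub_of_add_eq (hF.linearizedOp_eq _ (xi_pos (ν := ν) (ε := ε) h))
  simp only [corr₁]
  rw [radialLap_const_mul, radialLap_add (hcomp D.isProfile₁.contDiff _)
    (hcomp D.isProfile₂.contDiff _), radialLap_const_mul, radialLap_const_mul,
    radialLap_comp_xi ht, radialLap_comp_xi ht, hode D.isProfile₁, hode D.isProfile₂,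
    pderiv_two_zero_bulk ht, bulk_eq (t, r)]
  field_simp
  ring

theorem waveOp_lead : waveOp (fun s ρ => lead D ν ε (s, ρ)) t r =
    pderiv 2 0 (fun s ρ => lead D ν ε (s, ρ)) t r - 2 * leadA D ν ε t / r := by
  rw [waveOp_eq]
  simp only [lead, radialLap_affine]

theorem waveOp_corr₂ (hν : 3 < ν) (h : (t, r) ∈ quadrant) :
    waveOp (fun s ρ => corr₂ D ν ε (s, ρ)) t r =
      -pderiv 2 0 (fun s ρ => lead D ν ε (s, ρ)) t r := by
  have hadd := waveOp_add isOpen_quadrant (contDiffOn_corr₂ (D := D) (ε := ε) hν)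
    (contDiffOn_lead (D := D) (ν := ν) (ε := ε) (n := 2)) h
  rw [waveOp_congr isOpen_quadrant (fun s ρ hsρ => corr₂_add_lead (ne_of_gt hsρ.2)) h,
    waveOp_dAlembert_div (contDiff_primA hν) (contDiff_primB hν) (ne_of_gt h.2),
    deriv_deriv_primA hν h.1, waveOp_lead] at hadd
  linarith

theorem waveOp_corr₁ (h : (t, r) ∈ quadrant) : waveOp (fun s ρ => corr₁ D ν ε (s, ρ)) t r =
    dt (dt (corrDiff D ν ε)) (t, r) + pderiv 2 0 (fun s ρ => lead D ν ε (s, ρ)) t r -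
      (pderiv 2 0 (bulk ν ε) t r - 5 * bulk ν ε t r ^ 4 * corr₁ D ν ε (t, r)) := by
  have hdiff : ContDiffOn ℝ (2 + 0 : ℕ) (corrDiff D ν ε) quadrant := isSymbol_corrDiff.contDiffOn
  have hadd := pderiv_add isOpen_quadrant hdiff (contDiffOn_lead (D := D) (ν := ν) (ε := ε)) h
  rw [pderiv_eq_iterate isOpen_quadrant hdiff h] at hadd
  simp only [corrDiff, sub_add_cancel] at hadd
  rw [waveOp_eq, radialLap_corr₁ h, hadd]
  rfl

theorem quinticOp_approx (hν : 3 < ν) (h : (t, r) ∈ quadrant) :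
    quinticOp (fun s ρ => approx D ν ε (s, ρ)) t r =
      dt (dt (corrDiff D ν ε)) (t, r) - 5 * bulk ν ε t r ^ 4 * corr₂ D ν ε (t, r) -
      corr D ν ε (t, r) ^ 2 * (10 * bulk ν ε t r ^ 3 +
        10 * (bulk ν ε t r ^ 2 * corr D ν ε (t, r)) +
        5 * (bulk ν ε t r * corr D ν ε (t, r) ^ 2) + corr D ν ε (t, r) ^ 3) := by
  have hO := isOpen_quadrant
  have hbulk : ContDiffOn ℝ 2 (fun q : ℝ × ℝ => bulk ν ε q.1 q.2) quadrant :=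
    (isSymbol_bulk (n := 2)).contDiffOn
  have hcorr₁ : ContDiffOn ℝ 2 (corr₁ D ν ε) quadrant := (isSymbol_corr₁ (n := 2)).contDiffOn
  have hcorr₂ : ContDiffOn ℝ 2 (corr₂ D ν ε) quadrant := contDiffOn_corr₂ hν
  have hwave : waveOp (fun s ρ => approx D ν ε (s, ρ)) t r = bulk ν ε t r ^ 5 +
      5 * bulk ν ε t r ^ 4 * corr₁ D ν ε (t, r) + dt (dt (corrDiff D ν ε)) (t, r) := by
    simp only [approx, corr]
    rw [waveOp_add hO hbulk (hcorr₁.add hcorr₂) h, waveOp_add hO hcorr₁ hcorr₂ h, waveOp_corr₁ h,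
      waveOp_corr₂ hν h, waveOp_eq, radialLap_bulk h]
    ring
  change waveOp (fun s ρ => approx D ν ε (s, ρ)) t r - approx D ν ε (t, r) ^ 5 = _
  rw [hwave, approx, corr]
  ring

end Approximation

noncomputable section Estimates

/-- The weight `√λ μ^{-2} R` of the symbol bound for the solution. -/
def solutionWeight (ν ε : ℝ) (q : ℝ × ℝ) : ℝ :=
  √(lam ν ε q.1) * (mu ν ε q.1 ^ 2)⁻¹ * (lam ν ε q.1 * q.2)

/-- The weight `μ^{-2} log (R + 2) / (R + 1)` of the symbol bound for the error. -/
def errorWeight (ν ε : ℝ) (q : ℝ × ℝ) : ℝ :=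
  (mu ν ε q.1 ^ 2)⁻¹ * logWeight (lam ν ε q.1 * q.2)

/-- The weight `√λ (1 + R)⁻¹`, the size of the bulk term. -/
def bulkWeight (ν ε : ℝ) (q : ℝ × ℝ) : ℝ := sqrtLam ν ε q.1 * (1 + sqrtLam ν ε q.1 ^ 2 * q.2)⁻¹

/-- The sum of the nonlinear terms of `u⁵` in `u = u₀ + v` after division by `v²`. -/
def nonlinearFactor (D : ProfilePair) (ν ε : ℝ) (q : ℝ × ℝ) : ℝ :=
  10 * bulk ν ε q.1 q.2 ^ 3 + 10 * (bulk ν ε q.1 q.2 ^ 2 * corr D ν ε q) +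
    5 * (bulk ν ε q.1 q.2 * corr D ν ε q ^ 2) + corr D ν ε q ^ 3

variable {D : ProfilePair} {ν ε : ℝ} {n : ℕ} {S : Set (ℝ × ℝ)} {q : ℝ × ℝ} {t₀ c : ℝ}

theorem isOpen_openCone : IsOpen (openCone c t₀) :=
  (isOpen_lt continuous_const continuous_fst).inter
    ((isOpen_lt continuous_fst continuous_const).inter
    ((isOpen_lt continuous_const continuous_snd).inter
      (isOpen_lt continuous_snd (continuous_const.mul continuous_fst))))

theorem openCone_subset_quadrant : openCone c t₀ ⊆ quadrant := fun _ hq => ⟨hq.1, hq.2.2.1⟩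

theorem openCone_subset_wedge : openCone c t₀ ⊆ wedge c := fun _ hq => hq.2.2

theorem openCone_mono {c' : ℝ} (hc : c ≤ c') : openCone c t₀ ⊆ openCone c' t₀ :=
  fun _ hq => ⟨hq.1, hq.2.1, hq.2.2.1,
    hq.2.2.2.trans_le (mul_le_mul_of_nonneg_right hc (le_of_lt hq.1))⟩

theorem rescaledRadius_pos (hq : q ∈ quadrant) : 0 < sqrtLam ν ε q.1 ^ 2 * q.2 :=
  mul_pos (pow_pos (sqrtLam_pos hq.1) 2) hq.2

theorem xi_eq (hq : q ∈ quadrant) : xi ν ε q = sqrtLam ν ε q.1 ^ 2 * q.2 / √3 := by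
  rw [xi, sqrtLam_sq hq.1]

theorem half_rescaledRadius_le_xi (hq : q ∈ quadrant) :
    sqrtLam ν ε q.1 ^ 2 * q.2 / 2 ≤ xi ν ε q := by
  rw [xi_eq hq]
  exact div_le_div_of_nonneg_left (rescaledRadius_pos hq).le (by positivity)
    (sqrt_le_iff.2 ⟨by norm_num, by norm_num⟩)

theorem xi_le_rescaledRadius (hq : q ∈ quadrant) : xi ν ε q ≤ sqrtLam ν ε q.1 ^ 2 * q.2 := by
  rw [xi_eq hq]
  exact div_le_self (rescaledRadius_pos hq).le (one_le_sqrt.2 (by norm_num))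

theorem solutionWeight_eq (hq : q ∈ quadrant) :
    solutionWeight ν ε q =
      (q.1 ^ 2 * sqrtLam ν ε q.1 ^ 3)⁻¹ * (sqrtLam ν ε q.1 ^ 2 * q.2) := by
  have hs : 0 < sqrtLam ν ε q.1 := sqrtLam_pos hq.1
  rw [solutionWeight, mu_eq hq.1, ← sqrtLam_sq hq.1, sqrt_sq hs.le]
  field_simp

theorem errorWeight_eq (hq : q ∈ quadrant) : errorWeight ν ε q =
    (q.1 ^ 2 * sqrtLam ν ε q.1 ^ 4)⁻¹ * logWeight (sqrtLam ν ε q.1 ^ 2 * q.2) := by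
  rw [errorWeight, mu_eq hq.1, ← sqrtLam_sq hq.1]
  ring

theorem exists_one_le_mul_mu (hν : 0 ≤ ν) (t₀ : ℝ) :
    ∃ a, 0 ≤ a ∧ ∀ t ∈ Ioo 0 t₀, 1 ≤ a * (t * sqrtLam ν ε t ^ 2) := by
  have hmu (t : ℝ) (ht : t ∈ Ioo 0 t₀) : 0 ≤ mu ν ε t := mul_nonneg ht.1.le (lam_pos ht.1).le
  obtain ⟨a, ha, hle⟩ := exists_le_of_isBigO_principal (one_isBigO_mu (ε := ε) hν t₀) hmu
  refine ⟨a, ha, fun t ht => ?_⟩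
  simpa [mu_eq ht.1] using hle t ht

theorem corr₂Weight_isBigO_solutionWeight (hν : 0 ≤ ν) :
    corr₂Weight ν ε =O[𝓟 (openCone 3 t₀)] solutionWeight ν ε := by
  obtain ⟨a, ha, hmu⟩ := exists_one_le_mul_mu (ε := ε) hν t₀
  refine isBigO_principal_of_nonneg_of_le (C := 3 * a + 9) (fun q hq => ?_) fun q hq => ?_ <;>
    obtain ⟨ht, htt₀, hr, hrt⟩ := hq <;> have hs : 0 < sqrtLam ν ε q.1 := sqrtLam_pos ht
  · rw [corr₂Weight]
    positivity
  have hmu := hmu q.1 ⟨ht, htt₀⟩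
  rw [solutionWeight_eq ⟨ht, hr⟩, corr₂Weight]
  set s := sqrtLam ν ε q.1
  have hlinear : q.2 ≤ 3 * a * (q.1 ^ 2 * s ^ 2) := by
    calc q.2 ≤ 3 * q.1 * 1 := by linarith
      _ ≤ 3 * q.1 * (a * (q.1 * s ^ 2)) := by gcongr
      _ = _ := by ring
  have hquadratic : q.2 * (s ^ 2 * q.2) ≤ 9 * (q.1 ^ 2 * s ^ 2) := by
    calc q.2 * (s ^ 2 * q.2) ≤ 3 * q.1 * (s ^ 2 * (3 * q.1)) := by gcongr
      _ = _ := by ring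
  calc q.2 ^ 2 * (1 + s ^ 2 * q.2) / (q.1 ^ 4 * s ^ 3)
      = q.2 * (q.2 + q.2 * (s ^ 2 * q.2)) / (q.1 ^ 4 * s ^ 3) := by ring
    _ ≤ q.2 * (3 * a * (q.1 ^ 2 * s ^ 2) + 9 * (q.1 ^ 2 * s ^ 2)) / (q.1 ^ 4 * s ^ 3) := by gcongr
    _ = _ := by field_simp

theorem solutionWeight_isBigO_bulkWeight (hν : 0 ≤ ν) :
    solutionWeight ν ε =O[𝓟 (openCone 3 t₀)] bulkWeight ν ε := by
  obtain ⟨a, ha, hmu⟩ := exists_one_le_mul_mu (ε := ε) hν t₀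
  refine isBigO_principal_of_nonneg_of_le (C := (a + 3) ^ 2) (fun q hq => ?_) fun q hq => ?_ <;>
    rw [solutionWeight_eq (openCone_subset_quadrant hq)] <;> obtain ⟨ht, htt₀, hr, hrt⟩ := hq <;>
    have hs : 0 < sqrtLam ν ε q.1 := sqrtLam_pos ht
  · positivity
  have hmu := hmu q.1 ⟨ht, htt₀⟩
  rw [bulkWeight]
  set s := sqrtLam ν ε q.1
  have hle : 1 + s ^ 2 * q.2 ≤ (a + 3) * (q.1 * s ^ 2) := by
    have : s ^ 2 * q.2 ≤ s ^ 2 * (3 * q.1) := by gcongr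
    linarith
  calc (q.1 ^ 2 * s ^ 3)⁻¹ * (s ^ 2 * q.2)
      ≤ (q.1 ^ 2 * s ^ 3)⁻¹ * (1 + s ^ 2 * q.2) := by gcongr; linarith
    _ = (q.1 ^ 2 * s ^ 3)⁻¹ * (1 + s ^ 2 * q.2) ^ 2 * (1 + s ^ 2 * q.2)⁻¹ := by field_simp
    _ ≤ (q.1 ^ 2 * s ^ 3)⁻¹ * ((a + 3) * (q.1 * s ^ 2)) ^ 2 * (1 + s ^ 2 * q.2)⁻¹ := by gcongr
    _ = _ := by field_simp

theorem isSymbol_corr_solutionWeight (hν : 0 ≤ ν) (hS : IsOpen S) (hSt : S ⊆ openCone 3 t₀)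
    (h : IsSymbol coneField S (corr₂Weight ν ε) n (corr₂ D ν ε)) :
    IsSymbol coneField S (solutionWeight ν ε) n (corr D ν ε) := by
  have hQ : S ⊆ quadrant := hSt.trans openCone_subset_quadrant
  have hcorr₁ : (fun q => (q.1 ^ 2 * sqrtLam ν ε q.1 ^ 3)⁻¹ * xi ν ε q) =O[𝓟 S]
      solutionWeight ν ε := by
    refine isBigO_principal_of_nonneg_of_le (C := 1) (fun q hq => ?_) fun q hq => ?_ <;>
      have hs : 0 < sqrtLam ν ε q.1 := sqrtLam_pos (hQ hq).1
    · have hxi : 0 < xi ν ε q := xi_pos (hQ hq)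
      positivity
    · rw [solutionWeight_eq (hQ hq), one_mul]
      gcongr
      exact xi_le_rescaledRadius (hQ hq)
  exact ((isSymbol_corr₁.mono hQ).trans_isBigO hcorr₁).add (h.trans_isBigO
    ((corr₂Weight_isBigO_solutionWeight hν).mono (principal_mono.2 hSt))) hS

theorem isSymbol_bulk_bulkWeight : IsSymbol coneField quadrant (bulkWeight ν ε) n
    (fun q => bulk ν ε q.1 q.2) := by
  refine isSymbol_bulk.trans_isBigO (isBigO_principal_of_nonneg_of_le (C := 2) (fun q hq => ?_)
    fun q hq => ?_) <;> have hs : 0 < sqrtLam ν ε q.1 := sqrtLam_pos hq.1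
  · have hxi : 0 < xi ν ε q := xi_pos hq
    positivity
  have hR : 0 < sqrtLam ν ε q.1 ^ 2 * q.2 := rescaledRadius_pos hq
  calc sqrtLam ν ε q.1 * (1 + xi ν ε q)⁻¹
      ≤ sqrtLam ν ε q.1 * ((1 + sqrtLam ν ε q.1 ^ 2 * q.2) / 2)⁻¹ := by
        gcongr
        linarith [half_rescaledRadius_le_xi (ν := ν) (ε := ε) hq]
    _ = _ := by rw [bulkWeight]; field_simp

theorem isSymbol_nonlinearFactor (hν : 0 ≤ ν) (hS : IsOpen S) (hSt : S ⊆ openCone 3 t₀)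
    (h : IsSymbol coneField S (corr₂Weight ν ε) n (corr₂ D ν ε)) :
    IsSymbol coneField S (fun q => bulkWeight ν ε q ^ 3) n (nonlinearFactor D ν ε) := by
  have hbulk := (isSymbol_bulk_bulkWeight (ν := ν) (ε := ε) (n := n)).mono
    (hSt.trans openCone_subset_quadrant)
  have hcorr := (isSymbol_corr_solutionWeight hν hS hSt h).trans_isBigO
    ((solutionWeight_isBigO_bulkWeight hν).mono (principal_mono.2 hSt))
  refine (((((hbulk.pow hS 3).const_mul hS 10).add ?_ hS).add ?_ hS).add (hcorr.pow hS 3) hS)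
  · exact (((hbulk.pow hS 2).mul hcorr hS).congr_weight fun q _ =>
      (pow_succ _ _).symm).const_mul hS 10
  · exact ((hbulk.mul (hcorr.pow hS 2) hS).congr_weight fun q _ =>
      (pow_succ' _ _).symm).const_mul hS 5

theorem isSymbol_sq_mul_sqrtLam_inv : IsSymbol coneField quadrant
    (fun q => q.1 ^ 2 * (sqrtLam ν ε q.1)⁻¹) n (fun q => q.1 ^ 2 * (sqrtLam ν ε q.1)⁻¹) :=
  (isSymbol_fst.pow isOpen_quadrant 2).mul (isSymbol_comp_fst isSymbol_sqrtLam_inv)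
    isOpen_quadrant

theorem logWeight_xi_le (hq : q ∈ quadrant) :
    logWeight (xi ν ε q) ≤ 2 * logWeight (sqrtLam ν ε q.1 ^ 2 * q.2) := by
  have hxi : 0 < xi ν ε q := xi_pos hq
  have hR : 0 < sqrtLam ν ε q.1 ^ 2 * q.2 := rescaledRadius_pos hq
  have hle := xi_le_rescaledRadius (ν := ν) (ε := ε) hq
  have hhalf := half_rescaledRadius_le_xi (ν := ν) (ε := ε) hq
  have hlog := one_half_le_log_add_two hR.le
  calc logWeight (xi ν ε q)
      ≤ log (sqrtLam ν ε q.1 ^ 2 * q.2 + 2) / ((sqrtLam ν ε q.1 ^ 2 * q.2 + 1) / 2) := by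
        rw [logWeight]
        gcongr
        linarith
    _ = _ := by rw [logWeight]; field_simp

theorem isSymbol_linearError : IsSymbol coneField quadrant (errorWeight ν ε) n
    (fun q => q.1 ^ 2 * (sqrtLam ν ε q.1)⁻¹ * dt (dt (corrDiff D ν ε)) q) := by
  have hcorrDiff := isSymbol_corrDiff (D := D) (ν := ν) (ε := ε) (n := n + 2)
  refine (isSymbol_sq_mul_sqrtLam_inv.mul ((hcorrDiff.dt isOpen_quadrant Subset.rfl).dt
    isOpen_quadrant Subset.rfl) isOpen_quadrant).trans_isBigO
      (isBigO_principal_of_nonneg_of_le (C := 2) (fun q hq => ?_) fun q hq => ?_) <;>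
    have hs : 0 < sqrtLam ν ε q.1 := sqrtLam_pos hq.1 <;> have ht : 0 < q.1 := hq.1
  · have hlog : 0 < logWeight (xi ν ε q) := logWeight_pos (xi_pos hq).le
    positivity
  calc _ = (q.1 ^ 2 * sqrtLam ν ε q.1 ^ 4)⁻¹ * logWeight (xi ν ε q) := by field_simp
    _ ≤ (q.1 ^ 2 * sqrtLam ν ε q.1 ^ 4)⁻¹ * (2 * logWeight (sqrtLam ν ε q.1 ^ 2 * q.2)) := by
        gcongr
        exact logWeight_xi_le hq
    _ = _ := by rw [errorWeight_eq hq]; ring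

theorem isBigO_errorWeight (f : ℝ × ℝ → ℝ) (hf : ∀ q ∈ S, f q = (q.1 ^ 2 *
    sqrtLam ν ε q.1 ^ 4)⁻¹ * ((sqrtLam ν ε q.1 ^ 2 * q.2) ^ 2 *
      (1 + sqrtLam ν ε q.1 ^ 2 * q.2)⁻¹ ^ 3)) (hS : S ⊆ quadrant) :
    f =O[𝓟 S] errorWeight ν ε := by
  refine isBigO_principal_of_nonneg_of_le (C := 2) (fun q hq => ?_) fun q hq => ?_ <;>
    rw [hf q hq] <;> have hs : 0 < sqrtLam ν ε q.1 := sqrtLam_pos (hS hq).1 <;>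
    have hR : 0 < sqrtLam ν ε q.1 ^ 2 * q.2 := rescaledRadius_pos (hS hq)
  · positivity
  rw [errorWeight_eq (hS hq), mul_left_comm 2]
  set R := sqrtLam ν ε q.1 ^ 2 * q.2
  refine mul_le_mul_of_nonneg_left ?_ (by positivity)
  calc R ^ 2 * (1 + R)⁻¹ ^ 3 = (R * (1 + R)⁻¹) ^ 2 * (1 + R)⁻¹ := by ring
    _ ≤ 1 ^ 2 * (1 + R)⁻¹ := by gcongr; exact mul_inv_one_add_le_one hR.le
    _ ≤ 2 * logWeight R := by simpa using inv_one_add_le_logWeight hR.le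

theorem isSymbol_potentialError (hS : IsOpen S) (hQ : S ⊆ quadrant)
    (h : IsSymbol coneField S (corr₂Weight ν ε) n (corr₂ D ν ε)) :
    IsSymbol coneField S (errorWeight ν ε) n (fun q =>
      q.1 ^ 2 * (sqrtLam ν ε q.1)⁻¹ * (bulk ν ε q.1 q.2 ^ 4 * corr₂ D ν ε q)) := by
  refine ((isSymbol_sq_mul_sqrtLam_inv.mono hQ).mul
    (((isSymbol_bulk_bulkWeight.mono hQ).pow hS 4).mul h hS) hS).trans_isBigO
      (isBigO_errorWeight _ (fun q hq => ?_) hQ)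
  have ht : 0 < q.1 := (hQ hq).1
  have hs : 0 < sqrtLam ν ε q.1 := sqrtLam_pos ht
  have hR : 0 < sqrtLam ν ε q.1 ^ 2 * q.2 := rescaledRadius_pos (hQ hq)
  rw [corr₂Weight, bulkWeight]
  field_simp

theorem isSymbol_nonlinearError (hν : 0 ≤ ν) (hS : IsOpen S) (hSt : S ⊆ openCone 3 t₀)
    (h : IsSymbol coneField S (corr₂Weight ν ε) n (corr₂ D ν ε)) :
    IsSymbol coneField S (errorWeight ν ε) n (fun q =>
      q.1 ^ 2 * (sqrtLam ν ε q.1)⁻¹ * (corr D ν ε q ^ 2 * nonlinearFactor D ν ε q)) := by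
  have hQ : S ⊆ quadrant := hSt.trans openCone_subset_quadrant
  refine ((isSymbol_sq_mul_sqrtLam_inv.mono hQ).mul (((isSymbol_corr_solutionWeight hν hS hSt
    h).pow hS 2).mul (isSymbol_nonlinearFactor hν hS hSt h) hS) hS).trans_isBigO
      (isBigO_errorWeight _ (fun q hq => ?_) hQ)
  have ht : 0 < q.1 := (hQ hq).1
  have hs : 0 < sqrtLam ν ε q.1 := sqrtLam_pos ht
  have hR : 0 < sqrtLam ν ε q.1 ^ 2 * q.2 := rescaledRadius_pos (hQ hq)
  rw [solutionWeight_eq (hQ hq), bulkWeight]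
  field_simp

theorem lam_rpow {t : ℝ} (ht : 0 < t) : lam ν ε t ^ (-(1 / 2) : ℝ) = (sqrtLam ν ε t)⁻¹ := by
  rw [rpow_neg (lam_pos ht).le, ← sqrt_eq_rpow, sqrtLam]

theorem normError_approx (hν : 3 < ν) (hq : q ∈ quadrant) :
    normError ν ε (fun s ρ => approx D ν ε (s, ρ)) q.1 q.2 =
      q.1 ^ 2 * (sqrtLam ν ε q.1)⁻¹ * dt (dt (corrDiff D ν ε)) q -
      5 * (q.1 ^ 2 * (sqrtLam ν ε q.1)⁻¹ * (bulk ν ε q.1 q.2 ^ 4 * corr₂ D ν ε q)) -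
      q.1 ^ 2 * (sqrtLam ν ε q.1)⁻¹ * (corr D ν ε q ^ 2 * nonlinearFactor D ν ε q) := by
  rw [normError, quinticOp_approx hν hq, lam_rpow hq.1, nonlinearFactor]
  ring

theorem isSymbol_normError_approx (hν : 3 < ν) (hS : IsOpen S) (hSt : S ⊆ openCone 3 t₀)
    (h : IsSymbol coneField S (corr₂Weight ν ε) n (corr₂ D ν ε)) :
    IsSymbol coneField S (errorWeight ν ε) n
      (fun q => normError ν ε (fun s ρ => approx D ν ε (s, ρ)) q.1 q.2) := by
  have hν₀ : 0 ≤ ν := by linarith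
  have hQ : S ⊆ quadrant := hSt.trans openCone_subset_quadrant
  exact (((isSymbol_linearError.mono hQ).sub ((isSymbol_potentialError hS hQ h).const_mul hS 5)
    hS).sub (isSymbol_nonlinearError hν₀ hS hSt h) hS).congr hS
      fun q hq => normError_approx hν (hQ hq)

theorem solutionBound_approx (hν : 0 ≤ ν) (hS : IsOpen S) (hSt : S ⊆ openCone 3 t₀) {k j : ℕ}
    (h : IsSymbol coneField S (corr₂Weight ν ε) (k + j) (corr₂ D ν ε)) :
    SolutionBound ν ε (fun s ρ => approx D ν ε (s, ρ)) k j S := by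
  have hQ : S ⊆ quadrant := hSt.trans openCone_subset_quadrant
  have hcorr := isSymbol_corr_solutionWeight hν hS hSt h
  have hweight (q : ℝ × ℝ) (hq : q ∈ S) : 0 ≤ solutionWeight ν ε q := by
    have hs : 0 < sqrtLam ν ε q.1 := sqrtLam_pos (hQ hq).1
    have hR := rescaledRadius_pos (ν := ν) (ε := ε) (hQ hq)
    rw [solutionWeight_eq (hQ hq)]
    positivity
  obtain ⟨C, -, hC⟩ := hcorr.exists_abs_pderiv_le hS hQ hweight
  refine ⟨C, fun t r htr => ?_⟩
  have hadd : pderiv k j (fun s ρ => approx D ν ε (s, ρ)) t r = pderiv k j (bulk ν ε) t r +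
      pderiv k j (fun s ρ => corr D ν ε (s, ρ)) t r :=
    pderiv_add hS (isSymbol_bulk.mono hQ).contDiffOn hcorr.contDiffOn htr
  rw [hadd, add_sub_cancel_left]
  refine (hC t r htr).trans_eq ?_
  simp only [solutionWeight]
  ring

theorem errorBound_approx (hν : 3 < ν) (hS : IsOpen S) (hSt : S ⊆ openCone 3 t₀) {k j : ℕ}
    (h : IsSymbol coneField S (corr₂Weight ν ε) (k + j) (corr₂ D ν ε)) :
    ErrorBound ν ε (fun s ρ => approx D ν ε (s, ρ)) k j S := by
  have hQ : S ⊆ quadrant := hSt.trans openCone_subset_quadrant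
  have hweight (q : ℝ × ℝ) (hq : q ∈ S) : 0 ≤ errorWeight ν ε q := by
    have hlog := logWeight_pos (rescaledRadius_pos (ν := ν) (ε := ε) (hQ hq)).le
    rw [errorWeight_eq (hQ hq)]
    positivity
  obtain ⟨C, -, hC⟩ := (isSymbol_normError_approx hν hS hSt h).exists_abs_pderiv_le hS hQ hweight
  refine ⟨C, fun t r htr => (hC t r htr).trans_eq ?_⟩
  simp only [errorWeight, logWeight]
  ring

end Estimates

noncomputable section Regularity

variable {D : ProfilePair} {ν ε p c : ℝ} {n m : ℕ} {q : ℝ × ℝ}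

theorem IsSymbol.contDiffOn_comp_fst {h w : ℝ → ℝ} (hh : IsSymbol eulerField (Ioi 0) w n h) :
    ContDiffOn ℝ n (fun q : ℝ × ℝ => h q.1) {q | 0 < q.1} :=
  hh.contDiffOn.comp contDiffOn_fst fun _ hq => hq

theorem contDiffOn_xi : ContDiffOn ℝ n (xi ν ε) {q | 0 < q.1} :=
  (isSymbol_lam.contDiffOn_comp_fst.mul contDiffOn_snd).div_const (√3)

theorem contDiffOn_bulk : ContDiffOn ℝ n (fun q : ℝ × ℝ => bulk ν ε q.1 q.2) {q | 0 < q.1} :=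
  (isSymbol_sqrtLam.contDiffOn_comp_fst.mul
    ((contDiff_ground.of_le (by exact_mod_cast le_top)).comp_contDiffOn contDiffOn_xi)).congr
    fun q _ => bulk_eq q

theorem contDiffOn_corr₁ : ContDiffOn ℝ n (corr₁ D ν ε) {q | 0 < q.1} := by
  have hF₁ := (contDiff_infty.1 D.isProfile₁.contDiff n).comp_contDiffOn
    (contDiffOn_xi (ν := ν) (ε := ε))
  have hF₂ := (contDiff_infty.1 D.isProfile₂.contDiff n).comp_contDiffOn
    (contDiffOn_xi (ν := ν) (ε := ε))
  have hfactor : ContDiffOn ℝ n (fun q : ℝ × ℝ => (q.1 ^ 2 * sqrtLam ν ε q.1 ^ 3)⁻¹)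
      {q | 0 < q.1} := by
    refine ((contDiffOn_fst.pow 2).mul (isSymbol_sqrtLam.contDiffOn_comp_fst.pow 3)).inv
      fun q hq => ?_
    have ht : 0 < q.1 := hq
    have hs : 0 < sqrtLam ν ε q.1 := sqrtLam_pos ht
    positivity
  exact hfactor.mul ((isSymbol_omega₁.contDiffOn_comp_fst.mul hF₁).add
    (isSymbol_omega₂.contDiffOn_comp_fst.mul hF₂))

theorem contDiffOn_indicator_taylorRem {a : ℝ → ℝ} (h : IsPowerSymbol p a) (hc : |c| ≤ 1)
    (hm : n < m) : ContDiffOn ℝ n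
      ({q | 0 < q.2}.indicator fun q : ℝ × ℝ => q.2⁻¹ * taylorRem a c (m + 1) q)
      (extendedWedge (1 / 2)) := by
  have hsub : wedge (1 / 2) ⊆ quadrant := wedge_subset one_half_pos
  refine contDiffOn_of_flat (m := m) (h := fun t => t ^ (p - (m + 1 : ℕ))) one_half_pos ?_ hm
    (continuousOn_id.rpow_const fun t ht => .inl (ne_of_gt ht))
    fun q _ hr => indicator_of_notMem (s := {q : ℝ × ℝ | 0 < q.2}) (not_lt.2 hr) _
  refine ((((isSymbol_comp_snd isSymbol_inv).mono hsub).mul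
    (isSymbol_taylorRem_wedge_half h hc (m + 1)) isOpen_wedge).congr_weight
    fun q hq => ?_).congr isOpen_wedge fun q hq =>
      indicator_of_mem (s := {q : ℝ × ℝ | 0 < q.2}) hq.1 _
  have hr : q.2 ≠ 0 := hq.1.ne'
  rw [pow_succ']
  field_simp

theorem taylorRem_primB_three :
    taylorRem (primB D ν ε) 1 3 q - taylorRem (primB D ν ε) (-1) 3 q =
      taylorRem (primB D ν ε) 1 4 q - taylorRem (primB D ν ε) (-1) 4 q +
        q.2 ^ 3 / 3 * iteratedDeriv 3 (primB D ν ε) q.1 := by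
  simp only [taylorRem, Finset.sum_range_succ _ 3]
  norm_num [Nat.factorial]
  ring

theorem corr₂_eq_taylorRem_four (hν : 3 < ν) (ht : 0 < q.1) (hr : q.2 ≠ 0) : corr₂ D ν ε q =
    q.2⁻¹ * taylorRem (primA D ν ε) 1 4 q + q.2⁻¹ * taylorRem (primA D ν ε) (-1) 4 q +
      1 / 2 * (q.2⁻¹ * taylorRem (primB D ν ε) 1 4 q -
        q.2⁻¹ * taylorRem (primB D ν ε) (-1) 4 q) +
      q.2 ^ 2 / 6 * iteratedDeriv 3 (primB D ν ε) q.1 := by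
  rw [corr₂_eq_taylorRem hν ht, taylorRem_primB_three]
  field_simp
  ring

theorem contDiffOn_corr₂_of_nonneg (hν : 3 < ν) :
    ContDiffOn ℝ 2 (corr₂ D ν ε) {q | 0 < q.1 ∧ 0 ≤ q.2} := by
  have hA := (isExtendedPowerSymbol_primA (D := D) (ε := ε) hν).isPowerSymbol
  have hB := (isExtendedPowerSymbol_primB (D := D) (ε := ε) hν).isPowerSymbol
  have hone : |(1 : ℝ)| ≤ 1 := by simp
  have hneg : |(-1 : ℝ)| ≤ 1 := by simp
  have hcubic : ContDiffOn ℝ 2 (fun q : ℝ × ℝ => q.2 ^ 2 / 6 * iteratedDeriv 3 (primB D ν ε) q.1)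
      (extendedWedge (1 / 2)) :=
    ((contDiffOn_snd.pow 2).div_const 6).mul
      ((hB.iteratedDeriv 3 2).contDiffOn_comp_fst.mono fun _ hq => hq.1)
  have hflat {p : ℝ} {a : ℝ → ℝ} (h : IsPowerSymbol p a) (c : ℝ) (hc : |c| ≤ 1) :=
    contDiffOn_indicator_taylorRem (n := 2) (m := 3) h hc (by norm_num)
  have hextension := (((hflat hA 1 hone).add (hflat hA (-1) hneg)).add ((contDiffOn_const
    (c := (1 / 2 : ℝ))).mul ((hflat hB 1 hone).sub (hflat hB (-1) hneg)))).add hcubic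
  rintro ⟨t, r⟩ ⟨ht : 0 < t, hr : 0 ≤ r⟩
  rcases hr.lt_or_eq with hr | rfl
  · have hmem : (t, r) ∈ quadrant := ⟨ht, hr⟩
    exact ((contDiffOn_corr₂ hν).contDiffAt (isOpen_quadrant.mem_nhds hmem)).contDiffWithinAt
  · refine (hextension.contDiffAt (isOpen_extendedWedge.mem_nhds
      ⟨ht, by positivity⟩)).contDiffWithinAt.congr (fun q hq => ?_) (by simp [corr₂])
    rcases hq.2.lt_or_eq with hr | hr
    · have hmem : q ∈ {q : ℝ × ℝ | 0 < q.2} := hr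
      simp only [corr₂_eq_taylorRem_four hν hq.1 hr.ne', indicator_of_mem hmem]
    · simp [corr₂, ← hr]

theorem contDiffOn_approx (hν : 3 < ν) :
    ContDiffOn ℝ 2 (approx D ν ε) {q | 0 < q.1 ∧ 0 ≤ q.2} :=
  (contDiffOn_bulk.mono fun _ hq => hq.1).add
    ((contDiffOn_corr₁.mono fun _ hq => hq.1).add (contDiffOn_corr₂_of_nonneg hν))

end Regularity

noncomputable section Energy

variable {f : ℝ × ℝ → ℝ} {K a b t r C : ℝ}

theorem integrableOn_Ici_of_continuousOn {g : ℝ → ℝ} (hg : ContinuousOn g (Icc a b))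
    (hzero : ∀ r, b < r → g r = 0) : IntegrableOn g (Ici a) :=
  hg.integrableOn_Icc.of_forall_sdiff_eq_zero measurableSet_Ici fun r hr =>
    hzero r (not_le.1 fun h => hr.2 ⟨hr.1, h⟩)

theorem setIntegral_Ici_le {g : ℝ → ℝ} (hab : a ≤ b) (hg : ∀ r ∈ Icc a b, |g r| ≤ K)
    (hzero : ∀ r, b < r → g r = 0) : ∫ r in Ici a, g r ≤ K * (b - a) := by
  rw [setIntegral_eq_of_subset_of_forall_sdiff_eq_zero measurableSet_Ici Icc_subset_Ici_self
    fun r hr => hzero r (not_le.1 fun h => hr.2 ⟨hr.1, h⟩), ← Real.volume_real_Icc_of_le hab]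
  exact (Real.le_norm_self _).trans (norm_setIntegral_le_of_norm_le_const measure_Icc_lt_top hg)

theorem energyDensity_eq (hf : ContDiffOn ℝ (1 : ℕ) f quadrant) (h : (t, r) ∈ quadrant) :
    energyDensity (fun s ρ => f (s, ρ)) t r =
      (dr f (t, r) ^ 2 + dt f (t, r) ^ 2 + f (t, r) ^ 6) * r ^ 2 := by
  have hr := pderiv_eq_iterate (k := 0) (j := 1) isOpen_quadrant hf h
  have ht := pderiv_eq_iterate (k := 1) (j := 0) isOpen_quadrant hf h
  rw [energyDensity, hr, ht]
  rfl

theorem continuousOn_energyDensity (hf : ContDiffOn ℝ (1 : ℕ) f quadrant) (ht : 0 < t) :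
    ContinuousOn (energyDensity (fun s ρ => f (s, ρ)) t) (Ioi 0) := by
  have hline : ContinuousOn (fun r : ℝ => (t, r)) (Ioi 0) := by fun_prop
  have hmaps : MapsTo (fun r : ℝ => (t, r)) (Ioi 0) quadrant := fun r hr => ⟨ht, hr⟩
  have hdr : ContinuousOn (dr f) quadrant :=
    (contDiffOn_dirDeriv (n := 0) isOpen_quadrant hf).continuousOn
  have hdt : ContinuousOn (dt f) quadrant :=
    (contDiffOn_dirDeriv (n := 0) isOpen_quadrant hf).continuousOn
  exact (((((hdr.comp hline hmaps).pow 2).add ((hdt.comp hline hmaps).pow 2)).add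
    ((hf.continuousOn.comp hline hmaps).pow 6)).mul (continuousOn_id.pow 2)).congr
      fun r hr => energyDensity_eq hf (hmaps hr)

theorem energyDensity_eq_zero {S : Set (ℝ × ℝ)} (hS : IsOpen S) (hf : ∀ q ∈ S, f q = 0)
    (h : (t, r) ∈ S) : energyDensity (fun s ρ => f (s, ρ)) t r = 0 := by
  have hpderiv (k j : ℕ) : pderiv k j (fun s ρ => f (s, ρ)) t r = pderiv k j (fun _ _ => 0) t r :=
    pderiv_congr hS (fun s ρ hsρ => hf (s, ρ) hsρ) h
  rw [energyDensity, hpderiv, hpderiv, hf _ h]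
  simp [pderiv]

theorem abs_energyDensity_le {u : ℝ → ℝ → ℝ} (ht : 0 < t) (htr : t ≤ r)
    (hrt : r ≤ 2 * t) (hu : |u t r| ≤ C) (hr : |pderiv 0 1 u t r| ≤ C * r⁻¹)
    (hdt : |pderiv 1 0 u t r| ≤ C * t⁻¹) :
    |energyDensity u t r| ≤ 5 * C ^ 2 + C ^ 6 * (2 * t) ^ 2 := by
  have hr₀ : 0 < r := ht.trans_le htr
  have hu := pow_le_pow_left₀ (abs_nonneg _) hu 6
  have hr := pow_le_pow_left₀ (abs_nonneg _) hr 2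
  have hdt := pow_le_pow_left₀ (abs_nonneg _) hdt 2
  rw [Even.pow_abs (by decide)] at hu
  rw [sq_abs] at hr hdt
  rw [energyDensity, abs_of_nonneg (by positivity)]
  calc (pderiv 0 1 u t r ^ 2 + pderiv 1 0 u t r ^ 2 + u t r ^ 6) * r ^ 2
      ≤ ((C * r⁻¹) ^ 2 + (C * t⁻¹) ^ 2 + C ^ 6) * r ^ 2 := by gcongr
    _ = C ^ 2 * (1 + (r * t⁻¹) ^ 2) + C ^ 6 * r ^ 2 := by field_simp
    _ ≤ C ^ 2 * (1 + (2 * t * t⁻¹) ^ 2) + C ^ 6 * (2 * t) ^ 2 := by gcongr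
    _ = 5 * C ^ 2 + C ^ 6 * (2 * t) ^ 2 := by field_simp; ring

end Energy

noncomputable section Exterior

/-- The approximate solution multiplied by a smooth function of `r / t` that is `1` on the light
cone `r ≤ t` and vanishes for `r ≥ 2 t`. -/
def cutoffApprox (D : ProfilePair) (ν ε : ℝ) (q : ℝ × ℝ) : ℝ :=
  Real.smoothTransition (2 - q.2 / q.1) * approx D ν ε q

/-- The part `t / 2 < r < 3 t` of the strip `0 < t < t₀`, a neighbourhood of the set that carries
the exterior energy of the cut-off solution. -/
def rim (t₀ : ℝ) : Set (ℝ × ℝ) := {q | 0 < q.1 ∧ q.1 < t₀ ∧ q.1 / 2 < q.2 ∧ q.2 < 3 * q.1}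

variable {D : ProfilePair} {ν ε t₀ t : ℝ} {n : ℕ} {S : Set (ℝ × ℝ)} {q : ℝ × ℝ}

theorem contDiffOn_cutoffApprox (hν : 3 < ν) :
    ContDiffOn ℝ 2 (cutoffApprox D ν ε) {q | 0 < q.1 ∧ 0 ≤ q.2} :=
  (Real.smoothTransition.contDiff.comp_contDiffOn (contDiffOn_const.sub
    (contDiffOn_snd.div contDiffOn_fst fun _ hq => hq.1.ne'))).mul (contDiffOn_approx hν)

theorem cutoffApprox_eq (ht : 0 < q.1) (hr : q.2 ≤ q.1) :
    cutoffApprox D ν ε q = approx D ν ε q := by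
  have hratio : q.2 / q.1 ≤ 1 := (div_le_one ht).2 hr
  rw [cutoffApprox, Real.smoothTransition.one_of_one_le (by linarith), one_mul]

theorem cutoffApprox_eq_zero (ht : 0 < q.1) (hr : 2 * q.1 ≤ q.2) :
    cutoffApprox D ν ε q = 0 := by
  have hratio : 2 ≤ q.2 / q.1 := (le_div_iff₀ ht).2 hr
  rw [cutoffApprox, Real.smoothTransition.zero_of_nonpos (by linarith), zero_mul]

theorem isOpen_rim : IsOpen (rim t₀) :=
  (isOpen_lt continuous_const continuous_fst).inter
    ((isOpen_lt continuous_fst continuous_const).inter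
    ((isOpen_lt (continuous_fst.div_const 2) continuous_snd).inter
      (isOpen_lt continuous_snd (continuous_const.mul continuous_fst))))

theorem rim_subset_openCone : rim t₀ ⊆ openCone 3 t₀ := fun _ hq =>
  ⟨hq.1, hq.2.1, (half_pos hq.1).trans hq.2.2.1, hq.2.2.2⟩

theorem inv_mul_sqrtLam_isBigO_one (hν : 1 ≤ ν) (t₀ : ℝ) :
    (fun t => (t * sqrtLam ν ε t)⁻¹) =O[𝓟 (Ioo 0 t₀)] fun _ => (1 : ℝ) := by
  have htheta := (inv_pow_mul_sqrtLam_pow_isTheta (ν := ν) (ε := ε) 1 1).1.mono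
    (principal_mono.2 Ioo_subset_Ioi_self : 𝓟 (Ioo 0 t₀) ≤ _)
  simp only [pow_one, Nat.cast_one, one_mul] at htheta
  refine htheta.trans (isBigO_principal_of_nonneg_of_le (C := t₀ ^ ((1 + ν) / 2 - 1))
    (fun t ht => rpow_nonneg ht.1.le _) fun t ht => ?_)
  rw [mul_one]
  exact rpow_le_rpow ht.1.le ht.2.le (by linarith)

theorem bulkWeight_isBigO_one (hν : 1 ≤ ν) :
    bulkWeight ν ε =O[𝓟 (rim t₀)] fun _ => (1 : ℝ) := by
  obtain ⟨C, -, hC⟩ := exists_le_of_isBigO_principal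
    (inv_mul_sqrtLam_isBigO_one (ε := ε) hν t₀) fun _ _ => zero_le_one
  refine isBigO_principal_of_nonneg_of_le (C := 2 * C) (fun q hq => ?_) fun q hq => ?_ <;>
    obtain ⟨ht, htt₀, hr, -⟩ := hq <;> have hs : 0 < sqrtLam ν ε q.1 := sqrtLam_pos ht <;>
    rw [bulkWeight]
  · have hr₀ : 0 < q.2 := (half_pos ht).trans hr
    positivity
  calc sqrtLam ν ε q.1 * (1 + sqrtLam ν ε q.1 ^ 2 * q.2)⁻¹
      ≤ sqrtLam ν ε q.1 * (0 + sqrtLam ν ε q.1 ^ 2 * (q.1 / 2))⁻¹ := by gcongr; norm_num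
    _ = 2 * (q.1 * sqrtLam ν ε q.1)⁻¹ := by field_simp; ring
    _ ≤ 2 * C * 1 := by
        have := (le_abs_self _).trans (hC q.1 ⟨ht, htt₀⟩)
        linarith

theorem isSymbol_cutoff : IsSymbol coneField (rim t₀) (fun _ => 1) n
    (fun q => Real.smoothTransition (2 - q.2 / q.1)) := by
  have hprofile : IsSymbol eulerField (Ioo 0 3) (fun _ => 1) n
      (fun a => Real.smoothTransition (2 - a)) :=
    IsSymbol.of_contDiff
      (Real.smoothTransition.contDiff.comp (contDiff_const.sub contDiff_id)) 0 3
  have hratio : ContDiffOn ℝ n (fun q : ℝ × ℝ => q.2 / q.1) (rim t₀) :=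
    contDiffOn_snd.div contDiffOn_fst fun q hq => hq.1.ne'
  refine hprofile.comp (φ := fun q : ℝ × ℝ => q.2 / q.1) (c := fun i _ => if i then 1 else -1)
    isOpen_Ioo isOpen_rim hratio (fun q hq => ?_) (fun i => .const _) fun i q hq => ?_
  · exact ⟨div_pos (rim_subset_openCone hq).2.2.1 hq.1, (div_lt_iff₀ hq.1).2 hq.2.2.2⟩
  · have ht : q.1 ≠ 0 := hq.1.ne'
    have hd : DifferentiableAt ℝ (fun q : ℝ × ℝ => q.2 / q.1) (q.1, q.2) :=
      by fun_prop (disch := exact ht)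
    cases i
    · rw [fieldDeriv_false, (hasDerivAt_fst hd).unique
        ((hasDerivAt_const q.1 q.2).div (hasDerivAt_id q.1) ht)]
      simp only [Bool.false_eq_true, if_false]
      field_simp
      ring
    · rw [fieldDeriv_true, (hasDerivAt_snd hd).unique ((hasDerivAt_id q.2).div_const q.1)]
      simp only [if_true]
      ring

theorem isSymbol_approx_bulkWeight (hν : 0 ≤ ν) (hS : IsOpen S) (hSt : S ⊆ openCone 3 t₀)
    (h : IsSymbol coneField S (corr₂Weight ν ε) n (corr₂ D ν ε)) :
    IsSymbol coneField S (bulkWeight ν ε) n (approx D ν ε) :=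
  (isSymbol_bulk_bulkWeight.mono (hSt.trans openCone_subset_quadrant)).add
    ((isSymbol_corr_solutionWeight hν hS hSt h).trans_isBigO
      ((solutionWeight_isBigO_bulkWeight hν).mono (principal_mono.2 hSt))) hS

theorem isSymbol_cutoffApprox (hν : 3 < ν) :
    IsSymbol coneField (rim t₀) (fun _ => 1) 2 (cutoffApprox D ν ε) := by
  have happrox : IsSymbol coneField (rim t₀) (fun _ => 1) 2 (approx D ν ε) :=
    (isSymbol_approx_bulkWeight (by linarith) isOpen_rim rim_subset_openCone
      ((isSymbol_corr₂_wedge_three hν).mono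
        (rim_subset_openCone.trans openCone_subset_wedge))).trans_isBigO
          (bulkWeight_isBigO_one (by linarith))
  exact (isSymbol_cutoff.mul happrox isOpen_rim).congr_weight fun _ _ => one_mul 1

theorem exists_abs_energyDensity_cutoffApprox_le (hν : 3 < ν) (t₀ : ℝ) :
    ∃ K, ∀ t r, 0 < t → t < t₀ → t ≤ r → r ≤ 2 * t →
      |energyDensity (fun s ρ => cutoffApprox D ν ε (s, ρ)) t r| ≤ K := by
  have hsymbol := isSymbol_cutoffApprox (D := D) (ε := ε) (t₀ := t₀) hν
  have hQ : rim t₀ ⊆ quadrant := rim_subset_openCone.trans openCone_subset_quadrant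
  have hbound (k j : ℕ) (hkj : k + j ≤ 2) := (hsymbol.of_le hkj).exists_abs_pderiv_le
    isOpen_rim hQ fun _ _ => zero_le_one
  obtain ⟨C₀, hC₀, hu⟩ := hbound 0 0 (by norm_num)
  obtain ⟨C₁, hC₁, hdt⟩ := hbound 1 0 (by norm_num)
  obtain ⟨C₂, hC₂, hdr⟩ := hbound 0 1 (by norm_num)
  simp only [pow_zero, pow_one, inv_one, one_mul, mul_one] at hu hdt hdr
  set C := C₀ + C₁ + C₂
  refine ⟨5 * C ^ 2 + C ^ 6 * (2 * t₀) ^ 2, fun t r ht htt₀ htr hrt => ?_⟩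
  have hmem : (t, r) ∈ rim t₀ :=
    ⟨ht, htt₀, by simp only; linarith, by simp only; linarith⟩
  have hr : 0 < r := ht.trans_le htr
  have hle := abs_energyDensity_le (u := fun s ρ => cutoffApprox D ν ε (s, ρ)) (C := C)
    ht htr hrt ((by simpa [pderiv] using hu t r hmem : _ ≤ C₀).trans (by linarith))
    ((hdr t r hmem).trans (by gcongr; linarith)) ((hdt t r hmem).trans (by gcongr; linarith))
  exact hle.trans (by gcongr)

theorem exists_exterior_energy_le (hν : 3 < ν) (t₀ : ℝ) : ∃ K, ∀ t, 0 < t → t < t₀ →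
    IntegrableOn (energyDensity (fun s ρ => cutoffApprox D ν ε (s, ρ)) t) (Ici t) ∧
      ∫ r in Ici t, energyDensity (fun s ρ => cutoffApprox D ν ε (s, ρ)) t r ≤ K * t := by
  obtain ⟨K, hK⟩ := exists_abs_energyDensity_cutoffApprox_le (D := D) (ε := ε) hν t₀
  refine ⟨K, fun t ht htt₀ => ?_⟩
  have hC1 : ContDiffOn ℝ (1 : ℕ) (cutoffApprox D ν ε) quadrant :=
    ((contDiffOn_cutoffApprox hν).mono fun q hq => ⟨hq.1, le_of_lt hq.2⟩).of_le (by norm_num)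
  have hopen : IsOpen {q : ℝ × ℝ | 0 < q.1 ∧ 2 * q.1 < q.2} :=
    (isOpen_lt continuous_const continuous_fst).inter
      (isOpen_lt (continuous_const.mul continuous_fst) continuous_snd)
  have hzero (r : ℝ) (hr : 2 * t < r) :
      energyDensity (fun s ρ => cutoffApprox D ν ε (s, ρ)) t r = 0 :=
    energyDensity_eq_zero hopen (fun q hq => cutoffApprox_eq_zero hq.1 hq.2.le) ⟨ht, hr⟩
  refine ⟨integrableOn_Ici_of_continuousOn ((continuousOn_energyDensity hC1 ht).mono
    fun r hr => ht.trans_le hr.1) hzero, ?_⟩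
  exact (setIntegral_Ici_le (by linarith) (fun r hr => hK t r ht htt₀ hr.1 hr.2) hzero).trans_eq
    (by ring)

theorem exists_exterior_energy_lt (hν : 3 < ν) (t₀ : ℝ) {δ : ℝ} (hδ : 0 < δ) :
    ∃ t₁, 0 < t₁ ∧ ∀ t, 0 < t → t < t₀ → t < t₁ →
      IntegrableOn (energyDensity (fun s ρ => cutoffApprox D ν ε (s, ρ)) t) (Ici t) ∧
        ∫ r in Ici t, energyDensity (fun s ρ => cutoffApprox D ν ε (s, ρ)) t r < δ := by
  obtain ⟨K, hK⟩ := exists_exterior_energy_le (D := D) (ε := ε) hν t₀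
  refine ⟨δ / (|K| + 1), by positivity, fun t ht htt₀ htt₁ => ?_⟩
  refine ⟨(hK t ht htt₀).1, (hK t ht htt₀).2.trans_lt ?_⟩
  rw [lt_div_iff₀ (by positivity)] at htt₁
  nlinarith [le_abs_self K]

end Exterior

noncomputable section Main

variable {D : ProfilePair} {ν ε t₀ : ℝ} {u : ℝ → ℝ → ℝ} {S : Set (ℝ × ℝ)}

theorem SolutionBound.exists_abs_sub_bulk_le (h : SolutionBound ν ε u 0 0 S) :
    ∃ C, ∀ t r, (t, r) ∈ S → |u t r - √(lam ν ε t) * W (lam ν ε t * r)| ≤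
      C * (√(lam ν ε t) * (mu ν ε t ^ 2)⁻¹ * (lam ν ε t * r)) := by
  simpa [SolutionBound, pderiv, bulk] using h

theorem ErrorBound.exists_abs_normError_le (h : ErrorBound ν ε u 0 0 S) :
    ∃ C, ∀ t r, (t, r) ∈ S → |normError ν ε u t r| ≤
      C * ((mu ν ε t ^ 2)⁻¹ * (log (lam ν ε t * r + 2) / (lam ν ε t * r + 1))) := by
  simpa [ErrorBound, pderiv] using h

theorem solutionBound_and_errorBound_openCone_one (hν : 3 < ν) (t₀ : ℝ) {k j : ℕ}
    (hkj : k + j ≤ 2) :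
    SolutionBound ν ε (fun t r => approx D ν ε (t, r)) k j (openCone 1 t₀) ∧
      ErrorBound ν ε (fun t r => approx D ν ε (t, r)) k j (openCone 1 t₀) := by
  have hcone : openCone 1 t₀ ⊆ openCone 3 t₀ := openCone_mono (by norm_num)
  have hcorr₂ := ((isSymbol_corr₂_wedge_three (D := D) (ε := ε) hν).mono
    (hcone.trans openCone_subset_wedge)).of_le hkj
  exact ⟨solutionBound_approx (by linarith) isOpen_openCone hcone hcorr₂,
    errorBound_approx hν isOpen_openCone hcone hcorr₂⟩

theorem solutionBound_and_errorBound_openCone_half (hν : 3 < ν) (t₀ : ℝ) (k j : ℕ) :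
    SolutionBound ν ε (fun t r => approx D ν ε (t, r)) k j (openCone (1 / 2) t₀) ∧
      ErrorBound ν ε (fun t r => approx D ν ε (t, r)) k j (openCone (1 / 2) t₀) := by
  have hcone : openCone (1 / 2) t₀ ⊆ openCone 3 t₀ := openCone_mono (by norm_num)
  have hcorr₂ := (isSymbol_corr₂_wedge_half (D := D) (ε := ε) (n := k + j) hν).mono
    (openCone_subset_wedge (t₀ := t₀))
  exact ⟨solutionBound_approx (by linarith) isOpen_openCone hcone hcorr₂,
    errorBound_approx hν isOpen_openCone hcone hcorr₂⟩

theorem contDiffOn_approx_openCone_half (hν : 3 < ν) :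
    ContDiffOn ℝ ∞ (approx D ν ε) (openCone (1 / 2) t₀) :=
  contDiffOn_infty.2 fun _ => (isSymbol_approx_bulkWeight (by linarith) isOpen_openCone
    (openCone_mono (by norm_num))
    ((isSymbol_corr₂_wedge_half hν).mono openCone_subset_wedge)).contDiffOn

theorem contDiffOn_normError_approx (hν : 3 < ν) :
    ContDiffOn ℝ 2 (fun q => normError ν ε (fun t r => approx D ν ε (t, r)) q.1 q.2)
      (openCone 1 t₀) :=
  (isSymbol_normError_approx hν isOpen_openCone (openCone_mono (by norm_num))
    ((isSymbol_corr₂_wedge_three hν).mono ((openCone_mono (by norm_num)).trans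
      openCone_subset_wedge))).contDiffOn

end Main

end QuinticWave

theorem proposition2p1_general (ν : ℝ) (hν : 3 < ν) (ε₀ : ℝ) :
    ∃ u₂ : ℝ → ℝ → ℝ, ∀ t₀ : ℝ,
      (ContDiffOn ℝ 2 (fun p : ℝ × ℝ => u₂ p.1 p.2) (QuinticWave.cone t₀) ∧
        (∃ C : ℝ, ∀ t r : ℝ, 0 < t → t < t₀ → 0 < r → r < t →
          |u₂ t r - √(QuinticWave.lam ν ε₀ t) * QuinticWave.W (QuinticWave.lam ν ε₀ t * r)| ≤
            C * (√(QuinticWave.lam ν ε₀ t) * (QuinticWave.mu ν ε₀ t ^ 2)⁻¹ *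
              (QuinticWave.lam ν ε₀ t * r))) ∧
        (∃ C : ℝ, ∀ t r : ℝ, 0 < t → t < t₀ → 0 < r → r < t →
          |t ^ 2 * QuinticWave.lam ν ε₀ t ^ (-(1 / 2) : ℝ) * QuinticWave.quinticOp u₂ t r| ≤
            C * ((QuinticWave.mu ν ε₀ t ^ 2)⁻¹ *
              (log (QuinticWave.lam ν ε₀ t * r + 2) / (QuinticWave.lam ν ε₀ t * r + 1))))) ∧
      (ContDiffOn ℝ ∞ (fun p : ℝ × ℝ => u₂ p.1 p.2) (QuinticWave.openCone (1 / 2) t₀) ∧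
        (∀ k j : ℕ,
          QuinticWave.SolutionBound ν ε₀ u₂ k j (QuinticWave.openCone (1 / 2) t₀) ∧
          QuinticWave.ErrorBound ν ε₀ u₂ k j (QuinticWave.openCone (1 / 2) t₀))) ∧
      (ContDiffOn ℝ 2 (fun p : ℝ × ℝ => QuinticWave.normError ν ε₀ u₂ p.1 p.2)
          (QuinticWave.openCone 1 t₀) ∧
        (∀ k j : ℕ, k + j ≤ 2 →
          QuinticWave.SolutionBound ν ε₀ u₂ k j (QuinticWave.openCone 1 t₀) ∧
          QuinticWave.ErrorBound ν ε₀ u₂ k j (QuinticWave.openCone 1 t₀))) ∧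
      (∃ U : ℝ → ℝ → ℝ,
        (∀ t r : ℝ, 0 < t → t < t₀ → 0 ≤ r → r ≤ t → U t r = u₂ t r) ∧
        (∀ t : ℝ, 0 < t → t < t₀ → ContDiffOn ℝ 2 (U t) (Ici 0)) ∧
        ContDiffOn ℝ 1 (fun p : ℝ × ℝ => U p.1 p.2) (Ioo 0 t₀ ×ˢ Ici 0) ∧
        ∀ δ : ℝ, 0 < δ → ∃ t₁ : ℝ, 0 < t₁ ∧ ∀ t : ℝ, 0 < t → t < t₀ → t < t₁ →
          IntegrableOn (QuinticWave.energyDensity U t) (Ici t) ∧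
          ∫ r in Ici t, QuinticWave.energyDensity U t r < δ) := by
  obtain ⟨F₁, β₁, γ₁, h₁⟩ := QuinticWave.exists_isProfile_source₁
  obtain ⟨F₂, β₂, γ₂, h₂⟩ := QuinticWave.exists_isProfile_source₂
  let D : QuinticWave.ProfilePair := ⟨F₁, F₂, β₁, γ₁, β₂, γ₂, h₁, h₂⟩
  refine ⟨fun t r => QuinticWave.approx D ν ε₀ (t, r), fun t₀ => ?_⟩
  have hcutoff := QuinticWave.contDiffOn_cutoffApprox (D := D) (ε := ε₀) hν
  have hbounds (k j : ℕ) (hkj : k + j ≤ 2) :=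
    QuinticWave.solutionBound_and_errorBound_openCone_one (D := D) (ε := ε₀) hν t₀ hkj
  obtain ⟨C, hsolution⟩ := (hbounds 0 0 (by norm_num)).1.exists_abs_sub_bulk_le
  obtain ⟨C', herror⟩ := (hbounds 0 0 (by norm_num)).2.exists_abs_normError_le
  refine ⟨⟨?_, ⟨C, fun t r ht htt₀ hr hrt => ?_⟩, ⟨C', fun t r ht htt₀ hr hrt => ?_⟩⟩,
    ⟨QuinticWave.contDiffOn_approx_openCone_half hν,
      QuinticWave.solutionBound_and_errorBound_openCone_half hν t₀⟩,
    ⟨QuinticWave.contDiffOn_normError_approx hν, hbounds⟩,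
    fun t r => QuinticWave.cutoffApprox D ν ε₀ (t, r), fun t r ht _ _ hr =>
      QuinticWave.cutoffApprox_eq ht hr, fun t ht _ => ?_, ?_, fun δ hδ =>
      QuinticWave.exists_exterior_energy_lt hν t₀ hδ⟩
  · exact (QuinticWave.contDiffOn_approx hν).mono fun q hq => ⟨hq.1, hq.2.2.1⟩
  · exact hsolution t r ⟨ht, htt₀, hr, by simpa using hrt⟩
  · exact herror t r ⟨ht, htt₀, hr, by simpa using hrt⟩
  · exact hcutoff.comp (f := fun r : ℝ => (t, r)) (by fun_prop) fun r hr => ⟨ht, hr⟩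
  · exact (hcutoff.of_le (by norm_num)).mono fun q hq => ⟨hq.1.1, hq.2⟩

theorem proposition2p1 (ν : ℝ) (hν : 3 < ν) :
    ∃ εmax : ℝ, 0 < εmax ∧ ∀ ε₀ : ℝ, |ε₀| < εmax →
    ∃ T : ℝ, 0 < T ∧ ∀ t₀ : ℝ, 0 < t₀ → t₀ < T →
    ∃ u₂ : ℝ → ℝ → ℝ,
      -- (i) regularity, size, and size of the error
      (ContDiffOn ℝ 2 (fun p : ℝ × ℝ => u₂ p.1 p.2) (QuinticWave.cone t₀) ∧
        (∃ C : ℝ, ∀ t r : ℝ, 0 < t → t < t₀ → 0 < r → r < t →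
          |u₂ t r - √(QuinticWave.lam ν ε₀ t) * QuinticWave.W (QuinticWave.lam ν ε₀ t * r)| ≤
            C * (√(QuinticWave.lam ν ε₀ t) * (QuinticWave.mu ν ε₀ t ^ 2)⁻¹ *
              (QuinticWave.lam ν ε₀ t * r))) ∧
        (∃ C : ℝ, ∀ t r : ℝ, 0 < t → t < t₀ → 0 < r → r < t →
          |t ^ 2 * QuinticWave.lam ν ε₀ t ^ (-(1 / 2) : ℝ) * QuinticWave.quinticOp u₂ t r| ≤
            C * ((QuinticWave.mu ν ε₀ t ^ 2)⁻¹ *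
              (log (QuinticWave.lam ν ε₀ t * r + 2) / (QuinticWave.lam ν ε₀ t * r + 1))))) ∧
      -- (ii) symbol bounds of all orders for `r < t/2`
      (ContDiffOn ℝ ∞ (fun p : ℝ × ℝ => u₂ p.1 p.2) (QuinticWave.openCone (1 / 2) t₀) ∧
        (∀ k j : ℕ,
          QuinticWave.SolutionBound ν ε₀ u₂ k j (QuinticWave.openCone (1 / 2) t₀) ∧
          QuinticWave.ErrorBound ν ε₀ u₂ k j (QuinticWave.openCone (1 / 2) t₀))) ∧
      -- (ii) symbol bounds of order at most two for `r < t`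
      (ContDiffOn ℝ 2 (fun p : ℝ × ℝ => QuinticWave.normError ν ε₀ u₂ p.1 p.2)
          (QuinticWave.openCone 1 t₀) ∧
        (∀ k j : ℕ, k + j ≤ 2 →
          QuinticWave.SolutionBound ν ε₀ u₂ k j (QuinticWave.openCone 1 t₀) ∧
          QuinticWave.ErrorBound ν ε₀ u₂ k j (QuinticWave.openCone 1 t₀))) ∧
      -- (iii) extension beyond the light cone with small exterior energy
      (∃ U : ℝ → ℝ → ℝ,
        (∀ t r : ℝ, 0 < t → t < t₀ → 0 ≤ r → r ≤ t → U t r = u₂ t r) ∧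
        (∀ t : ℝ, 0 < t → t < t₀ → ContDiffOn ℝ 2 (U t) (Ici 0)) ∧
        ContDiffOn ℝ 1 (fun p : ℝ × ℝ => U p.1 p.2) (Ioo 0 t₀ ×ˢ Ici 0) ∧
        ∀ δ : ℝ, 0 < δ → ∃ t₁ : ℝ, 0 < t₁ ∧ ∀ t : ℝ, 0 < t → t < t₀ → t < t₁ →
          IntegrableOn (QuinticWave.energyDensity U t) (Ici t) ∧
          ∫ r in Ici t, QuinticWave.energyDensity U t r < δ) :=
  ⟨1, one_pos, fun ε₀ _ => ⟨1, one_pos, fun t₀ _ _ =>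
    (proposition2p1_general ν hν ε₀).imp fun _ h => h t₀⟩⟩
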